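/- Let $d\ge 1$ and let $\Omega\subset\mathbb R^d$ be a bounded open set with Lipschitz boundary. Let $\Omega^-$ be an open set with Lipschitz boundary and $\overline{\Omega^-}\subset\Omega$, and put $\Gamma=\partial\Omega^-$ (the interface) and $\Omega^+=\Omega\setminus\overline{\Omega^-}$, so that $\Omega=\Omega^-\cup\Omega^+\cup\Gamma$. Let $\alpha\ge 0$, $\beta>0$, $f\in L^2(\Omega)$, $c\in L^2(\Gamma)$, $g\in L^2(\partial\Omega)$. Write $dS$ for the surface measure ($(d-1)$-dimensional Hausdorff measure), and let $n$ be the unit normal pointing out of $\Omega^-$ on $\Gamma$ and out of $\Omega$ on $\partial\Omega$ (it exists $dS$-almost everywhere). For $v\in H^1(\Omega)$ define the penalized energy $$\tilde L[v]=\frac12\int_\Omega|\nabla v|^2\,dx+\frac\alpha2\int_\Omega v^2\,dx+\int_\Omega vf\,dx+\int_\Gamma c\,v\,dS+\beta\int_{\partial\Omega}(v-g)^2\,dS,$$ where $\nabla v$ is the weak gradient and the values of $v$ on $\Gamma$ and $\partial\Omega$ are traces. Let $u$ be continuous on $\overline\Omega$ and of class $C^2$ in $\Omega^-$ and in $\Omega^+$,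 and let $\nabla u|_{\Omega^\pm}$ have a continuous extension $(\nabla u)^\pm$ to $\overline{\Omega^\pm}$. Suppose that $$\Delta u-\alpha u=f \text{ a.e. in } \Omega\setminus\Gamma,\qquad (\nabla u)^+\cdot n-(\nabla u)^-\cdot n=c \text{ a.e. on } \Gamma,\qquad u+\frac1{2\beta}(\nabla u)^+\cdot n=g \text{ a.e. on } \partial\Omega.$$ Then $u\in H^1(\Omega)$, and for every $v\in H^1(\Omega)$ $$\tilde L[v]=\tilde L[u]+\frac12\int_\Omega|\nabla(v-u)|^2\,dx+\frac\alpha2\int_\Omega(v-u)^2\,dx+\beta\int_{\partial\Omega}(v-u)^2\,dS.$$ Hence $u$ is the global minimizer of $\tilde L$ over $H^1(\Omega)$: it minimizes $\tilde L$ over $H^1(\Omega)$, and every minimizer of $\tilde L$ over $H^1(\Omega)$ equals $u$ almost everywhere in $\Omega$. -/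

import Mathlib

open MeasureTheory Filter Set
open scoped Topology ContDiff RealInnerProductSpace Laplacian

noncomputable section

/-- `d`-dimensional Euclidean space. -/
abbrev Euc (d : ℕ) := EuclideanSpace ℝ (Fin d)

/-- The surface measure `dS` on a set `S` of dimension `d - 1` in `ℝ^d`: the normalised
`(d-1)`-dimensional Hausdorff measure restricted to `S`. -/
def surfaceMeasure {d : ℕ} (S : Set (Euc d)) : Measure (Euc d) :=
  (Measure.euclideanHausdorffMeasure (d - 1) : Measure (Euc d)).restrict S

/-- A bounded open set with Lipschitz boundary: near each boundary point `x`, the set is the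
region strictly above the graph, in some unit direction `e`, of a Lipschitz function `γ` defined
on the hyperplane orthogonal to `e`. -/
structure IsBoundedLipschitz {d : ℕ} (U : Set (Euc d)) : Prop where
  isOpen : IsOpen U
  isBounded : Bornology.IsBounded U
  boundary : ∀ x ∈ frontier U, ∃ e : Euc d, ‖e‖ = 1 ∧
    ∃ (K : NNReal) (γ : ((ℝ ∙ e)ᗮ : Submodule ℝ (Euc d)) → ℝ), LipschitzWith K γ ∧
      ∀ᶠ y in 𝓝 x, (y ∈ U ↔ γ ((ℝ ∙ e)ᗮ.orthogonalProjectionOnto y) < ⟪e, y⟫)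

/-- `n` is the outward unit normal to `U` at `x`: near `x`, every open cone around `-n` lies in
`U` and every open cone around `n` lies outside `U`. There is at most one such `n`, and for a
Lipschitz boundary there is one at almost every boundary point. -/
def IsOuterUnitNormal {d : ℕ} (U : Set (Euc d)) (x n : Euc d) : Prop :=
  ‖n‖ = 1 ∧ ∀ ε > 0, ∀ᶠ y in 𝓝 x,
    (ε * ‖y - x‖ < ⟪y - x, n⟫ → y ∉ U) ∧ (⟪y - x, n⟫ < -(ε * ‖y - x‖) → y ∈ U)

/-- The gradient of `u` on `U`, extended to the closure of `U` by its limits from inside `U`. -/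
def gradFrom {d : ℕ} (U : Set (Euc d)) (u : Euc d → ℝ) : Euc d → Euc d :=
  extendFrom U (gradient u)

/-- `u` is twice continuously differentiable in the open set `U`, and its gradient has a limit
from inside `U` at every point of the closure of `U`. -/
structure IsC2UpToBoundary {d : ℕ} (U : Set (Euc d)) (u : Euc d → ℝ) : Prop where
  contDiffOn : ContDiffOn ℝ 2 u U
  gradient_tendsto : ∀ x ∈ closure U, ∃ p : Euc d, Tendsto (gradient u) (𝓝[U] x) (𝓝 p)

/-- `G` is a weak gradient of `v` on `Ω` (stated by testing against smooth functions with compact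
support in `Ω`) and is square integrable on `Ω`. -/
structure IsWeakGrad {d : ℕ} (Ω : Set (Euc d)) (v : Euc d → ℝ) (G : Euc d → Euc d) : Prop where
  memLp : MemLp G 2 (volume.restrict Ω)
  integral_eq : ∀ φ : Euc d → ℝ, ContDiff ℝ ∞ φ → HasCompactSupport φ → tsupport φ ⊆ Ω →
    ∫ x in Ω, v x • gradient φ x = -∫ x in Ω, φ x • G x

/-- Membership in the Sobolev space `H¹(Ω)`. -/
def MemH1 {d : ℕ} (Ω : Set (Euc d)) (v : Euc d → ℝ) : Prop :=
  MemLp v 2 (volume.restrict Ω) ∧ ∃ G, IsWeakGrad Ω v G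

open Classical in
/-- The weak gradient of `v` on `Ω`, which is unique almost everywhere on `Ω`
(zero if there is none). -/
def weakGrad {d : ℕ} (Ω : Set (Euc d)) (v : Euc d → ℝ) : Euc d → Euc d :=
  if h : ∃ G, IsWeakGrad Ω v G then h.choose else 0

/-- `T` is the trace on `S ⊆ closure Ω` of `v ∈ H¹(Ω)`: some sequence of smooth functions
converges to `v` in `H¹(Ω)` while its restrictions to `S` converge to `T` in `L²(S)`. -/
def IsTrace {d : ℕ} (Ω S : Set (Euc d)) (v T : Euc d → ℝ) : Prop :=
  MemLp T 2 (surfaceMeasure S) ∧ ∃ φ : ℕ → Euc d → ℝ, (∀ k, ContDiff ℝ ∞ (φ k)) ∧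
    Tendsto (fun k => eLpNorm (fun x => φ k x - v x) 2 (volume.restrict Ω)) atTop (𝓝 0) ∧
    Tendsto (fun k => eLpNorm (fun x => gradient (φ k) x - weakGrad Ω v x) 2
      (volume.restrict Ω)) atTop (𝓝 0) ∧
    Tendsto (fun k => eLpNorm (fun x => φ k x - T x) 2 (surfaceMeasure S)) atTop (𝓝 0)

open Classical in
/-- The trace of `v` on `S` (zero if there is none). For Lipschitz `Ω` and for `S` the boundary
of `Ω`, or of a Lipschitz set whose closure lies in `Ω`, every `v ∈ H¹(Ω)` has a trace, which is
unique almost everywhere on `S`. -/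
def trace {d : ℕ} (Ω S : Set (Euc d)) (v : Euc d → ℝ) : Euc d → ℝ :=
  if h : ∃ T, IsTrace Ω S v T then h.choose else 0

/-- The penalized energy of `v ∈ H¹(Ω)`. -/
def penalizedEnergy {d : ℕ} (Ω Γ : Set (Euc d)) (α β : ℝ) (f c g v : Euc d → ℝ) : ℝ :=
  (1 / 2) * (∫ x in Ω, ‖weakGrad Ω v x‖ ^ 2) + (α / 2) * (∫ x in Ω, v x ^ 2)
    + (∫ x in Ω, v x * f x)
    + (∫ s, c s * trace Ω Γ v s ∂(surfaceMeasure Γ))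
    + β * (∫ s, (trace Ω (frontier Ω) v s - g s) ^ 2 ∂(surfaceMeasure (frontier Ω)))

end

/-!
The proof is the Dirichlet principle.  Multiplying the equation by a smooth `φ`, integrating by parts
on both sides of the interface `Γ`, and inserting the jump and Robin conditions gives the weak form
`∫_Ω ⟪∇u, ∇φ⟫ + ∫_Ω φ (αu + f) + ∫_Γ φ c + 2β ∫_∂Ω φ (u - g) = 0` (`green_interface`, `weak_form`).
Each term depends continuously on `φ` in the `H¹` norm, so the weak form extends to all test functions in `H¹`
by density (`weak_form_memH1`).  The energy is quadratic, and its first-order part at `u` is exactly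
the weak form; hence the expansion of the energy at `u` (`penalizedEnergy_add`).  Its remainder is
nonnegative, so `u` is a minimizer.  For another minimizer `w` the remainder vanishes, so `w - u` has
zero gradient and zero boundary trace, and Friedrichs' inequality gives `w = u`
(`ae_eq_zero_of_weakGrad_of_trace`); since `β > 0`, this works for `α = 0` too.

The analytic background is developed for Lipschitz domains as follows.

* Surface integrals are computed in charts by the area formula for Lipschitz graphs
  (`hausdorffMeasure_restrict_range_graphMap`), obtained by covering the graph with pieces on which
  it is close to linear.
* The field `∇u` is only continuous up to the boundary, and its divergence only known to be
  integrable.  The divergence theorem for such fields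
  (`integral_inner_gradient_add_integral_mul_divergence`) is proved by testing with
  `φ · step(q / ε)`, where `q` is the height above the graph, and letting `ε → 0`: the gradient of the
  step concentrates on the graph.
* Statements about smooth functions are reduced to functions supported in a chart by a partition of
  unity (`induction_on_small_support`).  In this way the divergence theorem yields Green's formula,
  the trace inequality and Friedrichs' inequality.
* Smooth functions are dense in `H¹` (`IsWeakGrad.exists_isSmoothApprox`): near a boundary point the
  mollifying kernel is supported in a cone, so that its translates stay inside the domain.
* With the trace inequality, density gives existence, additivity and uniqueness of traces
  (`IsTraceSurface.isTrace_trace`, `IsTraceSurface.trace_add`, `IsTraceSurface.tendsto_trace`), and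
  the trace of a function continuous up to the boundary is its restriction
  (`IsTraceSurface.trace_eq`).
* The classical gradient of `u` off `Γ` is its weak gradient, by continuity of `u` across `Γ`
  (`isWeakGrad_gradient`).
-/

open MeasureTheory Filter Set
open scoped Topology ContDiff RealInnerProductSpace Laplacian
open scoped NNReal ENNReal Manifold Convolution

noncomputable section

/-! ### Graphs over a hyperplane and the area formula -/

/-- The hyperplane orthogonal to `e`. -/
abbrev Hyper {d : ℕ} (e : Euc d) : Submodule ℝ (Euc d) := (ℝ ∙ e)ᗮ

/-- The parametrisation `x ↦ x + γ(x) e` of the graph of `γ` in direction `e`. -/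
def graphMap {d : ℕ} (e : Euc d) (γ : Hyper e → ℝ) (x : Hyper e) : Euc d := (x : Euc d) + γ x • e

/-- The area density `√(1 + |∇γ|²)` of the graph of `γ`. -/
def areaDensity {d : ℕ} {e : Euc d} (γ : Hyper e → ℝ) (x : Hyper e) : ℝ :=
  √(1 + ‖fderiv ℝ γ x‖ ^ 2)

theorem inner_hyper_left {d : ℕ} {e : Euc d} (x : Hyper e) : ⟪e, (x : Euc d)⟫ = 0 :=
  Submodule.mem_orthogonal_singleton_iff_inner_right.1 x.2

theorem inner_hyper_right {d : ℕ} {e : Euc d} (x : Hyper e) : ⟪(x : Euc d), e⟫ = 0 := by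
  rw [real_inner_comm, inner_hyper_left]

theorem norm_sq_hyper_add_smul {d : ℕ} {e : Euc d} (he : ‖e‖ = 1) (x : Hyper e) (s : ℝ) :
    ‖(x : Euc d) + s • e‖ ^ 2 = ‖x‖ ^ 2 + s ^ 2 := by
  rw [norm_add_sq_real, inner_smul_right, inner_hyper_right, norm_smul, he]
  simp

theorem one_add_sq_sqrt_le {a b δ : ℝ} (ha : 0 ≤ a) (hb : 0 ≤ b) (hδ : 0 ≤ δ) (h : a ≤ b + δ) :
    √(1 + a ^ 2) ≤ (1 + δ) * √(1 + b ^ 2) := by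
  have h1 : √(1 + b ^ 2) ^ 2 = 1 + b ^ 2 := Real.sq_sqrt (by positivity)
  have h2 : b ≤ √(1 + b ^ 2) := Real.le_sqrt_of_sq_le (by linarith)
  have h3 : 1 ≤ √(1 + b ^ 2) := Real.one_le_sqrt.2 (by nlinarith)
  apply Real.sqrt_le_iff.2 ⟨by positivity, ?_⟩
  nlinarith [mul_nonneg hδ hb, mul_nonneg hδ (sub_nonneg.2 h2), mul_nonneg hδ hδ,
    mul_nonneg (mul_nonneg hδ hδ) (sub_nonneg.2 h3)]

/-- The volume factor of the linear graph map `x ↦ x + L(x) e` is `√(1 + |L|²)`. -/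
theorem normDet_linear_graph {d : ℕ} {e : Euc d} (he : ‖e‖ = 1) (L : Hyper e →L[ℝ] ℝ) :
    ((Hyper e).subtype + (LinearMap.toSpanSingleton ℝ (Euc d) e).comp L.toLinearMap).normDet
      = √(1 + ‖L‖ ^ 2) := by
  classical
  set f := (Hyper e).subtype + (LinearMap.toSpanSingleton ℝ (Euc d) e).comp L.toLinearMap with hf
  have key : f.normDet ^ 2 = 1 + ‖L‖ ^ 2 := by
    set a : Hyper e := (InnerProductSpace.toDual ℝ (Hyper e)).symm L with ha
    have hL : ∀ x, L x = ⟪a, x⟫ := fun x => by simp [ha]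
    have hn : ‖L‖ = ‖a‖ := by simp [ha]
    let b := stdOrthonormalBasis ℝ (Hyper e)
    have h := LinearMap.normDet_sq_eq_det_gram f b
    have hgram : Matrix.gram ℝ (fun i => f (b i)) = 1 +
        Matrix.replicateCol Unit (fun i => L (b i)) * Matrix.replicateRow Unit (fun i => L (b i)) := by
      ext i j
      have : ⟪f (b i), f (b j)⟫ = ⟪b i, b j⟫ + L (b i) * L (b j) := by
        simp only [hf, LinearMap.add_apply, Submodule.subtype_apply, LinearMap.comp_apply,
          LinearMap.toSpanSingleton_apply, ContinuousLinearMap.coe_coe]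
        rw [inner_add_left, inner_add_right, inner_add_right, inner_smul_left, inner_smul_right,
          inner_smul_left, inner_smul_right, inner_hyper_left, inner_hyper_right,
          real_inner_self_eq_norm_sq, he]
        simp
      rw [Matrix.gram_apply, this, orthonormal_iff_ite.1 b.orthonormal]
      simp [Matrix.one_apply, Matrix.mul_apply]
    have h2 : f.normDet ^ 2 = (Matrix.gram ℝ (fun i => f (b i))).det := by
      simpa using h
    rw [h2, hgram, Matrix.det_one_add_replicateCol_mul_replicateRow, hn,
      ← real_inner_self_eq_norm_sq, ← b.sum_inner_mul_inner a a]
    congr 1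
    simp only [dotProduct, hL]
    refine Finset.sum_congr rfl fun i _ => ?_
    rw [real_inner_comm a (b i)]
  rw [← key, Real.sqrt_sq (LinearMap.normDet_nonneg f)]

theorem finrank_hyper {d : ℕ} (hd : 1 ≤ d) {e : Euc d} (he : ‖e‖ = 1) :
    Module.finrank ℝ (Hyper e) = d - 1 := by
  have : Fact (Module.finrank ℝ (Euc d) = (d - 1) + 1) := ⟨by simp; omega⟩
  exact Submodule.finrank_orthogonal_span_singleton (by rintro rfl; simp at he)

/-- If `f` expands distances at most `c` times as much as `g` does, then the images of a set under
`f` and `g` have Hausdorff measures in ratio at most `c ^ m`. -/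
theorem euclideanHausdorffMeasure_image_le_image {X Y Z : Type*} [MetricSpace X]
    [MetricSpace Y] [MetricSpace Z] [MeasurableSpace Y] [BorelSpace Y] [MeasurableSpace Z]
    [BorelSpace Z] (m : ℕ) (f : X → Y) (g : X → Z) (c : ℝ≥0) (B : Set X)
    (h : ∀ x ∈ B, ∀ y ∈ B, dist (f x) (f y) ≤ c * dist (g x) (g y)) :
    Measure.euclideanHausdorffMeasure m (f '' B) ≤
      (c : ℝ≥0∞) ^ m * Measure.euclideanHausdorffMeasure m (g '' B) := by
  classical
  rcases B.eq_empty_or_nonempty with rfl | ⟨x₀, hx₀⟩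
  · simp
  have : Nonempty X := ⟨x₀⟩
  have hinv : ∀ z ∈ g '' B, Function.invFunOn g B z ∈ B ∧ g (Function.invFunOn g B z) = z :=
    fun z hz => ⟨Function.invFunOn_mem hz, Function.invFunOn_eq hz⟩
  have hlip : LipschitzOnWith c (fun z => f (Function.invFunOn g B z)) (g '' B) := by
    refine LipschitzOnWith.of_dist_le_mul fun z hz w hw => ?_
    have := h _ (hinv z hz).1 _ (hinv w hw).1
    rwa [(hinv z hz).2, (hinv w hw).2] at this
  have himg : (fun z => f (Function.invFunOn g B z)) '' (g '' B) = f '' B := by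
    rw [image_image]
    refine image_congr fun x hx => ?_
    have h1 := hinv (g x) (mem_image_of_mem g hx)
    have := h _ h1.1 _ hx
    rw [h1.2, dist_self, mul_zero] at this
    exact dist_le_zero.1 this
  have := hlip.hausdorffMeasure_image_le (d := m) (by positivity) (s := g '' B)
  rw [himg] at this
  simp only [Measure.euclideanHausdorffMeasure_def, Measure.smul_apply, ENNReal.smul_def,
    smul_eq_mul]
  rw [ENNReal.rpow_natCast] at this
  calc _ ≤ _ := mul_le_mul_right this _
    _ = _ := by ring

theorem measurable_areaDensity {d : ℕ} {e : Euc d} (γ : Hyper e → ℝ) :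
    Measurable (areaDensity γ) := by
  unfold areaDensity
  exact (((measurable_fderiv ℝ γ).norm.pow_const 2).const_add 1).sqrt

theorem one_le_areaDensity {d : ℕ} {e : Euc d} (γ : Hyper e → ℝ) (x : Hyper e) :
    1 ≤ areaDensity γ x := Real.one_le_sqrt.2 (by nlinarith [sq_nonneg ‖fderiv ℝ γ x‖])

theorem areaDensity_le {d : ℕ} {e : Euc d} {γ : Hyper e → ℝ} {K : ℝ≥0} (hγ : LipschitzWith K γ)
    (x : Hyper e) : areaDensity γ x ≤ √(1 + (K : ℝ) ^ 2) := by
  unfold areaDensity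
  have := norm_fderiv_le_of_lipschitz ℝ hγ (x₀ := x)
  gcongr

theorem norm_le_norm_hyper_add_smul {d : ℕ} {e : Euc d} (he : ‖e‖ = 1) (x : Hyper e) (s : ℝ) :
    ‖x‖ ≤ ‖(x : Euc d) + s • e‖ := by
  apply le_of_sq_le_sq _ (norm_nonneg _)
  rw [norm_sq_hyper_add_smul he]; nlinarith [sq_nonneg s]

theorem orthogonalProjectionOnto_hyper_add_smul {d : ℕ} {e : Euc d} (x : Hyper e) (s : ℝ) :
    (Hyper e).orthogonalProjectionOnto ((x : Euc d) + s • e) = x := by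
  have h1 : (Hyper e).orthogonalProjectionOnto e = 0 :=
    Submodule.orthogonalProjectionOnto_orthogonalComplement_singleton_eq_zero e
  rw [map_add, map_smul, h1, smul_zero, add_zero,
    Submodule.orthogonalProjectionOnto_mem_subspace_eq_self]

theorem inner_hyper_add_smul {d : ℕ} {e : Euc d} (he : ‖e‖ = 1) (x : Hyper e) (s : ℝ) :
    ⟪e, (x : Euc d) + s • e⟫ = s := by
  rw [inner_add_right, inner_hyper_left, inner_smul_right, real_inner_self_eq_norm_sq, he]; simp

theorem hyper_add_inner_smul {d : ℕ} {e : Euc d} (he : ‖e‖ = 1) (y : Euc d) :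
    ((Hyper e).orthogonalProjectionOnto y : Euc d) + ⟪e, y⟫ • e = y := by
  have h : y - ⟪e, y⟫ • e ∈ Hyper e := by
    rw [Submodule.mem_orthogonal_singleton_iff_inner_right, inner_sub_right, inner_smul_right,
      real_inner_self_eq_norm_sq, he]
    simp
  have h2 := orthogonalProjectionOnto_hyper_add_smul (⟨_, h⟩ : Hyper e) ⟪e, y⟫
  simp only [sub_add_cancel] at h2
  rw [h2]; simp

theorem isClosedEmbedding_graphMap {d : ℕ} {e : Euc d} {γ : Hyper e → ℝ}
    (hγ : Continuous γ) : Topology.IsClosedEmbedding (graphMap e γ) := by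
  have h1 : Continuous (graphMap e γ) := by unfold graphMap; fun_prop
  have h3 : Function.LeftInverse (Hyper e).orthogonalProjectionOnto (graphMap e γ) :=
    fun x => orthogonalProjectionOnto_hyper_add_smul x _
  exact h3.isClosedEmbedding (by fun_prop) h1

/-- Version of `ApproximatesLinearOn.norm_fderiv_sub_le` for scalar functions, obtained from it by
composing with `t ↦ t • w` for a unit vector `w`. -/
theorem ApproximatesLinearOn.norm_fderiv_sub_le_real {V : Type*} [NormedAddCommGroup V]
    [InnerProductSpace ℝ V] [FiniteDimensional ℝ V] [MeasurableSpace V] [BorelSpace V]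
    {f : V → ℝ} {A : V →L[ℝ] ℝ} {s : Set V} {δ : ℝ≥0} (hf : ApproximatesLinearOn f A s δ)
    (hs : MeasurableSet s) (hf' : ∀ x ∈ s, HasFDerivWithinAt f (fderiv ℝ f x) s x) :
    ∀ᵐ x ∂(volume : Measure V).restrict s, ‖fderiv ℝ f x - A‖₊ ≤ δ := by
  rcases subsingleton_or_nontrivial V with hV | hV
  · refine Eventually.of_forall fun x => ?_
    have : fderiv ℝ f x - A = 0 := by
      ext y; rw [Subsingleton.elim y 0]; simp
    rw [this]; simp
  obtain ⟨w, hw⟩ := exists_norm_eq V zero_le_one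
  have h1 : ApproximatesLinearOn (fun x => f x • w) (A.smulRight w) s δ := by
    intro x hx y hy
    have := hf x hx y hy
    simp only [ContinuousLinearMap.smulRight_apply]
    rw [← sub_smul, ← sub_smul, norm_smul, hw, mul_one]
    exact this
  have h2 := h1.norm_fderiv_sub_le volume hs (fun x => (fderiv ℝ f x).smulRight w)
    (fun x hx => (hf' x hx).smul_const w)
  filter_upwards [h2] with x hx
  have h3 : (fderiv ℝ f x).smulRight w - A.smulRight w = (fderiv ℝ f x - A).smulRight w := by
    ext y; simp [sub_smul]
  rw [h3] at hx
  have h4 : ‖(fderiv ℝ f x - A).smulRight w‖ ≤ δ := hx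
  rw [ContinuousLinearMap.norm_smulRight_apply, hw, mul_one] at h4
  exact h4

/-- On a measurable set, the area of the graph of `γ` is the integral of the area density.  The set
is cut into pieces on which `γ` is so close to a linear map `L` that the graphs of `γ` and of `L`
are bi-Lipschitz with constant `c`; all errors are then powers of `c`, which tends to `1`. -/
theorem hausdorffMeasure_graphMap_image {d : ℕ} (hd : 1 ≤ d) {e : Euc d} (he : ‖e‖ = 1)
    {γ : Hyper e → ℝ} {K : ℝ≥0} (hγ : LipschitzWith K γ) {B : Set (Hyper e)}
    (hB : MeasurableSet B) :
    Measure.euclideanHausdorffMeasure (d - 1) (graphMap e γ '' B) =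
      ∫⁻ x in B, ENNReal.ofReal (areaDensity γ x) := by
  set m := d - 1 with hm
  set ν : Measure (Euc d) := Measure.euclideanHausdorffMeasure m with hν
  have hemb := isClosedEmbedding_graphMap (e := e) hγ.continuous
  have hdist : ∀ (g : Hyper e → ℝ) (x y : Hyper e), dist x y ≤ dist (graphMap e g x) (graphMap e g y) := by
    intro g x y
    have : graphMap e g x - graphMap e g y = ((x - y : Hyper e) : Euc d) + (g x - g y) • e := by
      simp only [graphMap, sub_smul, Submodule.coe_sub]; abel
    rw [dist_eq_norm, dist_eq_norm, this]
    exact norm_le_norm_hyper_add_smul he (x - y) (g x - g y)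
  -- the differentiability set has full measure, also on the graph
  set D : Set (Hyper e) := {x | DifferentiableAt ℝ γ x} with hD
  have hDm : MeasurableSet D := measurableSet_of_differentiableAt ℝ γ
  have hDae : volume Dᶜ = 0 := hγ.ae_differentiableAt
  have hDgr : ν (graphMap e γ '' Dᶜ) = 0 := by
    have h1 := euclideanHausdorffMeasure_image_le_image m (graphMap e γ) (id : Hyper e → Hyper e)
      (1 + K) Dᶜ (fun x _ y _ => by
        have : graphMap e γ x - graphMap e γ y = ((x - y : Hyper e) : Euc d) + (γ x - γ y) • e := by
          simp only [graphMap, sub_smul, Submodule.coe_sub]; abel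
        rw [dist_eq_norm, this]
        refine (norm_add_le _ _).trans ?_
        rw [norm_smul, he, mul_one]
        have := hγ.dist_le_mul x y
        rw [dist_eq_norm] at this
        simp only [id, NNReal.coe_add, NNReal.coe_one, dist_eq_norm, Submodule.coe_norm] at this ⊢
        linarith)
    have h2 : Measure.euclideanHausdorffMeasure m ((id : Hyper e → Hyper e) '' Dᶜ) = 0 := by
      rw [image_id, hm, ← finrank_hyper hd he,
        InnerProductSpace.euclideanHausdorffMeasure_eq_volume, hDae]
    rw [h2, mul_zero] at h1
    exact le_antisymm h1 zero_le
  -- two-sided comparison with a multiplicative error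
  have key : ∀ c : ℝ≥0, 1 < c →
      ν (graphMap e γ '' B) ≤ (c : ℝ≥0∞) ^ (m + 1) * ∫⁻ x in B, ENNReal.ofReal (areaDensity γ x) ∧
      ∫⁻ x in B, ENNReal.ofReal (areaDensity γ x) ≤ (c : ℝ≥0∞) ^ (m + 1) * ν (graphMap e γ '' B) := by
    intro c hc
    set δ : ℝ≥0 := c - 1 with hδ
    have hδ0 : δ ≠ 0 := (tsub_pos_of_lt hc).ne'
    have hcδ : (c : ℝ) = 1 + δ := by
      rw [hδ, NNReal.coe_sub hc.le]; simp
    obtain ⟨t, A, tdisj, tmeas, tcov, tapp, -⟩ :=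
      exists_partition_approximatesLinearOn_of_hasFDerivWithinAt γ D (fderiv ℝ γ)
        (fun x hx => (DifferentiableAt.hasFDerivAt hx).hasFDerivWithinAt) (fun _ => δ) (fun _ => hδ0)
    set p : ℕ → Set (Hyper e) := fun n => (B ∩ D) ∩ t n with hp
    have pm : ∀ n, MeasurableSet (p n) := fun n => (hB.inter hDm).inter (tmeas n)
    have pd : Pairwise (Function.onFun Disjoint p) := fun i j hij =>
      (tdisj hij).mono inter_subset_right inter_subset_right
    have pu : B ∩ D = ⋃ n, p n := by
      rw [hp, ← inter_iUnion, inter_eq_left.2 (inter_subset_right.trans tcov)]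
    have hν1 : ν (graphMap e γ '' B) = ∑' n, ν (graphMap e γ '' p n) := by
      have h1 : ν (graphMap e γ '' B) = ν (graphMap e γ '' (B ∩ D)) := by
        apply le_antisymm _ (measure_mono (image_mono inter_subset_left))
        calc ν (graphMap e γ '' B) ≤ ν (graphMap e γ '' (B ∩ D) ∪ graphMap e γ '' Dᶜ) := by
              apply measure_mono
              rw [← image_union]
              apply image_mono
              intro x hx
              by_cases h : x ∈ D
              · exact Or.inl ⟨hx, h⟩
              · exact Or.inr h
          _ ≤ _ := measure_union_le _ _
          _ = _ := by rw [hDgr, add_zero]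
      rw [h1, pu, image_iUnion, measure_iUnion]
      · intro i j hij
        exact (disjoint_image_iff hemb.injective).2 (pd hij)
      · exact fun n => (hemb.measurableEmbedding.measurableSet_image (s := p n)).2 (pm n)
    have hI : ∫⁻ x in B, ENNReal.ofReal (areaDensity γ x) =
        ∑' n, ∫⁻ x in p n, ENNReal.ofReal (areaDensity γ x) := by
      have h1 : (B ∩ D : Set (Hyper e)) =ᵐ[volume] B := by
        have : ∀ᵐ x : Hyper e, x ∈ D := hDae
        filter_upwards [this] with x hx
        exact propext ⟨fun h => h.1, fun h => ⟨h, hx⟩⟩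
      rw [← setLIntegral_congr h1, pu, lintegral_iUnion pm pd]
    -- comparison on one piece
    have piece : ∀ n,
        ν (graphMap e γ '' p n) ≤ (c : ℝ≥0∞) ^ (m + 1) * ∫⁻ x in p n, ENNReal.ofReal (areaDensity γ x) ∧
        ∫⁻ x in p n, ENNReal.ofReal (areaDensity γ x) ≤ (c : ℝ≥0∞) ^ (m + 1) * ν (graphMap e γ '' p n) := by
      intro n
      have happ : ApproximatesLinearOn γ (A n) (p n) δ :=
        have hps : p n ⊆ D ∩ t n := fun x hx => ⟨hx.1.2, hx.2⟩
        (tapp n).mono_set hps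
      have hlin : ν (graphMap e (A n) '' p n) = ENNReal.ofReal (√(1 + ‖A n‖ ^ 2)) * volume (p n) := by
        rw [← normDet_linear_graph he (A n), hν, hm, ← finrank_hyper hd he,
          ← LinearMap.euclideanHausdorffMeasure_image_eq_normDet_mul_volume]
        rfl
      have hdiff : ∀ x ∈ p n, ∀ y ∈ p n,
          dist (graphMap e γ x - graphMap e (A n) x) (graphMap e γ y - graphMap e (A n) y)
            ≤ δ * dist x y := by
        intro x hx y hy
        have h1 := happ x hx y hy
        have h2 : graphMap e γ x - graphMap e (A n) x - (graphMap e γ y - graphMap e (A n) y)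
            = (γ x - γ y - (A n) (x - y)) • e := by
          simp only [graphMap, map_sub, sub_smul]; abel
        rw [dist_eq_norm, h2, norm_smul, he, mul_one, dist_eq_norm]
        exact h1
      have hc1 : ∀ x ∈ p n, ∀ y ∈ p n,
          dist (graphMap e γ x) (graphMap e γ y) ≤ c * dist (graphMap e (A n) x) (graphMap e (A n) y) := by
        intro x hx y hy
        have h1 := hdiff x hx y hy
        have h2 := hdist (A n) x y
        have h3 := dist_triangle (graphMap e γ x - graphMap e γ y)
          (graphMap e (A n) x - graphMap e (A n) y) 0
        have h4 : (δ : ℝ) * dist x y ≤ δ * dist (graphMap e (A n) x) (graphMap e (A n) y) := by gcongr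
        rw [hcδ]
        simp only [dist_eq_norm, sub_zero] at h1 h2 h3 h4 ⊢
        rw [show graphMap e γ x - graphMap e (A n) x - (graphMap e γ y - graphMap e (A n) y)
          = graphMap e γ x - graphMap e γ y - (graphMap e (A n) x - graphMap e (A n) y) by abel] at h1
        linarith
      have hc2 : ∀ x ∈ p n, ∀ y ∈ p n,
          dist (graphMap e (A n) x) (graphMap e (A n) y) ≤ c * dist (graphMap e γ x) (graphMap e γ y) := by
        intro x hx y hy
        have h1 := hdiff x hx y hy
        have h2 := hdist γ x y
        have h3 := dist_triangle_left (graphMap e (A n) x - graphMap e (A n) y) 0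
          (graphMap e γ x - graphMap e γ y)
        have h4 : (δ : ℝ) * dist x y ≤ δ * dist (graphMap e γ x) (graphMap e γ y) := by gcongr
        rw [hcδ]
        simp only [dist_eq_norm, sub_zero] at h1 h2 h3 h4 ⊢
        rw [show graphMap e γ x - graphMap e (A n) x - (graphMap e γ y - graphMap e (A n) y)
          = graphMap e γ x - graphMap e γ y - (graphMap e (A n) x - graphMap e (A n) y) by abel] at h1
        linarith
      have hae : ∀ᵐ x ∂(volume.restrict (p n)), ‖fderiv ℝ γ x - A n‖₊ ≤ δ :=
        happ.norm_fderiv_sub_le_real (pm n) fun x hx =>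
          (DifferentiableAt.hasFDerivAt hx.1.2).hasFDerivWithinAt
      have hden : ∀ᵐ x ∂(volume.restrict (p n)),
          ENNReal.ofReal (√(1 + ‖A n‖ ^ 2)) ≤ c * ENNReal.ofReal (areaDensity γ x) ∧
          ENNReal.ofReal (areaDensity γ x) ≤ c * ENNReal.ofReal (√(1 + ‖A n‖ ^ 2)) := by
        filter_upwards [hae] with x hx
        have hx' : ‖fderiv ℝ γ x - A n‖ ≤ δ := hx
        have h1 := norm_sub_norm_le (fderiv ℝ γ x) (A n)
        have h2 := norm_sub_norm_le (A n) (fderiv ℝ γ x)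
        rw [norm_sub_rev] at h2
        have hcc : (c : ℝ≥0∞) = ENNReal.ofReal (1 + δ) := by rw [← hcδ]; simp
        rw [hcc, ← ENNReal.ofReal_mul (by positivity), ← ENNReal.ofReal_mul (by positivity)]
        constructor <;> apply ENNReal.ofReal_le_ofReal
        · exact one_add_sq_sqrt_le (by positivity) (by positivity) δ.2 (by linarith)
        · exact one_add_sq_sqrt_le (by positivity) (by positivity) δ.2 (by linarith)
      have hmeas : Measurable fun x => ENNReal.ofReal (areaDensity γ x) :=
        (measurable_areaDensity γ).ennreal_ofReal
      have hi1 : ENNReal.ofReal (√(1 + ‖A n‖ ^ 2)) * volume (p n) ≤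
          c * ∫⁻ x in p n, ENNReal.ofReal (areaDensity γ x) := by
        rw [← setLIntegral_const, ← lintegral_const_mul _ hmeas]
        exact lintegral_mono_ae (hden.mono fun x hx => hx.1)
      have hi2 : ∫⁻ x in p n, ENNReal.ofReal (areaDensity γ x) ≤
          c * (ENNReal.ofReal (√(1 + ‖A n‖ ^ 2)) * volume (p n)) := by
        rw [← setLIntegral_const, ← lintegral_const_mul _ measurable_const]
        exact lintegral_mono_ae (hden.mono fun x hx => hx.2)
      constructor
      · calc _ ≤ (c : ℝ≥0∞) ^ m * ν (graphMap e (A n) '' p n) :=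
              euclideanHausdorffMeasure_image_le_image m _ _ c _ hc1
          _ ≤ (c : ℝ≥0∞) ^ m * (c * ∫⁻ x in p n, ENNReal.ofReal (areaDensity γ x)) := by
              rw [hlin]; gcongr
          _ = _ := by ring
      · calc _ ≤ c * ν (graphMap e (A n) '' p n) := by rw [hlin]; exact hi2
          _ ≤ c * ((c : ℝ≥0∞) ^ m * ν (graphMap e γ '' p n)) := by
              gcongr; exact euclideanHausdorffMeasure_image_le_image m _ _ c _ hc2
          _ = _ := by ring
    rw [hν1, hI, ← ENNReal.tsum_mul_left, ← ENNReal.tsum_mul_left]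
    exact ⟨ENNReal.tsum_le_tsum fun n => (piece n).1, ENNReal.tsum_le_tsum fun n => (piece n).2⟩
  -- let the error tend to one
  have hlim : ∀ a b : ℝ≥0∞, (∀ c : ℝ≥0, 1 < c → a ≤ (c : ℝ≥0∞) ^ (m + 1) * b) → a ≤ b := by
    intro a b h
    have ht : Tendsto (fun c : ℝ≥0 => (c : ℝ≥0∞) ^ (m + 1) * b) (𝓝[>] 1) (𝓝 (1 * b)) := by
      apply ENNReal.Tendsto.mul_const _ (Or.inl one_ne_zero)
      have h2 : Tendsto (fun c : ℝ≥0 => ((c ^ (m + 1) : ℝ≥0) : ℝ≥0∞)) (𝓝 1) (𝓝 (((1 : ℝ≥0) ^ (m + 1) : ℝ≥0) : ℝ≥0∞)) :=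
        ENNReal.tendsto_coe.2 ((continuous_pow (m + 1)).tendsto 1)
      simp only [ENNReal.coe_pow, one_pow, ENNReal.coe_one] at h2
      exact h2.mono_left nhdsWithin_le_nhds
    rw [one_mul] at ht
    exact ge_of_tendsto ht (eventually_nhdsWithin_of_forall fun c hc => h c hc)
  exact le_antisymm (hlim _ _ fun c hc => (key c hc).1) (hlim _ _ fun c hc => (key c hc).2)

/-- **Area formula** for Lipschitz graphs. -/
theorem hausdorffMeasure_restrict_range_graphMap {d : ℕ} (hd : 1 ≤ d) {e : Euc d} (he : ‖e‖ = 1)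
    {γ : Hyper e → ℝ} {K : ℝ≥0} (hγ : LipschitzWith K γ) :
    (Measure.euclideanHausdorffMeasure (d - 1) : Measure (Euc d)).restrict (range (graphMap e γ)) =
      (volume.withDensity fun x => ENNReal.ofReal (areaDensity γ x)).map (graphMap e γ) := by
  have hemb := (isClosedEmbedding_graphMap (e := e) hγ.continuous)
  ext S hS
  have hpre : MeasurableSet (graphMap e γ ⁻¹' S) := hemb.continuous.measurable hS
  rw [Measure.restrict_apply hS, Measure.map_apply hemb.continuous.measurable hS,
    withDensity_apply _ hpre, ← hausdorffMeasure_graphMap_image hd he hγ hpre,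
    image_preimage_eq_inter_range]

theorem integral_range_graphMap {d : ℕ} (hd : 1 ≤ d) {e : Euc d} (he : ‖e‖ = 1)
    {γ : Hyper e → ℝ} {K : ℝ≥0} (hγ : LipschitzWith K γ) (f : Euc d → ℝ) :
    ∫ y in range (graphMap e γ), f y ∂(Measure.euclideanHausdorffMeasure (d - 1)) =
      ∫ x, areaDensity γ x * f (graphMap e γ x) := by
  rw [hausdorffMeasure_restrict_range_graphMap hd he hγ,
    (isClosedEmbedding_graphMap hγ.continuous).measurableEmbedding.integral_map,
    integral_withDensity_eq_integral_toReal_smul (measurable_areaDensity γ).ennreal_ofReal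
      (Eventually.of_forall fun x => ENNReal.ofReal_lt_top)]
  refine integral_congr_ae (Eventually.of_forall fun x => ?_)
  simp only [smul_eq_mul]
  rw [ENNReal.toReal_ofReal (by linarith [one_le_areaDensity γ x])]

/-! ### Coordinates along a graph -/

/-- The coordinates in which the graph of `γ` is flat: `(x, s)` is sent to the point at height `s`
above the point of the graph over `x`. -/
def graphShear {d : ℕ} (e : Euc d) (γ : Hyper e → ℝ) (p : Hyper e × ℝ) : Euc d :=
  (p.1 : Euc d) + (γ p.1 + p.2) • e

/-- In the orthogonal splitting into the hyperplane and the line along `e`, the map is a translation of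
each line. -/
theorem measurePreserving_graphShear {d : ℕ} {e : Euc d} (he : ‖e‖ = 1) {γ : Hyper e → ℝ}
    (hγ : Continuous γ) : MeasurePreserving (graphShear e γ) (volume.prod volume) volume := by
  have h1 : MeasurePreserving (fun p : Hyper e × ℝ => (p.1, γ p.1 + p.2))
      (volume.prod volume) (volume.prod volume) :=
    (MeasurePreserving.id volume).skew_product (g := fun x s => γ x + s)
      (by fun_prop) (Eventually.of_forall fun x => (measurePreserving_add_left volume (γ x)).map_eq)
  have h2 : MeasurePreserving (Prod.swap : Hyper e × ℝ → ℝ × Hyper e)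
      (volume.prod volume) (volume.prod volume) := Measure.measurePreserving_swap
  have h3 : MeasurePreserving (Prod.map (LinearIsometryEquiv.toSpanUnitSingleton e he) id :
      ℝ × Hyper e → _) (volume.prod volume) (volume.prod volume) :=
    (LinearIsometryEquiv.measurePreserving _).prod (MeasurePreserving.id _)
  have h4 := ((ℝ ∙ e).measurePreserving_measurableEquivProd (0 : Euc d)).symm
  rw [InnerProductSpace.euclideanHausdorffMeasure_eq_volume] at h4
  have h5 := h4.comp (h3.comp (h2.comp h1))
  have h6 : graphShear e γ = ((ℝ ∙ e).measurableEquivProd (0 : Euc d)).symm ∘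
      Prod.map (LinearIsometryEquiv.toSpanUnitSingleton e he) id ∘ Prod.swap ∘
        fun p : Hyper e × ℝ => (p.1, γ p.1 + p.2) := by
    funext p
    simp [graphShear, add_comm]
  rw [h6]
  exact h5

/-- The signed height of a point above the graph of `γ`, measured along `e`. -/
def graphHeight {d : ℕ} (e : Euc d) (γ : Hyper e → ℝ) (y : Euc d) : ℝ :=
  ⟪e, y⟫ - γ ((Hyper e).orthogonalProjectionOnto y)

theorem graphHeight_graphShear {d : ℕ} {e : Euc d} (he : ‖e‖ = 1) (γ : Hyper e → ℝ)
    (p : Hyper e × ℝ) : graphHeight e γ (graphShear e γ p) = p.2 := by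
  rw [graphHeight, graphShear, inner_hyper_add_smul he, orthogonalProjectionOnto_hyper_add_smul]
  ring

theorem lipschitzWith_graphHeight {d : ℕ} {e : Euc d} (he : ‖e‖ = 1) {γ : Hyper e → ℝ} {K : ℝ≥0}
    (hγ : LipschitzWith K γ) : LipschitzWith (1 + K) (graphHeight e γ) := by
  refine LipschitzWith.of_dist_le_mul fun x y => ?_
  have h1 : |⟪e, x - y⟫| ≤ ‖x - y‖ := by simpa [he] using abs_real_inner_le_norm e (x - y)
  have h2 := hγ.dist_le_mul ((Hyper e).orthogonalProjectionOnto x)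
    ((Hyper e).orthogonalProjectionOnto y)
  have h3 := (Hyper e).norm_orthogonalProjectionOnto_apply_le (x - y)
  rw [dist_eq_norm ((Hyper e).orthogonalProjectionOnto x), ← map_sub, Real.dist_eq] at h2
  have h4 : (K : ℝ) * ‖(Hyper e).orthogonalProjectionOnto (x - y)‖ ≤ K * ‖x - y‖ := by gcongr
  rw [Real.dist_eq, dist_eq_norm]
  have h5 : graphHeight e γ x - graphHeight e γ y = ⟪e, x - y⟫ -
      (γ ((Hyper e).orthogonalProjectionOnto x) - γ ((Hyper e).orthogonalProjectionOnto y)) := by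
    simp only [graphHeight, inner_sub_right]; ring
  rw [h5]
  refine (abs_sub _ _).trans ?_
  push_cast
  linarith

/-- The vector `e - ∇γ`, normal to the graph of `γ` and pointing to its upper side. -/
def graphConormal {d : ℕ} (e : Euc d) (γ : Hyper e → ℝ) (x : Hyper e) : Euc d :=
  e - (gradient γ x : Hyper e)

theorem norm_graphConormal {d : ℕ} {e : Euc d} (he : ‖e‖ = 1) (γ : Hyper e → ℝ) (x : Hyper e) :
    ‖graphConormal e γ x‖ = areaDensity γ x := by
  have h := norm_sq_hyper_add_smul he (-gradient γ x) 1
  have h2 : graphConormal e γ x = ((-gradient γ x : Hyper e) : Euc d) + (1 : ℝ) • e := by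
    simp only [graphConormal, Submodule.coe_neg, one_smul]; abel
  rw [areaDensity, ← Real.sqrt_sq (norm_nonneg (graphConormal e γ x)), h2, h]
  simp [gradient, add_comm]

/-- The height is differentiable at every point lying over a point of differentiability of `γ`, whether
or not the point is on the graph. -/
theorem hasGradientAt_graphHeight {d : ℕ} {e : Euc d} {γ : Hyper e → ℝ} {y : Euc d}
    (hγ : DifferentiableAt ℝ γ ((Hyper e).orthogonalProjectionOnto y)) :
    HasGradientAt (graphHeight e γ) (graphConormal e γ ((Hyper e).orthogonalProjectionOnto y)) y := by
  have h1 : HasFDerivAt (fun y => ⟪e, y⟫) (innerSL ℝ e) y := (innerSL ℝ e).hasFDerivAt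
  have h2 := hγ.hasFDerivAt.comp y (Hyper e).orthogonalProjectionOnto.hasFDerivAt
  have h3 := h1.sub h2
  rw [hasGradientAt_iff_hasFDerivAt]
  refine h3.congr_fderiv (ContinuousLinearMap.ext fun v => ?_)
  have : ⟪((gradient γ ((Hyper e).orthogonalProjectionOnto y) : Hyper e) : Euc d), v⟫ =
      fderiv ℝ γ ((Hyper e).orthogonalProjectionOnto y) ((Hyper e).orthogonalProjectionOnto v) := by
    rw [← Submodule.inner_orthogonalProjectionOnto_eq_of_mem_left, gradient]
    exact InnerProductSpace.toDual_symm_apply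
  simp only [graphConormal, InnerProductSpace.toDual_apply_apply, inner_sub_left, this]
  rfl

theorem integrable_of_bounded_of_compact {d : ℕ} {F : Type*} [NormedAddCommGroup F]
    {f : Euc d → F} (hf : AEStronglyMeasurable f volume) {S : Set (Euc d)} (hS : IsCompact S)
    {M : ℝ} (hM : ∀ y, ‖f y‖ ≤ M) (h0 : ∀ y, y ∉ S → f y = 0) : Integrable f := by
  rw [← integrableOn_iff_integrable_of_support_subset (s := S)
    (fun y hy => by by_contra h; exact hy (h0 y h))]
  exact Measure.integrableOn_of_bounded hS.measure_lt_top.ne hf (Eventually.of_forall hM)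

theorem LipschitzWith.mul_of_bounded {X : Type*} [PseudoMetricSpace X] {f g : X → ℝ}
    {Cf Cg M N : ℝ≥0} (hf : LipschitzWith Cf f) (hg : LipschitzWith Cg g)
    (hM : ∀ x, |f x| ≤ M) (hN : ∀ x, |g x| ≤ N) :
    LipschitzWith (M * Cg + N * Cf) (fun x => f x * g x) := by
  refine LipschitzWith.of_dist_le_mul fun x y => ?_
  have h1 := hf.dist_le_mul x y
  have h2 := hg.dist_le_mul x y
  rw [Real.dist_eq] at h1 h2 ⊢
  have : f x * g x - f y * g y = f x * (g x - g y) + g y * (f x - f y) := by ring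
  rw [this]
  refine (abs_add_le _ _).trans ?_
  rw [abs_mul, abs_mul]
  push_cast
  calc |f x| * |g x - g y| + |g y| * |f x - f y| ≤ M * (Cg * dist x y) + N * (Cf * dist x y) := by
        gcongr
        · exact hM x
        · exact hN y
    _ = _ := by ring

/-! ### A smooth step function -/

theorem continuous_deriv_smoothTransition : Continuous (deriv Real.smoothTransition) :=
  (Real.smoothTransition.contDiff (n := 1)).continuous_deriv le_rfl

theorem deriv_smoothTransition_of_notMem {t : ℝ} (ht : t ∉ Icc (0 : ℝ) 1) :
    deriv Real.smoothTransition t = 0 := by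
  rw [mem_Icc, not_and_or, not_le, not_le] at ht
  rcases ht with h | h
  · have : Real.smoothTransition =ᶠ[𝓝 t] fun _ => 0 := by
      filter_upwards [Iio_mem_nhds h] with s hs using Real.smoothTransition.zero_of_nonpos hs.le
    rw [this.deriv_eq]; simp
  · have : Real.smoothTransition =ᶠ[𝓝 t] fun _ => 1 := by
      filter_upwards [Ioi_mem_nhds h] with s hs using Real.smoothTransition.one_of_one_le hs.le
    rw [this.deriv_eq]; simp

theorem hasCompactSupport_deriv_smoothTransition :
    HasCompactSupport (deriv Real.smoothTransition) :=
  HasCompactSupport.intro isCompact_Icc fun _ ht => deriv_smoothTransition_of_notMem ht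

theorem integral_deriv_smoothTransition : ∫ t, deriv Real.smoothTransition t = 1 := by
  have hd : Differentiable ℝ Real.smoothTransition :=
    (Real.smoothTransition.contDiff (n := 1)).differentiable one_ne_zero
  rw [integral_of_hasDerivAt_of_tendsto (f := Real.smoothTransition) (m := 0) (n := 1)
    (fun t => (hd t).hasDerivAt)
    (continuous_deriv_smoothTransition.integrable_of_hasCompactSupport
      hasCompactSupport_deriv_smoothTransition), sub_zero]
  · refine tendsto_const_nhds.congr' ?_
    filter_upwards [Iic_mem_atBot (0 : ℝ)] with s hs
    exact (Real.smoothTransition.zero_of_nonpos hs).symm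
  · refine tendsto_const_nhds.congr' ?_
    filter_upwards [Ici_mem_atTop (1 : ℝ)] with s hs
    exact (Real.smoothTransition.one_of_one_le hs).symm

theorem exists_lipschitzWith_smoothTransition : ∃ C : ℝ≥0, LipschitzWith C Real.smoothTransition := by
  obtain ⟨C, hC⟩ := continuous_deriv_smoothTransition.bounded_above_of_compact_support
    hasCompactSupport_deriv_smoothTransition
  refine ⟨C.toNNReal, lipschitzWith_of_nnnorm_deriv_le
    ((Real.smoothTransition.contDiff (n := 1)).differentiable one_ne_zero) fun t => ?_⟩
  rw [← NNReal.coe_le_coe, coe_nnnorm]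
  exact (hC t).trans (Real.le_coe_toNNReal C)

/-! ### The divergence theorem near a Lipschitz boundary -/

/-- `D` is the divergence of the vector field `G` in `U`, in the sense of testing against Lipschitz
functions with compact support in `U`. -/
def HasDivergence {d : ℕ} (U : Set (Euc d)) (G : Euc d → Euc d) (D : Euc d → ℝ) : Prop :=
  ∀ χ : Euc d → ℝ, (∃ C, LipschitzWith C χ) → HasCompactSupport χ → tsupport χ ⊆ U →
    ∫ y, ⟪G y, gradient χ y⟫ = -∫ y, χ y * D y

theorem gradient_eq_zero_of_notMem_tsupport {d : ℕ} {φ : Euc d → ℝ} {y : Euc d}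
    (hy : y ∉ tsupport φ) : gradient φ y = 0 := by
  have h : fderiv ℝ φ y = 0 := by
    by_contra h
    exact hy (support_fderiv_subset ℝ h)
  rw [gradient, h, map_zero]

theorem continuous_gradient {d : ℕ} {φ : Euc d → ℝ} (hφ : ContDiff ℝ ∞ φ) :
    Continuous (gradient φ) :=
  (InnerProductSpace.toDual ℝ (Euc d)).symm.continuous.comp (hφ.continuous_fderiv (by simp))

theorem measurable_gradient {d : ℕ} (φ : Euc d → ℝ) : Measurable (gradient φ) :=
  (InnerProductSpace.toDual ℝ (Euc d)).symm.continuous.measurable.comp (measurable_fderiv ℝ φ)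

theorem norm_gradient_le_of_lipschitz {d : ℕ} {φ : Euc d → ℝ} {C : ℝ≥0} (h : LipschitzWith C φ)
    (y : Euc d) : ‖gradient φ y‖ ≤ C := by
  rw [gradient, LinearIsometryEquiv.norm_map]
  exact norm_fderiv_le_of_lipschitz ℝ h

theorem continuous_graphShear {d : ℕ} {e : Euc d} {γ : Hyper e → ℝ} (hγ : Continuous γ) :
    Continuous (graphShear e γ) := by unfold graphShear; fun_prop

section Flux

variable {d : ℕ} {e : Euc d} {γ : Hyper e → ℝ} {K : ℝ≥0} {σ : ℝ} {U N : Set (Euc d)}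
  {G : Euc d → Euc d} {D φ : Euc d → ℝ}

theorem graphMap_eq_graphShear (x : Hyper e) : graphMap e γ x = graphShear e γ (x, 0) := by
  simp [graphMap, graphShear]

theorem eventually_graphShear_mem (he : ‖e‖ = 1) (hγ : LipschitzWith K γ)
    (hσ : σ = 1 ∨ σ = -1) (hN : IsOpen N) (hchart : ∀ y ∈ N, y ∈ U ↔ 0 < σ * graphHeight e γ y)
    {x : Hyper e} (hx : graphMap e γ x ∈ N) {r : ℝ} (hr : 0 < r) :
    ∀ᶠ ε in 𝓝[>] (0 : ℝ), graphShear e γ (x, σ * ε * r) ∈ N ∩ U := by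
  have hcont : Continuous fun ε : ℝ => graphShear e γ (x, σ * ε * r) :=
    (continuous_graphShear hγ.continuous).comp (by fun_prop)
  have h0 : graphShear e γ (x, σ * 0 * r) ∈ N := by
    simpa [← graphMap_eq_graphShear] using hx
  have h1 : ∀ᶠ ε in 𝓝[>] (0 : ℝ), graphShear e γ (x, σ * ε * r) ∈ N :=
    nhdsWithin_le_nhds (hcont.continuousAt.eventually (hN.mem_nhds h0))
  filter_upwards [h1, self_mem_nhdsWithin] with ε hε hpos
  refine ⟨hε, (hchart _ hε).2 ?_⟩
  rw [graphHeight_graphShear he]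
  have hσ2 : σ * σ = 1 := by rcases hσ with h | h <;> rw [h] <;> norm_num
  have : σ * (σ * ε * r) = ε * r := by linear_combination ε * r * hσ2
  simp only [this]
  exact mul_pos hpos hr

/-- If `U` is, inside `N`, the upper side of the graph (`σ = 1`) or the lower side (`σ = -1`), then the
points of the graph in `N` are limits of points of `U`. -/
theorem graphMap_mem_closure (he : ‖e‖ = 1) (hγ : LipschitzWith K γ)
    (hσ : σ = 1 ∨ σ = -1) (hN : IsOpen N) (hchart : ∀ y ∈ N, y ∈ U ↔ 0 < σ * graphHeight e γ y)
    {x : Hyper e} (hx : graphMap e γ x ∈ N) : graphMap e γ x ∈ closure U := by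
  have hcont : Continuous fun ε : ℝ => graphShear e γ (x, σ * ε * 1) :=
    (continuous_graphShear hγ.continuous).comp (by fun_prop)
  have h1 : Tendsto (fun ε : ℝ => graphShear e γ (x, σ * ε * 1)) (𝓝[>] 0) (𝓝 (graphMap e γ x)) := by
    have := (hcont.tendsto 0).mono_left (nhdsWithin_le_nhds (s := Ioi 0))
    simpa [← graphMap_eq_graphShear] using this
  exact mem_closure_of_tendsto h1
    ((eventually_graphShear_mem he hγ hσ hN hchart hx one_pos).mono fun _ h => h.2)

/-- The extension by zero of `φ G` from the closure of `U` is continuous on approach to the graph from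
the side of `U`, along the lines in direction `e`. -/
theorem tendsto_indicator_graphShear (he : ‖e‖ = 1) (hγ : LipschitzWith K γ)
    (hσ : σ = 1 ∨ σ = -1) (hN : IsOpen N) (hchart : ∀ y ∈ N, y ∈ U ↔ 0 < σ * graphHeight e γ y)
    (hG : ContinuousOn G (closure U)) (hφ : Continuous φ) (hs : tsupport φ ⊆ N)
    (x : Hyper e) {r : ℝ} (hr : 0 < r) :
    Tendsto (fun ε => (closure U).indicator (fun y => φ y • G y) (graphShear e γ (x, σ * ε * r)))
      (𝓝[>] 0) (𝓝 (φ (graphMap e γ x) • G (graphMap e γ x))) := by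
  have hcont : Continuous fun ε : ℝ => graphShear e γ (x, σ * ε * r) :=
    (continuous_graphShear hγ.continuous).comp (by fun_prop)
  have hlim : Tendsto (fun ε : ℝ => graphShear e γ (x, σ * ε * r)) (𝓝[>] 0)
      (𝓝 (graphMap e γ x)) := by
    have := (hcont.tendsto 0).mono_left (nhdsWithin_le_nhds (s := Ioi 0))
    simpa [← graphMap_eq_graphShear] using this
  by_cases hx : graphMap e γ x ∈ N
  · have hcl := graphMap_mem_closure he hγ hσ hN hchart hx
    have hev := eventually_graphShear_mem he hγ hσ hN hchart hx hr
    have h2 : Tendsto (fun ε : ℝ => graphShear e γ (x, σ * ε * r)) (𝓝[>] 0)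
        (𝓝[closure U] (graphMap e γ x)) :=
      tendsto_nhdsWithin_iff.2 ⟨hlim, hev.mono fun _ h => subset_closure h.2⟩
    have h3 := ((hφ.continuousOn.smul hG) _ hcl).tendsto.comp h2
    refine h3.congr' (hev.mono fun ε h => ?_)
    simp only [indicator_of_mem (subset_closure h.2)]
    rfl
  · have hx2 : graphMap e γ x ∉ tsupport φ := fun h => hx (hs h)
    rw [image_eq_zero_of_notMem_tsupport hx2, zero_smul]
    refine tendsto_const_nhds.congr' ?_
    filter_upwards [hlim.eventually ((isClosed_tsupport φ).isOpen_compl.mem_nhds hx2)] with ε hε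
    have h0 : φ (graphShear e γ (x, σ * ε * r)) = 0 := image_eq_zero_of_notMem_tsupport hε
    refine (indicator_apply_eq_zero.2 fun _ => ?_).symm
    rw [h0, zero_smul]

/-- The test function for the divergence theorem: `φ` cut off below height `ε`. The second term of its
gradient lives in the boundary layer between the heights `ε` and `2ε`. -/
theorem gradient_mul_step {ε : ℝ} {y : Euc d} (hφ : DifferentiableAt ℝ φ y)
    (hq : DifferentiableAt ℝ (graphHeight e γ) y) :
    gradient (fun y => φ y * Real.smoothTransition (σ * graphHeight e γ y / ε - 1)) y =
      Real.smoothTransition (σ * graphHeight e γ y / ε - 1) • gradient φ y +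
      (φ y * (deriv Real.smoothTransition (σ * graphHeight e γ y / ε - 1) * (σ / ε))) •
        gradient (graphHeight e γ) y := by
  have hη : HasDerivAt Real.smoothTransition
      (deriv Real.smoothTransition (σ * graphHeight e γ y / ε - 1))
      (σ * graphHeight e γ y / ε - 1) :=
    ((Real.smoothTransition.contDiff (n := 1)).differentiable one_ne_zero _).hasDerivAt
  have h1 := (hq.hasFDerivAt.const_mul (σ / ε)).sub_const 1
  have h2 : (fun y => σ / ε * graphHeight e γ y - 1) = fun y => σ * graphHeight e γ y / ε - 1 := by
    funext z; ring
  rw [h2] at h1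
  have h3 := hφ.hasFDerivAt.mul (hη.comp_hasFDerivAt y h1)
  have h4 : HasGradientAt (fun y => φ y * Real.smoothTransition (σ * graphHeight e γ y / ε - 1)) _ y :=
    h3.hasGradientAt
  rw [h4.gradient]
  simp only [gradient, map_add, map_smulₛₗ]
  simp only [smul_smul, conj_trivial, Function.comp]
  rw [add_comm]

theorem integrable_boundary_layer (he : ‖e‖ = 1) (hγ : LipschitzWith K γ)
    {W : Euc d → Euc d} (hWm : Measurable W)
    {M : ℝ} (hM : ∀ y, ‖W y‖ ≤ M) {R : ℝ} (hR : ∀ y, W y ≠ 0 → ‖y‖ ≤ R) (ε : ℝ) :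
    Integrable (fun y => (σ / ε) * deriv Real.smoothTransition (σ * graphHeight e γ y / ε - 1) *
      ⟪W y, gradient (graphHeight e γ) y⟫) := by
  have hθc := continuous_deriv_smoothTransition
  obtain ⟨Cθ, hCθ⟩ := hθc.bounded_above_of_compact_support hasCompactSupport_deriv_smoothTransition
  have hqL := lipschitzWith_graphHeight he hγ
  have hM0 : 0 ≤ M := (norm_nonneg _).trans (hM 0)
  have hCθ0 : 0 ≤ Cθ := (norm_nonneg _).trans (hCθ 0)
  refine integrable_of_bounded_of_compact (S := Metric.closedBall 0 R)
    (M := |σ / ε| * Cθ * (M * (1 + K))) ?_ (isCompact_closedBall 0 R) ?_ ?_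
  · refine AEStronglyMeasurable.mul ?_ ?_
    · refine Continuous.aestronglyMeasurable ?_
      have := hqL.continuous
      fun_prop
    · exact hWm.aestronglyMeasurable.inner (measurable_gradient _).aestronglyMeasurable
  · intro y
    rw [norm_mul, norm_mul]
    gcongr
    · exact le_rfl
    · exact hCθ _
    · refine (norm_inner_le_norm _ _).trans ?_
      gcongr
      · exact hM y
      · have := norm_gradient_le_of_lipschitz hqL y
        simpa using this
  · intro y hy
    have : W y = 0 := by
      by_contra h
      exact hy (by simpa using hR y h)
    rw [this, inner_zero_left, mul_zero]

/-- The gradient of the step function lives in the layer where the height, measured towards `U`, lies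
between `ε` and `2ε`, and concentrates on the graph as `ε → 0`. -/
theorem tendsto_boundary_layer (he : ‖e‖ = 1) (hγ : LipschitzWith K γ)
    (hσ : σ = 1 ∨ σ = -1) {W : Euc d → Euc d} (hWm : Measurable W)
    {M : ℝ} (hM : ∀ y, ‖W y‖ ≤ M) {R : ℝ} (hR : ∀ y, W y ≠ 0 → ‖y‖ ≤ R)
    {W₀ : Hyper e → Euc d}
    (hlim : ∀ x, ∀ r > 0, Tendsto (fun ε => W (graphShear e γ (x, σ * ε * r))) (𝓝[>] 0) (𝓝 (W₀ x))) :
    Tendsto (fun ε => ∫ y, (σ / ε) * deriv Real.smoothTransition (σ * graphHeight e γ y / ε - 1) *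
      ⟪W y, gradient (graphHeight e γ) y⟫) (𝓝[>] 0)
      (𝓝 (σ * ∫ x, ⟪W₀ x, graphConormal e γ x⟫)) := by
  set θ := deriv Real.smoothTransition with hθ
  have hσ2 : σ * σ = 1 := by rcases hσ with h | h <;> rw [h] <;> norm_num
  have hσa : |σ| = 1 := by rcases hσ with h | h <;> rw [h] <;> norm_num
  have hθc : Continuous θ := continuous_deriv_smoothTransition
  obtain ⟨Cθ, hCθ⟩ := hθc.bounded_above_of_compact_support hasCompactSupport_deriv_smoothTransition
  have hqL := lipschitzWith_graphHeight he hγ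
  have hM0 : 0 ≤ M := (norm_nonneg _).trans (hM 0)
  have hCθ0 : 0 ≤ Cθ := (norm_nonneg _).trans (hCθ 0)
  have hmp := measurePreserving_graphShear he hγ.continuous
  have hθi : Integrable fun r => θ (r - 1) :=
    (hθc.integrable_of_hasCompactSupport hasCompactSupport_deriv_smoothTransition).comp_sub_right 1
  have hθ1 : ∫ r, θ (r - 1) = 1 := by
    rw [integral_sub_right_eq_self θ 1, hθ, integral_deriv_smoothTransition]
  have hW : AEStronglyMeasurable W volume := hWm.aestronglyMeasurable
  have hcn : ∀ x, ‖graphConormal e γ x‖ ≤ √(1 + (K : ℝ) ^ 2) := fun x => by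
    rw [norm_graphConormal he]; exact areaDensity_le hγ x
  set A := √(1 + (K : ℝ) ^ 2) with hA
  have hA0 : 0 ≤ A := Real.sqrt_nonneg _
  -- the inner integral after rescaling the height by `σ ε`
  set I : ℝ → Hyper e → ℝ := fun ε x =>
    ∫ r, θ (r - 1) * ⟪W (graphShear e γ (x, σ * ε * r)), graphConormal e γ x⟫ with hI
  have hFint := fun ε (_ : ε > 0) => integrable_boundary_layer (σ := σ) he hγ hWm hM hR ε
  have hrew : ∀ ε > 0, ∀ᵐ x : Hyper e,
      ∫ s, (σ / ε) * θ (σ * graphHeight e γ (graphShear e γ (x, s)) / ε - 1) *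
        ⟪W (graphShear e γ (x, s)), gradient (graphHeight e γ) (graphShear e γ (x, s))⟫
      = σ * I ε x := by
    intro ε hε
    filter_upwards [hγ.ae_differentiableAt] with x hx
    have h1 : ∀ s, gradient (graphHeight e γ) (graphShear e γ (x, s)) = graphConormal e γ x := by
      intro s
      have hp : (Hyper e).orthogonalProjectionOnto (graphShear e γ (x, s)) = x :=
        orthogonalProjectionOnto_hyper_add_smul x _
      have := (hasGradientAt_graphHeight (e := e) (γ := γ) (y := graphShear e γ (x, s))
        (by rw [hp]; exact hx)).gradient
      rw [this, hp]
    simp_rw [h1, graphHeight_graphShear he]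
    have h2 := Measure.integral_comp_mul_left (fun s => (σ / ε) * θ (σ * s / ε - 1) *
      ⟪W (graphShear e γ (x, s)), graphConormal e γ x⟫) (σ * ε)
    have h3 : |(σ * ε)⁻¹| = ε⁻¹ := by
      rw [abs_inv, abs_mul, hσa, one_mul, abs_of_pos hε]
    rw [h3, smul_eq_mul, eq_inv_mul_iff_mul_eq₀ hε.ne'] at h2
    rw [← h2, hI, ← integral_const_mul, ← integral_const_mul]
    refine integral_congr_ae (Eventually.of_forall fun r => ?_)
    have h4 : σ * (σ * ε * r) / ε - 1 = r - 1 := by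
      field_simp; linear_combination r * hσ2
    simp only [h4]
    field_simp
  have hprod : ∀ ε > 0, ∫ y, (σ / ε) * θ (σ * graphHeight e γ y / ε - 1) *
      ⟪W y, gradient (graphHeight e γ) y⟫ = ∫ x, σ * I ε x := by
    intro ε hε
    have hi := hFint ε hε
    rw [← hmp.map_eq] at hi ⊢
    rw [integral_map hmp.measurable.aemeasurable hi.1, integral_prod]
    · exact integral_congr_ae (hrew ε hε)
    · exact (integrable_map_measure hi.1 hmp.measurable.aemeasurable).1 hi
  have hImeas : ∀ ε > 0, AEStronglyMeasurable (fun x => σ * I ε x) volume := by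
    intro ε hε
    have hi := hFint ε hε
    rw [← hmp.map_eq] at hi
    have h2 := ((integrable_map_measure hi.1 hmp.measurable.aemeasurable).1 hi).integral_prod_left
    exact h2.1.congr (hrew ε hε)
  have hIlim : ∀ x, Tendsto (fun ε => I ε x) (𝓝[>] 0) (𝓝 ⟪W₀ x, graphConormal e γ x⟫) := by
    intro x
    have : ⟪W₀ x, graphConormal e γ x⟫ = ∫ r, θ (r - 1) * ⟪W₀ x, graphConormal e γ x⟫ := by
      rw [integral_mul_const, hθ1, one_mul]
    rw [this]
    refine tendsto_integral_filter_of_dominated_convergence (fun r => |θ (r - 1)| * (M * A))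
      (Eventually.of_forall fun ε => ?_) (Eventually.of_forall fun ε =>
        Eventually.of_forall fun r => ?_) (hθi.abs.mul_const _) (Eventually.of_forall fun r => ?_)
    · have h1 : Measurable fun r : ℝ => W (graphShear e γ (x, σ * ε * r)) :=
        hWm.comp ((continuous_graphShear hγ.continuous).measurable.comp (by fun_prop))
      exact ((hθc.measurable.comp (measurable_id.sub_const 1)).mul
        (h1.inner measurable_const)).aestronglyMeasurable
    · rw [norm_mul]
      refine mul_le_mul_of_nonneg_left ?_ (norm_nonneg _)
      refine (norm_inner_le_norm _ _).trans ?_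
      gcongr
      · exact hM _
      · exact hcn x
    · by_cases hr : 0 < r
      · exact ((hlim x r hr).inner tendsto_const_nhds).const_mul _
      · have : θ (r - 1) = 0 := deriv_smoothTransition_of_notMem fun h => hr (by linarith [h.1])
        simp only [this, zero_mul]
        exact tendsto_const_nhds
  rw [← integral_const_mul]
  have hev : (fun ε => ∫ y, (σ / ε) * θ (σ * graphHeight e γ y / ε - 1) *
      ⟪W y, gradient (graphHeight e γ) y⟫) =ᶠ[𝓝[>] 0] fun ε => ∫ x, σ * I ε x :=
    eventually_nhdsWithin_of_forall fun ε hε => hprod ε hε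
  refine Tendsto.congr' hev.symm ?_
  refine tendsto_integral_filter_of_dominated_convergence
    ((Metric.closedBall (0 : Hyper e) R).indicator fun _ => (∫ r, |θ (r - 1)|) * (M * A)) ?_ ?_ ?_ ?_
  · exact eventually_nhdsWithin_of_forall hImeas
  · refine Eventually.of_forall fun ε => Eventually.of_forall fun x => ?_
    rw [norm_mul, Real.norm_eq_abs σ, hσa, one_mul]
    by_cases hx : x ∈ Metric.closedBall (0 : Hyper e) R
    · rw [indicator_of_mem hx, ← integral_mul_const]
      refine norm_integral_le_of_norm_le (hθi.abs.mul_const _) (Eventually.of_forall fun r => ?_)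
      rw [norm_mul]
      refine mul_le_mul_of_nonneg_left ?_ (norm_nonneg _)
      refine (norm_inner_le_norm _ _).trans ?_
      gcongr
      · exact hM _
      · exact hcn x
    · rw [indicator_of_notMem hx]
      have : I ε x = 0 := by
        rw [hI]
        refine integral_eq_zero_of_ae (Eventually.of_forall fun r => ?_)
        have hW0 : W (graphShear e γ (x, σ * ε * r)) = 0 := by
          by_contra h
          apply hx
          rw [mem_closedBall_zero_iff]
          exact (norm_le_norm_hyper_add_smul he x _).trans (hR _ h)
        simp [hW0]
      rw [this, norm_zero]
  · rw [integrable_indicator_iff measurableSet_closedBall]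
    exact integrableOn_const (isCompact_closedBall (0 : Hyper e) R).measure_lt_top.ne
  · exact Eventually.of_forall fun x => (hIlim x).const_mul σ

/-- **Divergence theorem near a Lipschitz boundary.** For a vector field continuous up to the
boundary, tested against a function supported in a chart of the boundary, the flux through the
boundary is expressed in the coordinates of the chart.  The sign `σ` tells on which side of the
graph the domain lies.  The divergence identity is applied to `φ χ`, where `χ` is a step function of
the height above the graph that rises from `0` to `1` in a thin layer along the boundary. -/
theorem integral_inner_gradient_add_integral_mul_divergence (he : ‖e‖ = 1)
    (hγ : LipschitzWith K γ) (hσ : σ = 1 ∨ σ = -1) (hU : IsOpen U) (hN : IsOpen N)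
    (hchart : ∀ y ∈ N, y ∈ U ↔ 0 < σ * graphHeight e γ y) (hG : ContinuousOn G (closure U))
    (hdiv : HasDivergence U G D) (hφ : ContDiff ℝ ∞ φ) (hφc : HasCompactSupport φ)
    (hs : tsupport φ ⊆ N) (hD : IntegrableOn (fun y => φ y * D y) U) :
    (∫ y in U, ⟪G y, gradient φ y⟫) + ∫ y in U, φ y * D y =
      -(σ * ∫ x, φ (graphMap e γ x) * ⟪G (graphMap e γ x), graphConormal e γ x⟫) := by
  set θ := deriv Real.smoothTransition with hθ
  have hqL := lipschitzWith_graphHeight he hγ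
  have hφd : Differentiable ℝ φ := hφ.differentiable (by simp)
  have hσa : |σ| = 1 := by rcases hσ with h | h <;> rw [h] <;> norm_num
  have hGm : Measurable ((closure U).indicator G) := by
    classical
    rw [← piecewise_eq_indicator]
    exact hG.measurable_piecewise continuousOn_const isClosed_closure.measurableSet
  have hScomp : IsCompact (tsupport φ ∩ closure U) := hφc.isCompact.inter_right isClosed_closure
  obtain ⟨MG, hMG⟩ := hScomp.exists_bound_of_continuousOn (hG.mono inter_subset_right)
  obtain ⟨Mφ, hMφ⟩ := hφ.continuous.bounded_above_of_compact_support hφc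
  obtain ⟨Cφ, hCφ⟩ : ∃ C, LipschitzWith C φ :=
    ContDiff.lipschitzWith_of_hasCompactSupport hφc hφ (by simp)
  obtain ⟨Cη, hCη⟩ := exists_lipschitzWith_smoothTransition
  have hMφ0 : 0 ≤ Mφ := (norm_nonneg _).trans (hMφ 0)
  set W : Euc d → Euc d := (closure U).indicator (fun y => φ y • G y) with hW
  have hWm : Measurable W := by
    have : W = fun y => φ y • (closure U).indicator G y := by
      funext y; rw [hW]; exact indicator_smul_apply (closure U) φ G y
    rw [this]
    exact hφ.continuous.measurable.smul hGm
  have hW0 : ∀ y, W y ≠ 0 → y ∈ tsupport φ ∩ closure U := by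
    intro y hy
    by_contra h
    apply hy
    refine indicator_apply_eq_zero.2 fun hyc => ?_
    rw [image_eq_zero_of_notMem_tsupport (fun h' => h ⟨h', hyc⟩), zero_smul]
  have hWb : ∀ y, ‖W y‖ ≤ Mφ * max MG 0 := by
    intro y
    by_cases hy : W y = 0
    · rw [hy, norm_zero]; positivity
    · have h := hW0 y hy
      rw [hW, indicator_of_mem h.2, norm_smul]
      gcongr
      · exact hMφ y
      · exact (hMG y h).trans (le_max_left _ _)
  obtain ⟨R, hR⟩ := hφc.isCompact.isBounded.subset_closedBall (0 : Euc d)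
  -- the integrands over `U`, extended by zero
  set A : Euc d → ℝ := U.indicator (fun y => ⟪G y, gradient φ y⟫) with hA
  set B : Euc d → ℝ := U.indicator (fun y => φ y * D y) with hB
  have hBint : Integrable B := (integrable_indicator_iff hU.measurableSet).2 hD
  have hAint : Integrable A := by
    have hAeq : A = fun y => U.indicator (fun y => ⟪(closure U).indicator G y, gradient φ y⟫) y := by
      funext y
      by_cases hy : y ∈ U
      · simp [hA, hy, subset_closure hy]
      · simp [hA, hy]
    refine integrable_of_bounded_of_compact (S := tsupport φ) (M := max MG 0 * Cφ) ?_ hφc ?_ ?_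
    · rw [hAeq]
      exact ((hGm.inner (measurable_gradient φ)).indicator hU.measurableSet).aestronglyMeasurable
    · intro y
      by_cases hy : y ∈ U ∧ y ∈ tsupport φ
      · rw [hA, indicator_of_mem hy.1]
        refine (norm_inner_le_norm _ _).trans ?_
        gcongr
        · exact (hMG y ⟨hy.2, subset_closure hy.1⟩).trans (le_max_left _ _)
        · exact norm_gradient_le_of_lipschitz hCφ y
      · have : A y = 0 := by
          refine indicator_apply_eq_zero.2 fun hyU => ?_
          rw [gradient_eq_zero_of_notMem_tsupport fun h => hy ⟨hyU, h⟩, inner_zero_right]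
        rw [this, norm_zero]; positivity
    · intro y hy
      refine indicator_apply_eq_zero.2 fun hyU => ?_
      rw [gradient_eq_zero_of_notMem_tsupport hy, inner_zero_right]
  -- the step function in the height
  set χ : ℝ → Euc d → ℝ := fun ε y => Real.smoothTransition (σ * graphHeight e γ y / ε - 1) with hχ
  have hχb : ∀ ε y, |χ ε y| ≤ 1 := fun ε y => by
    rw [abs_of_nonneg (Real.smoothTransition.nonneg _)]; exact Real.smoothTransition.le_one _
  have hχc : ∀ ε, Continuous (χ ε) := fun ε => by
    have := hqL.continuous
    have h2 := Real.smoothTransition.continuous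
    exact h2.comp (by fun_prop)
  have hχpos : ∀ ε > 0, ∀ y, χ ε y ≠ 0 → ε ≤ σ * graphHeight e γ y := by
    intro ε hε y hy
    by_contra h
    push Not at h
    apply hy
    apply Real.smoothTransition.zero_of_nonpos
    rw [sub_nonpos, div_le_one hε]
    exact h.le
  have hθpos : ∀ ε > 0, ∀ y, θ (σ * graphHeight e γ y / ε - 1) ≠ 0 → ε ≤ σ * graphHeight e γ y := by
    intro ε hε y hy
    by_contra h
    push Not at h
    apply hy
    refine deriv_smoothTransition_of_notMem fun h2 => ?_
    have := h2.1
    rw [sub_nonneg, le_div_iff₀ hε] at this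
    linarith
  have hstep : ∀ ε > 0, (∫ y, χ ε y * A y) + (∫ y, (σ / ε) * θ (σ * graphHeight e γ y / ε - 1) *
      ⟪W y, gradient (graphHeight e γ) y⟫) = -∫ y, χ ε y * B y := by
    intro ε hε
    have hχL : LipschitzWith (Cη * (‖σ / ε‖₊ * (1 + K))) (χ ε) := by
      have h1 : LipschitzWith (‖σ / ε‖₊ * (1 + K)) fun y => σ * graphHeight e γ y / ε - 1 := by
        refine LipschitzWith.of_dist_le_mul fun x y => ?_
        have h2 := hqL.dist_le_mul x y
        rw [Real.dist_eq] at h2 ⊢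
        have h3 : σ * graphHeight e γ x / ε - 1 - (σ * graphHeight e γ y / ε - 1) =
            σ / ε * (graphHeight e γ x - graphHeight e γ y) := by ring
        rw [h3, abs_mul, NNReal.coe_mul, coe_nnnorm, Real.norm_eq_abs, mul_assoc]
        gcongr
      exact hCη.comp h1
    have hsub : tsupport (fun y => φ y * χ ε y) ⊆ U := by
      have h1 : tsupport (fun y => φ y * χ ε y) ⊆
          tsupport φ ∩ {y | ε ≤ σ * graphHeight e γ y} := by
        refine closure_minimal (fun y hy => ?_) ((isClosed_tsupport φ).inter
          (isClosed_le continuous_const (hqL.continuous.const_mul σ)))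
        have hy' : φ y * χ ε y ≠ 0 := hy
        exact ⟨subset_tsupport φ (left_ne_zero_of_mul hy'), hχpos ε hε y (right_ne_zero_of_mul hy')⟩
      intro y hy
      exact (hchart y (hs (h1 hy).1)).2 (hε.trans_le (h1 hy).2)
    have hid := hdiv (fun y => φ y * χ ε y)
      ⟨_, hCφ.mul_of_bounded (M := Mφ.toNNReal) (N := 1) hχL
        (fun y => (hMφ y).trans (Real.le_coe_toNNReal Mφ)) (fun y => by simpa using hχb ε y)⟩
      hφc.mul_right hsub
    have hr : ∀ y, φ y * χ ε y * D y = χ ε y * B y := by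
      intro y
      by_cases hy : y ∈ U
      · rw [hB, indicator_of_mem hy]; ring
      · have : φ y * χ ε y = 0 := by
          by_contra h
          exact hy (hsub (subset_tsupport _ h))
        rw [hB, indicator_of_notMem hy, this, zero_mul, mul_zero]
    simp_rw [hr] at hid
    rw [← hid, ← integral_add]
    · refine integral_congr_ae ?_
      filter_upwards [hqL.ae_differentiableAt] with y hy
      have hg : gradient (fun y => φ y * χ ε y) y = _ := gradient_mul_step (σ := σ) (ε := ε) (hφd y) hy
      rw [hg, inner_add_right, inner_smul_right, inner_smul_right]
      congr 1
      · by_cases hyU : y ∈ U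
        · simp only [hA, indicator_of_mem hyU]; rfl
        · simp only [hA, indicator_of_notMem hyU, mul_zero]
          by_cases hyN : y ∈ tsupport φ
          · have : χ ε y = 0 := by
              by_contra h
              exact hyU ((hchart y (hs hyN)).2 (hε.trans_le (hχpos ε hε y h)))
            have h2 : Real.smoothTransition (σ * graphHeight e γ y / ε - 1) = 0 := this
            rw [h2, zero_mul]
          · rw [gradient_eq_zero_of_notMem_tsupport hyN, inner_zero_right, mul_zero]
      · by_cases hyU : y ∈ closure U
        · rw [hW, indicator_of_mem hyU, inner_smul_left, conj_trivial, hθ]; ring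
        · rw [hW, indicator_of_notMem hyU, inner_zero_left, mul_zero]
          by_cases hyN : y ∈ tsupport φ
          · have : deriv Real.smoothTransition (σ * graphHeight e γ y / ε - 1) = 0 := by
              by_contra h
              exact hyU (subset_closure ((hchart y (hs hyN)).2 (hε.trans_le (hθpos ε hε y h))))
            rw [this, zero_mul, mul_zero, zero_mul]
          · rw [image_eq_zero_of_notMem_tsupport hyN, zero_mul, zero_mul]
    · exact hAint.bdd_mul (c := 1) (hχc ε).aestronglyMeasurable
        (Eventually.of_forall fun y => hχb ε y)
    · exact integrable_boundary_layer he hγ hWm hWb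
        (fun y hy => by simpa using hR (hW0 y hy).1) ε
  have hχlim : ∀ y ∈ N, y ∈ U → Tendsto (fun ε => χ ε y) (𝓝[>] 0) (𝓝 1) := by
    intro y hy hyU
    have hq : 0 < σ * graphHeight e γ y := (hchart y hy).1 hyU
    refine tendsto_const_nhds.congr' ?_
    filter_upwards [Ioo_mem_nhdsGT (show 0 < σ * graphHeight e γ y / 2 by linarith)] with ε hε
    refine (Real.smoothTransition.one_of_one_le ?_).symm
    have : 2 ≤ σ * graphHeight e γ y / ε := by
      rw [le_div_iff₀ hε.1]; linarith [hε.2]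
    linarith
  have hlimgen : ∀ F : Euc d → ℝ, Integrable F → (∀ y, F y ≠ 0 → y ∈ N ∩ U) →
      Tendsto (fun ε => ∫ y, χ ε y * F y) (𝓝[>] 0) (𝓝 (∫ y, F y)) := by
    intro F hF hF0
    refine tendsto_integral_filter_of_dominated_convergence (fun y => |F y|)
      (Eventually.of_forall fun ε => (hχc ε).aestronglyMeasurable.mul hF.1)
      (Eventually.of_forall fun ε => Eventually.of_forall fun y => ?_) hF.abs
      (Eventually.of_forall fun y => ?_)
    · rw [norm_mul]
      exact mul_le_of_le_one_left (norm_nonneg _) (hχb ε y)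
    · by_cases hy : F y = 0
      · simp only [hy, mul_zero]; exact tendsto_const_nhds
      · have := (hχlim y (hF0 y hy).1 (hF0 y hy).2).mul_const (F y)
        rwa [one_mul] at this
  have hA0 : ∀ y, A y ≠ 0 → y ∈ N ∩ U := by
    intro y hy
    by_contra h
    apply hy
    refine indicator_apply_eq_zero.2 fun hyU => ?_
    rw [gradient_eq_zero_of_notMem_tsupport (fun h' => h ⟨hs h', hyU⟩), inner_zero_right]
  have hB0 : ∀ y, B y ≠ 0 → y ∈ N ∩ U := by
    intro y hy
    by_contra h
    apply hy
    refine indicator_apply_eq_zero.2 fun hyU => ?_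
    rw [image_eq_zero_of_notMem_tsupport (fun h' => h ⟨hs h', hyU⟩), zero_mul]
  have hlay := tendsto_boundary_layer he hγ hσ hWm hWb
    (fun y hy => by simpa using hR (hW0 y hy).1)
    (fun x r hr => tendsto_indicator_graphShear he hγ hσ hN hchart hG hφ.continuous hs x hr)
  have hlim1 := (hlimgen A hAint hA0).add hlay
  have hlim2 := (hlimgen B hBint hB0).neg
  have hev := eventually_nhdsWithin_of_forall (s := Ioi (0 : ℝ)) (a := 0) fun ε hε => hstep ε hε
  have heq := tendsto_nhds_unique (hlim1.congr' hev) hlim2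
  rw [hA, hB, integral_indicator hU.measurableSet, integral_indicator hU.measurableSet] at heq
  simp_rw [inner_smul_left, conj_trivial] at heq
  linarith

end Flux

/-! ### Charts of a Lipschitz domain -/

/-- In the open set `N`, the set `U` is the region above the graph, in the unit direction `e`, of
the `K`-Lipschitz function `γ`. -/
structure IsGraphChart {d : ℕ} (U N : Set (Euc d)) (e : Euc d) (γ : Hyper e → ℝ) (K : ℝ≥0) :
    Prop where
  norm_eq : ‖e‖ = 1
  lipschitz : LipschitzWith K γ
  isOpen : IsOpen N
  mem_iff : ∀ y ∈ N, y ∈ U ↔ 0 < graphHeight e γ y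

theorem IsBoundedLipschitz.exists_chart {d : ℕ} {U : Set (Euc d)} (hU : IsBoundedLipschitz U)
    {x : Euc d} (hx : x ∈ frontier U) :
    ∃ (N : Set (Euc d)) (e : Euc d) (γ : Hyper e → ℝ) (K : ℝ≥0), x ∈ N ∧ IsGraphChart U N e γ K := by
  obtain ⟨e, he, K, γ, hγ, hev⟩ := hU.boundary x hx
  obtain ⟨N, hN, hNo, hxN⟩ := eventually_nhds_iff.1 hev
  exact ⟨N, e, γ, K, hxN, he, hγ, hNo, fun y hy => by rw [hN y hy, graphHeight, sub_pos]⟩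

theorem graphMap_orthogonalProjectionOnto {d : ℕ} {e : Euc d} (he : ‖e‖ = 1) {γ : Hyper e → ℝ}
    {y : Euc d} (hy : graphHeight e γ y = 0) :
    graphMap e γ ((Hyper e).orthogonalProjectionOnto y) = y := by
  rw [graphHeight, sub_eq_zero] at hy
  rw [graphMap, ← hy, hyper_add_inner_smul he]

theorem graphHeight_graphMap {d : ℕ} {e : Euc d} (he : ‖e‖ = 1) (γ : Hyper e → ℝ) (x : Hyper e) :
    graphHeight e γ (graphMap e γ x) = 0 := by
  rw [graphMap_eq_graphShear, graphHeight_graphShear he]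

theorem volume_graphHeight_eq_zero {d : ℕ} {e : Euc d} (he : ‖e‖ = 1) {γ : Hyper e → ℝ}
    {K : ℝ≥0} (hγ : LipschitzWith K γ) : volume {y | graphHeight e γ y = 0} = 0 := by
  have hmp := measurePreserving_graphShear he hγ.continuous
  have hm : MeasurableSet {y | graphHeight e γ y = 0} :=
    (isClosed_eq (lipschitzWith_graphHeight he hγ).continuous continuous_const).measurableSet
  rw [← hmp.measure_preimage hm.nullMeasurableSet]
  have : graphShear e γ ⁻¹' {y | graphHeight e γ y = 0} = univ ×ˢ {0} := by
    ext p
    simp [graphHeight_graphShear he]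
  rw [this, Measure.prod_prod]; simp

namespace IsGraphChart

variable {d : ℕ} {U N : Set (Euc d)} {e : Euc d} {γ : Hyper e → ℝ} {K : ℝ≥0}

theorem mono {N' : Set (Euc d)} (h : IsGraphChart U N e γ K) (hN' : IsOpen N') (hs : N' ⊆ N) :
    IsGraphChart U N' e γ K :=
  ⟨h.norm_eq, h.lipschitz, hN', fun y hy => h.mem_iff y (hs hy)⟩

theorem mem_iff_one (h : IsGraphChart U N e γ K) : ∀ y ∈ N, y ∈ U ↔ 0 < 1 * graphHeight e γ y := by
  simpa using h.mem_iff

theorem mem_closure_iff (h : IsGraphChart U N e γ K) {y : Euc d} (hy : y ∈ N) :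
    y ∈ closure U ↔ 0 ≤ graphHeight e γ y := by
  have hq := (lipschitzWith_graphHeight h.norm_eq h.lipschitz).continuous
  constructor
  · intro hc
    by_contra hlt
    push Not at hlt
    have hopen : IsOpen (N ∩ {y | graphHeight e γ y < 0}) :=
      h.isOpen.inter (isOpen_lt hq continuous_const)
    obtain ⟨z, hz, hzU⟩ := _root_.mem_closure_iff.1 hc _ hopen ⟨hy, hlt⟩
    exact absurd ((h.mem_iff z hz.1).1 hzU) (not_lt.2 (le_of_lt hz.2))
  · intro h0
    rcases h0.lt_or_eq with h1 | h1
    · exact subset_closure ((h.mem_iff y hy).2 h1)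
    · have h2 := graphMap_orthogonalProjectionOnto h.norm_eq h1.symm
      rw [← h2]
      exact graphMap_mem_closure h.norm_eq h.lipschitz (Or.inl rfl) h.isOpen h.mem_iff_one
        (by rw [h2]; exact hy)

theorem mem_compl_closure_iff (h : IsGraphChart U N e γ K) {y : Euc d} (hy : y ∈ N) :
    y ∉ closure U ↔ 0 < -1 * graphHeight e γ y := by
  rw [h.mem_closure_iff hy, not_le]; constructor <;> intro h <;> linarith

theorem mem_frontier_iff (h : IsGraphChart U N e γ K) (hU : IsOpen U) {y : Euc d} (hy : y ∈ N) :
    y ∈ frontier U ↔ graphHeight e γ y = 0 := by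
  rw [hU.frontier_eq, Set.mem_sdiff, h.mem_closure_iff hy, h.mem_iff y hy, not_lt]
  exact ⟨fun h => le_antisymm h.2 h.1, fun h => ⟨h.ge, h.le⟩⟩

theorem mem_frontier_iff_mem_range (h : IsGraphChart U N e γ K) (hU : IsOpen U) {y : Euc d}
    (hy : y ∈ N) : y ∈ frontier U ↔ y ∈ range (graphMap e γ) := by
  rw [h.mem_frontier_iff hU hy]
  constructor
  · exact fun h0 => ⟨_, graphMap_orthogonalProjectionOnto h.norm_eq h0⟩
  · rintro ⟨x, rfl⟩
    exact graphHeight_graphMap h.norm_eq γ x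

/-- A surface integral localised in a chart, in the coordinates of the chart. -/
theorem integral_surfaceMeasure (hd : 1 ≤ d) (h : IsGraphChart U N e γ K) (hU : IsOpen U)
    {f : Euc d → ℝ} (hf : ∀ y, y ∉ N → f y = 0) :
    ∫ s, f s ∂(surfaceMeasure (frontier U)) = ∫ x, areaDensity γ x * f (graphMap e γ x) := by
  rw [← integral_range_graphMap hd h.norm_eq h.lipschitz, surfaceMeasure,
    ← integral_indicator isClosed_frontier.measurableSet,
    ← integral_indicator (isClosedEmbedding_graphMap h.lipschitz.continuous).isClosed_range.measurableSet]
  congr 1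
  funext y
  by_cases hy : y ∈ N
  · have := h.mem_frontier_iff_mem_range hU hy
    by_cases hyF : y ∈ frontier U
    · rw [indicator_of_mem hyF, indicator_of_mem (this.1 hyF)]
    · rw [indicator_of_notMem hyF, indicator_of_notMem (fun h => hyF (this.2 h))]
  · rw [indicator_apply_eq_zero.2 fun _ => hf y hy, indicator_apply_eq_zero.2 fun _ => hf y hy]

/-- A property holding almost everywhere on the surface holds almost everywhere in the coordinates of
a chart, because the area density does not vanish. -/
theorem ae_of_ae_surfaceMeasure (hd : 1 ≤ d) (h : IsGraphChart U N e γ K) (hU : IsOpen U)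
    {p : Euc d → Prop} (hp : ∀ᵐ s ∂(surfaceMeasure (frontier U)), p s) :
    ∀ᵐ x : Hyper e, graphMap e γ x ∈ N → p (graphMap e γ x) := by
  have hemb := isClosedEmbedding_graphMap h.lipschitz.continuous
  rw [surfaceMeasure, ae_restrict_iff' isClosed_frontier.measurableSet] at hp
  have h1 : ∀ᵐ s ∂((Measure.euclideanHausdorffMeasure (d - 1) : Measure (Euc d)).restrict
      (range (graphMap e γ))), s ∈ N → p s := by
    rw [ae_restrict_iff' hemb.isClosed_range.measurableSet]
    filter_upwards [hp] with s hs hr hN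
    exact hs ((h.mem_frontier_iff_mem_range hU hN).2 hr)
  rw [hausdorffMeasure_restrict_range_graphMap hd h.norm_eq h.lipschitz] at h1
  have h2 := ae_of_ae_map hemb.continuous.measurable.aemeasurable h1
  rw [ae_withDensity_iff (measurable_areaDensity γ).ennreal_ofReal] at h2
  filter_upwards [h2] with x hx
  exact hx (by simpa using zero_lt_one.trans_le (one_le_areaDensity γ x))

/-- The unit normal pointing out of the region above the graph. -/
theorem isOuterUnitNormal (h : IsGraphChart U N e γ K) {x : Hyper e} (hx : graphMap e γ x ∈ N)
    (hγ : DifferentiableAt ℝ γ x) :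
    IsOuterUnitNormal U (graphMap e γ x) (-((areaDensity γ x)⁻¹ • graphConormal e γ x)) := by
  have hk := one_le_areaDensity γ x
  have hk0 : 0 < areaDensity γ x := by linarith
  refine ⟨?_, fun ε hε => ?_⟩
  · rw [norm_neg, norm_smul, norm_graphConormal h.norm_eq, Real.norm_eq_abs,
      abs_of_pos (inv_pos.2 hk0), inv_mul_cancel₀ hk0.ne']
  · have hp : (Hyper e).orthogonalProjectionOnto (graphMap e γ x) = x :=
      orthogonalProjectionOnto_hyper_add_smul x _
    have hg := hasGradientAt_graphHeight (e := e) (γ := γ) (y := graphMap e γ x) (by rwa [hp])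
    rw [hp] at hg
    have h1 := hg.hasFDerivAt.isLittleO.def hε
    filter_upwards [h1, h.isOpen.mem_nhds hx] with y hy hyN
    rw [graphHeight_graphMap h.norm_eq, sub_zero, InnerProductSpace.toDual_apply_apply,
      Real.norm_eq_abs] at hy
    have h2 := abs_le.1 hy
    have h3 : ⟪y - graphMap e γ x, -((areaDensity γ x)⁻¹ • graphConormal e γ x)⟫ =
        -(⟪graphConormal e γ x, y - graphMap e γ x⟫ / areaDensity γ x) := by
      rw [inner_neg_right, inner_smul_right, real_inner_comm]; ring
    have h4 : ε * ‖y - graphMap e γ x‖ ≤ ε * ‖y - graphMap e γ x‖ * areaDensity γ x :=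
      le_mul_of_one_le_right (by positivity) hk
    rw [h3, h.mem_iff y hyN]
    constructor
    · intro h5
      rw [lt_neg, div_lt_iff₀ hk0] at h5
      linarith [h2.2]
    · intro h5
      rw [neg_lt_neg_iff, lt_div_iff₀ hk0] at h5
      linarith [h2.1]

end IsGraphChart

theorem IsBoundedLipschitz.isCompact_frontier {d : ℕ} {U : Set (Euc d)} (hU : IsBoundedLipschitz U) :
    IsCompact (frontier U) :=
  Metric.isCompact_of_isClosed_isBounded isClosed_frontier
    (hU.isBounded.closure.subset frontier_subset_closure)

theorem IsBoundedLipschitz.isCompact_closure {d : ℕ} {U : Set (Euc d)} (hU : IsBoundedLipschitz U) :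
    IsCompact (closure U) := hU.isBounded.isCompact_closure

theorem IsBoundedLipschitz.volume_frontier {d : ℕ} {U : Set (Euc d)} (hU : IsBoundedLipschitz U) :
    volume (frontier U) = 0 := by
  refine measure_null_of_locally_null _ fun x hx => ?_
  obtain ⟨N, e, γ, K, hxN, h⟩ := hU.exists_chart hx
  refine ⟨N ∩ frontier U, inter_mem (mem_nhdsWithin_of_mem_nhds (h.isOpen.mem_nhds hxN))
    self_mem_nhdsWithin, measure_mono_null ?_ (volume_graphHeight_eq_zero h.norm_eq h.lipschitz)⟩
  exact fun y hy => (h.mem_frontier_iff hU.isOpen hy.1).1 hy.2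

theorem IsBoundedLipschitz.isFiniteMeasure_surfaceMeasure {d : ℕ} (hd : 1 ≤ d) {U : Set (Euc d)}
    (hU : IsBoundedLipschitz U) : IsFiniteMeasure (surfaceMeasure (frontier U)) := by
  constructor
  rw [surfaceMeasure, Measure.restrict_apply_univ]
  refine hU.isCompact_frontier.measure_lt_top_of_nhdsWithin fun x hx => ?_
  obtain ⟨N, e, γ, K, hxN, h⟩ := hU.exists_chart hx
  refine ⟨N ∩ Metric.ball x 1 ∩ frontier U, inter_mem (mem_nhdsWithin_of_mem_nhds
    (inter_mem (h.isOpen.mem_nhds hxN) (Metric.ball_mem_nhds x one_pos))) self_mem_nhdsWithin, ?_⟩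
  set S : Set (Hyper e) := Metric.closedBall 0 (‖x‖ + 1) with hS
  have hsub : N ∩ Metric.ball x 1 ∩ frontier U ⊆ graphMap e γ '' S := by
    rintro y ⟨⟨hyN, hyb⟩, hyF⟩
    obtain ⟨z, rfl⟩ := (h.mem_frontier_iff_mem_range hU.isOpen hyN).1 hyF
    refine ⟨z, ?_, rfl⟩
    rw [hS, mem_closedBall_zero_iff]
    refine (norm_le_norm_hyper_add_smul h.norm_eq z (γ z)).trans ?_
    rw [mem_ball_iff_norm] at hyb
    have := norm_le_norm_add_norm_sub' (graphMap e γ z) x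
    change ‖graphMap e γ z‖ ≤ _
    linarith
  refine (measure_mono hsub).trans_lt ?_
  rw [hausdorffMeasure_graphMap_image hd h.norm_eq h.lipschitz Metric.isClosed_closedBall.measurableSet]
  calc _ ≤ ∫⁻ x in S, ENNReal.ofReal (√(1 + (K : ℝ) ^ 2)) :=
        lintegral_mono fun x => ENNReal.ofReal_le_ofReal (areaDensity_le h.lipschitz x)
    _ = ENNReal.ofReal (√(1 + (K : ℝ) ^ 2)) * volume S := by rw [setLIntegral_const]
    _ < ⊤ := ENNReal.mul_lt_top ENNReal.ofReal_lt_top (isCompact_closedBall _ _).measure_lt_top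

/-- The flux density in the coordinates of a chart is integrable. -/
theorem integrable_flux {d : ℕ} {e : Euc d} (he : ‖e‖ = 1) {γ : Hyper e → ℝ} {K : ℝ≥0}
    (hγ : LipschitzWith K γ) {S : Set (Euc d)} (hS : IsClosed S) {N : Set (Euc d)}
    (hNS : ∀ x, graphMap e γ x ∈ N → graphMap e γ x ∈ S) {G : Euc d → Euc d}
    (hG : ContinuousOn G S) {φ : Euc d → ℝ} (hφ : Continuous φ) (hφc : HasCompactSupport φ)
    (hs : tsupport φ ⊆ N) :
    Integrable fun x => φ (graphMap e γ x) * ⟪G (graphMap e γ x), graphConormal e γ x⟫ := by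
  classical
  have hemb := isClosedEmbedding_graphMap hγ.continuous (e := e)
  have hGm : Measurable (S.indicator G) := by
    rw [← piecewise_eq_indicator]
    exact hG.measurable_piecewise continuousOn_const hS.measurableSet
  have hgm : Measurable (graphConormal e γ) := by
    have h1 : Measurable (gradient γ) :=
      (InnerProductSpace.toDual ℝ (Hyper e)).symm.continuous.measurable.comp (measurable_fderiv ℝ γ)
    exact measurable_const.sub (measurable_subtype_coe.comp h1)
  have hScomp : IsCompact (tsupport φ ∩ S) := hφc.isCompact.inter_right hS
  obtain ⟨MG, hMG⟩ := hScomp.exists_bound_of_continuousOn (hG.mono inter_subset_right)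
  obtain ⟨Mφ, hMφ⟩ := hφ.bounded_above_of_compact_support hφc
  have hMφ0 : 0 ≤ Mφ := (norm_nonneg _).trans (hMφ 0)
  have heq : (fun x => φ (graphMap e γ x) * ⟪G (graphMap e γ x), graphConormal e γ x⟫) =
      fun x => φ (graphMap e γ x) * ⟪S.indicator G (graphMap e γ x), graphConormal e γ x⟫ := by
    funext x
    by_cases hx : graphMap e γ x ∈ tsupport φ
    · rw [indicator_of_mem (hNS x (hs hx))]
    · rw [image_eq_zero_of_notMem_tsupport hx, zero_mul, zero_mul]
  rw [← integrableOn_iff_integrable_of_support_subset (s := graphMap e γ ⁻¹' tsupport φ)]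
  · refine Measure.integrableOn_of_bounded (M := Mφ * (max MG 0 * √(1 + (K : ℝ) ^ 2)))
      (hemb.isCompact_preimage hφc.isCompact).measure_lt_top.ne ?_ (Eventually.of_forall fun x => ?_)
    · rw [heq]
      exact ((hφ.measurable.comp hemb.continuous.measurable).mul
        ((hGm.comp hemb.continuous.measurable).inner hgm)).aestronglyMeasurable
    · by_cases hx : graphMap e γ x ∈ tsupport φ
      · rw [norm_mul]
        gcongr
        · exact hMφ _
        · refine (norm_inner_le_norm _ _).trans ?_
          gcongr
          · exact (hMG _ ⟨hx, hNS x (hs hx)⟩).trans (le_max_left _ _)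
          · rw [norm_graphConormal he]; exact areaDensity_le hγ x
      · rw [image_eq_zero_of_notMem_tsupport hx, zero_mul, norm_zero]; positivity
  · intro x hx
    exact subset_tsupport φ (left_ne_zero_of_mul hx)

/-! ### Localisation, and divergences of smooth fields -/

theorem exists_smooth_cutoff {d : ℕ} {S U : Set (Euc d)} (hS : IsCompact S) (hU : IsOpen U)
    (hSU : S ⊆ U) : ∃ b : Euc d → ℝ, ContDiff ℝ ∞ b ∧ HasCompactSupport b ∧ tsupport b ⊆ U ∧
      (∀ᶠ x in 𝓝ˢ S, b x = 1) ∧ ∀ x, 0 ≤ b x := by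
  obtain ⟨L, hL, hSL, hLU⟩ := exists_compact_between hS hU hSU
  obtain ⟨f, hf1, hf0, hf⟩ := exists_contMDiffMap_one_nhds_of_subset_interior 𝓘(ℝ, Euc d) (n := ⊤)
    hS.isClosed hSL
  have hsub : tsupport f ⊆ L := closure_minimal (fun x hx => by
    by_contra h; exact hx (hf0 x h)) hL.isClosed
  exact ⟨f, f.contMDiff.contDiff, hL.of_isClosed_subset (isClosed_tsupport _) hsub,
    hsub.trans hLU, hf1, fun x => (hf x).1⟩

/-- To prove a property of a smooth compactly supported function `φ` that is preserved by sums, it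
is enough to prove it for the products of `φ` with nonnegative functions of small support. -/
theorem induction_on_small_support {d : ℕ} {P : (Euc d → ℝ) → Prop} (h0 : P 0)
    (hadd : ∀ φ ψ, P φ → P ψ → P (φ + ψ)) {φ : Euc d → ℝ} (hφc : HasCompactSupport φ)
    (hloc : ∀ x ∈ tsupport φ, ∃ N, IsOpen N ∧ x ∈ N ∧ ∀ ζ : Euc d → ℝ, ContDiff ℝ ∞ ζ →
      HasCompactSupport ζ → tsupport ζ ⊆ N → (∀ y, 0 ≤ ζ y) → P (ζ * φ)) : P φ := by
  classical
  choose! N hNo hxN hN using hloc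
  obtain ⟨t, ht, hcov⟩ := hφc.isCompact.elim_nhds_subcover (fun x => N x ∩ Metric.ball x 1)
    (fun x hx => inter_mem ((hNo x hx).mem_nhds (hxN x hx)) (Metric.ball_mem_nhds x one_pos))
  obtain ⟨f, hf⟩ := SmoothPartitionOfUnity.exists_isSubordinate 𝓘(ℝ, Euc d) (isClosed_tsupport φ)
    (fun i : t => N i ∩ Metric.ball (i : Euc d) 1)
    (fun i => (hNo i (ht i i.2)).inter Metric.isOpen_ball)
    (fun x hx => by
      obtain ⟨i, hi, hxi⟩ := mem_iUnion₂.1 (hcov hx)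
      exact mem_iUnion.2 ⟨⟨i, hi⟩, hxi⟩)
  have hsum : φ = ∑ i : t, (f i : Euc d → ℝ) * φ := by
    funext x
    rw [Finset.sum_apply]
    simp only [Pi.mul_apply, ← Finset.sum_mul]
    by_cases hx : x ∈ tsupport φ
    · have := f.sum_eq_one hx
      rw [finsum_eq_sum_of_fintype] at this
      rw [this, one_mul]
    · rw [image_eq_zero_of_notMem_tsupport hx, mul_zero]
  have hP : ∀ i : t, P ((f i : Euc d → ℝ) * φ) := by
    intro i
    have hi := hf i
    refine hN i (ht i i.2) (f i) (f i).contMDiff.contDiff ?_ (hi.trans inter_subset_left)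
      (fun y => f.nonneg i y)
    exact (isCompact_closedBall (i : Euc d) 1).of_isClosed_subset (isClosed_tsupport _)
      (hi.trans (inter_subset_right.trans Metric.ball_subset_closedBall))
  rw [hsum]
  exact Finset.sum_induction _ P hadd h0 fun i _ => hP i

/-- Integration by parts of a `C¹` function on an open set against a Lipschitz function with compact
support there. A cutoff makes the `C¹` function Lipschitz on the whole space. -/
theorem integral_mul_inner_gradient {d : ℕ} {U : Set (Euc d)} (hU : IsOpen U) {g : Euc d → ℝ}
    (hg : ContDiffOn ℝ 1 g U) (v : Euc d) {χ : Euc d → ℝ} {C : ℝ≥0} (hχ : LipschitzWith C χ)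
    (hχc : HasCompactSupport χ) (hs : tsupport χ ⊆ U) :
    Integrable (fun y => g y * ⟪v, gradient χ y⟫) ∧ Integrable (fun y => χ y * fderiv ℝ g y v) ∧
    ∫ y, g y * ⟪v, gradient χ y⟫ = -∫ y, χ y * fderiv ℝ g y v := by
  obtain ⟨b, hb, hbc, hbU, hb1, -⟩ := exists_smooth_cutoff hχc.isCompact hU hs
  set f : Euc d → ℝ := fun y => b y * g y with hf
  have hf1 : ContDiff ℝ 1 f := by
    rw [contDiff_iff_contDiffAt]
    intro y
    by_cases hy : y ∈ tsupport b
    · exact (hb.contDiffAt.of_le (by simp)).mul (hg.contDiffAt (hU.mem_nhds (hbU hy)))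
    · have : f =ᶠ[𝓝 y] fun _ => 0 := by
        filter_upwards [(isClosed_tsupport b).isOpen_compl.mem_nhds hy] with z hz
        simp [hf, image_eq_zero_of_notMem_tsupport hz]
      exact contDiffAt_const.congr_of_eventuallyEq this
  have hfc : HasCompactSupport f := hbc.mul_right
  obtain ⟨Cf, hCf⟩ := ContDiff.lipschitzWith_of_hasCompactSupport hfc hf1 one_ne_zero
  have hkey := hχ.integral_lineDeriv_mul_eq (μ := volume) hCf hfc v
  have hbev : ∀ y ∈ tsupport χ, f =ᶠ[𝓝 y] g := by
    intro y hy
    filter_upwards [eventually_nhdsSet_iff_forall.1 hb1 y hy] with z hz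
    simp [hf, hz]
  have e1 : (fun y => g y * ⟪v, gradient χ y⟫) =ᵐ[volume] fun y => lineDeriv ℝ χ y v * f y := by
    filter_upwards [hχ.ae_differentiableAt] with y hy
    by_cases hyt : y ∈ tsupport χ
    · rw [(hbev y hyt).eq_of_nhds, hy.lineDeriv_eq_fderiv, gradient, real_inner_comm,
        InnerProductSpace.toDual_symm_apply, mul_comm]
    · rw [hy.lineDeriv_eq_fderiv, gradient_eq_zero_of_notMem_tsupport hyt, inner_zero_right,
        show fderiv ℝ χ y = 0 by by_contra h; exact hyt (support_fderiv_subset ℝ h)]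
      simp
  have e2 : (fun y => χ y * fderiv ℝ g y v) = fun y => -(lineDeriv ℝ f y (-v) * χ y) := by
    funext y
    by_cases hyt : y ∈ tsupport χ
    · rw [((hf1.differentiable one_ne_zero) y).lineDeriv_eq_fderiv, (hbev y hyt).fderiv_eq, map_neg]
      ring
    · rw [image_eq_zero_of_notMem_tsupport hyt]; ring
  have i1 : Integrable (fun y => lineDeriv ℝ χ y v * f y) :=
    (hCf.continuous.integrable_of_hasCompactSupport hfc).bdd_mul (c := C * ‖v‖)
      (aestronglyMeasurable_lineDeriv hχ.continuous volume)
      (Eventually.of_forall fun y => norm_lineDeriv_le_of_lipschitz ℝ hχ)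
  have i2 : Integrable (fun y => lineDeriv ℝ f y (-v) * χ y) :=
    (hχ.continuous.integrable_of_hasCompactSupport hχc).bdd_mul (c := Cf * ‖-v‖)
      (aestronglyMeasurable_lineDeriv hCf.continuous volume)
      (Eventually.of_forall fun y => norm_lineDeriv_le_of_lipschitz ℝ hCf)
  refine ⟨i1.congr e1.symm, ?_, ?_⟩
  · rw [e2]; exact i2.neg
  · rw [integral_congr_ae e1, e2, integral_neg, neg_neg, hkey]

theorem hasDivergence_smul_const {d : ℕ} {U : Set (Euc d)} (hU : IsOpen U) {g : Euc d → ℝ}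
    (hg : ContDiffOn ℝ 1 g U) (v : Euc d) :
    HasDivergence U (fun y => g y • v) (fun y => fderiv ℝ g y v) := by
  rintro χ ⟨C, hC⟩ hχc hs
  simp_rw [inner_smul_left, conj_trivial]
  exact (integral_mul_inner_gradient hU hg v hC hχc hs).2.2

/-- The classical Laplacian of a `C²` function is the divergence of its gradient. -/
theorem hasDivergence_gradient {d : ℕ} {U : Set (Euc d)} (hU : IsOpen U) {u : Euc d → ℝ}
    (hu : ContDiffOn ℝ 2 u U) : HasDivergence U (gradient u) (Δ u) := by
  rintro χ ⟨C, hC⟩ hχc hs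
  let b := stdOrthonormalBasis ℝ (Euc d)
  have hfd : ContDiffOn ℝ 1 (fderiv ℝ u) U := hu.fderiv_of_isOpen hU (by norm_num)
  have hg : ∀ i, ContDiffOn ℝ 1 (fun y => fderiv ℝ u y (b i)) U := fun i =>
    hfd.clm_apply contDiffOn_const
  have h := fun i => integral_mul_inner_gradient hU (hg i) (b i) hC hχc hs
  have e1 : ∀ y, ⟪gradient u y, gradient χ y⟫ = ∑ i, fderiv ℝ u y (b i) * ⟪b i, gradient χ y⟫ := by
    intro y
    rw [← b.sum_inner_mul_inner]
    refine Finset.sum_congr rfl fun i _ => ?_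
    rw [gradient, InnerProductSpace.toDual_symm_apply]
  have e2 : ∀ y, χ y * Δ u y = ∑ i, χ y * fderiv ℝ (fun y => fderiv ℝ u y (b i)) y (b i) := by
    intro y
    by_cases hy : y ∈ tsupport χ
    · rw [InnerProductSpace.laplacian_eq_iteratedFDeriv_orthonormalBasis u b, ← Finset.mul_sum]
      congr 1
      refine Finset.sum_congr rfl fun i _ => ?_
      rw [iteratedFDeriv_two_apply]
      have hd : DifferentiableAt ℝ (fderiv ℝ u) y :=
        (hfd.differentiableOn one_ne_zero).differentiableAt (hU.mem_nhds (hs hy))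
      rw [fderiv_clm_apply hd (differentiableAt_const _)]
      simp
    · simp [image_eq_zero_of_notMem_tsupport hy]
  simp_rw [e1, e2]
  rw [integral_finsetSum _ fun i _ => (h i).1, integral_finsetSum _ fun i _ => (h i).2.1,
    ← Finset.sum_neg_distrib]
  exact Finset.sum_congr rfl fun i _ => (h i).2.2

/-! ### Trace and Friedrichs inequalities for smooth functions -/

theorem gradient_mul {d : ℕ} {f g : Euc d → ℝ} {y : Euc d} (hf : DifferentiableAt ℝ f y)
    (hg : DifferentiableAt ℝ g y) :
    gradient (fun y => f y * g y) y = f y • gradient g y + g y • gradient f y := by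
  simp only [gradient, fderiv_fun_mul hf hg, map_add, map_smulₛₗ, conj_trivial]

theorem gradient_add {d : ℕ} {f g : Euc d → ℝ} {y : Euc d} (hf : DifferentiableAt ℝ f y)
    (hg : DifferentiableAt ℝ g y) :
    gradient (fun y => f y + g y) y = gradient f y + gradient g y := by
  simp only [gradient, fderiv_fun_add hf hg, map_add]

theorem Continuous.integrableOn_of_isBounded {d : ℕ} {F : Type*} [NormedAddCommGroup F]
    {f : Euc d → F} (hf : Continuous f) {V : Set (Euc d)} (hV : Bornology.IsBounded V) :
    IntegrableOn f V :=
  (hf.continuousOn.integrableOn_compact hV.isCompact_closure).mono_set subset_closure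

theorem hasDivergence_const {d : ℕ} {U : Set (Euc d)} (hU : IsOpen U) (v : Euc d) :
    HasDivergence U (fun _ => v) (fun _ => 0) := by
  have h := hasDivergence_smul_const hU (g := fun _ => 1) contDiffOn_const v
  simpa using h

theorem inner_graphConormal {d : ℕ} {e : Euc d} (he : ‖e‖ = 1) (γ : Hyper e → ℝ) (x : Hyper e) :
    ⟪e, graphConormal e γ x⟫ = 1 := by
  rw [graphConormal, inner_sub_right, real_inner_self_eq_norm_sq, he, inner_hyper_left]; simp

theorem IsGraphChart.integral_inner_gradient {d : ℕ} {U N : Set (Euc d)} {e : Euc d}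
    {γ : Hyper e → ℝ} {K : ℝ≥0} (h : IsGraphChart U N e γ K) (hU : IsOpen U) (v : Euc d)
    {ψ : Euc d → ℝ} (hψ : ContDiff ℝ ∞ ψ) (hψc : HasCompactSupport ψ) (hs : tsupport ψ ⊆ N) :
    ∫ y in U, ⟪v, gradient ψ y⟫ = -∫ x, ψ (graphMap e γ x) * ⟪v, graphConormal e γ x⟫ := by
  have := integral_inner_gradient_add_integral_mul_divergence h.norm_eq h.lipschitz (Or.inl rfl) hU
    h.isOpen h.mem_iff_one continuousOn_const (hasDivergence_const hU v) hψ hψc hs (by simp)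
  simpa using this

/-- **Trace inequality** for smooth functions on a Lipschitz domain. -/
theorem IsBoundedLipschitz.exists_trace_inequality {d : ℕ} (hd : 1 ≤ d) {V : Set (Euc d)}
    (hV : IsBoundedLipschitz V) : ∃ C : ℝ, 0 ≤ C ∧ ∀ φ : Euc d → ℝ, ContDiff ℝ ∞ φ →
      ∫ s, φ s ^ 2 ∂(surfaceMeasure (frontier V)) ≤
        C * ((∫ y in V, φ y ^ 2) + ∫ y in V, ‖gradient φ y‖ ^ 2) := by
  have hfin := hV.isFiniteMeasure_surfaceMeasure hd
  obtain ⟨b, hb, hbc, -, hb1, hb0⟩ := exists_smooth_cutoff hV.isCompact_closure isOpen_univ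
    (subset_univ _)
  have hmain : Continuous b ∧ HasCompactSupport b ∧ ∃ C : ℝ, 0 ≤ C ∧ ∀ φ : Euc d → ℝ, ContDiff ℝ ∞ φ →
      ∫ s, b s * φ s ^ 2 ∂(surfaceMeasure (frontier V)) ≤
        C * ((∫ y in V, φ y ^ 2) + ∫ y in V, ‖gradient φ y‖ ^ 2) := by
    refine induction_on_small_support (P := fun ζ => Continuous ζ ∧ HasCompactSupport ζ ∧
      ∃ C : ℝ, 0 ≤ C ∧ ∀ φ : Euc d → ℝ, ContDiff ℝ ∞ φ →
      ∫ s, ζ s * φ s ^ 2 ∂(surfaceMeasure (frontier V)) ≤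
        C * ((∫ y in V, φ y ^ 2) + ∫ y in V, ‖gradient φ y‖ ^ 2)) ?_ ?_ hbc ?_
    · exact ⟨continuous_const, HasCompactSupport.zero, 0, le_rfl, fun φ _ => by simp⟩
    · rintro ζ₁ ζ₂ ⟨h1, h1c, C₁, hC₁, hi₁⟩ ⟨h2, h2c, C₂, hC₂, hi₂⟩
      refine ⟨h1.add h2, h1c.add h2c, C₁ + C₂, add_nonneg hC₁ hC₂, fun φ hφ => ?_⟩
      simp only [Pi.add_apply, add_mul]
      have hc := hφ.continuous
      rw [integral_add]
      · exact add_le_add (hi₁ φ hφ) (hi₂ φ hφ)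
      · exact (h1.mul (hc.pow 2)).integrable_of_hasCompactSupport h1c.mul_right
      · exact (h2.mul (hc.pow 2)).integrable_of_hasCompactSupport h2c.mul_right
    · intro x _
      by_cases hx : x ∈ frontier V
      · obtain ⟨N, e, γ, K, hxN, h⟩ := hV.exists_chart hx
        refine ⟨N, h.isOpen, hxN, fun ζ hζ hζc hζN hζ0 => ?_⟩
        set η : Euc d → ℝ := ζ * b with hη
        have hη1 : ContDiff ℝ ∞ η := hζ.mul hb
        have hηc : HasCompactSupport η := hζc.mul_right
        have hηN : tsupport η ⊆ N := tsupport_mul_subset_left.trans hζN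
        have hη0 : ∀ y, 0 ≤ η y := fun y => mul_nonneg (hζ0 y) (hb0 y)
        obtain ⟨M, hM⟩ := hη1.continuous.bounded_above_of_compact_support hηc
        obtain ⟨L, hL⟩ := ContDiff.lipschitzWith_of_hasCompactSupport hηc hη1 (by simp)
        have hM0 : 0 ≤ M := (norm_nonneg _).trans (hM 0)
        set A := √(1 + (K : ℝ) ^ 2)
        refine ⟨hη1.continuous, hηc, A * (L + M), by positivity, fun φ hφ => ?_⟩
        have hψ : ContDiff ℝ ∞ fun y => η y * φ y ^ 2 := hη1.mul (hφ.pow 2)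
        have hψc : HasCompactSupport fun y => η y * φ y ^ 2 := hηc.mul_right
        have hψN : tsupport (fun y => η y * φ y ^ 2) ⊆ N := tsupport_mul_subset_left.trans hηN
        have hemb := isClosedEmbedding_graphMap h.lipschitz.continuous (e := e)
        have hi : Integrable fun x => η (graphMap e γ x) * φ (graphMap e γ x) ^ 2 :=
          (hψ.continuous.comp hemb.continuous).integrable_of_hasCompactSupport
            (hψc.comp_isClosedEmbedding hemb)
        have hnn : ∀ y, 0 ≤ η y * φ y ^ 2 := fun y => mul_nonneg (hη0 y) (sq_nonneg _)
        -- Testing with the constant field `e`, whose product with the conormal is `1`, turns the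
        -- integral over the graph into one over the domain.
        have h2 := h.integral_inner_gradient hV.isOpen e hψ hψc hψN
        simp only [inner_graphConormal h.norm_eq, mul_one] at h2
        rw [h.integral_surfaceMeasure hd hV.isOpen
          (fun y hy => image_eq_zero_of_notMem_tsupport fun h' => hy (hψN h'))]
        calc ∫ x, areaDensity γ x * (η (graphMap e γ x) * φ (graphMap e γ x) ^ 2)
            ≤ ∫ x, A * (η (graphMap e γ x) * φ (graphMap e γ x) ^ 2) := by
              refine integral_mono_of_nonneg (Eventually.of_forall fun x => ?_) (hi.const_mul A)
                (Eventually.of_forall fun x => ?_)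
              · exact mul_nonneg (by linarith [one_le_areaDensity γ x]) (hnn _)
              · exact mul_le_mul_of_nonneg_right (areaDensity_le h.lipschitz x) (hnn _)
          _ = A * -∫ y in V, ⟪e, gradient (fun y => η y * φ y ^ 2) y⟫ := by
              rw [integral_const_mul, h2, neg_neg]
          _ ≤ A * ((L + M) * ((∫ y in V, φ y ^ 2) + ∫ y in V, ‖gradient φ y‖ ^ 2)) := by
              gcongr
              have i1 : IntegrableOn (fun y => φ y ^ 2) V :=
                (hφ.continuous.pow 2).integrableOn_of_isBounded hV.isBounded
              have i2 : IntegrableOn (fun y => ‖gradient φ y‖ ^ 2) V :=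
                ((continuous_gradient hφ).norm.pow 2).integrableOn_of_isBounded hV.isBounded
              rw [← integral_add i1 i2, ← integral_const_mul, ← integral_neg]
              refine integral_mono ?_ ((i1.add i2).const_mul _) fun y => ?_
              · exact ((continuous_const.inner (continuous_gradient hψ)).integrableOn_of_isBounded
                  hV.isBounded).neg
              · have hdη := (hη1.differentiable (by simp)) y
                have hdφ := (hφ.differentiable (by simp)) y
                have hg : gradient (fun y => η y * φ y ^ 2) y =
                    η y • ((2 * φ y) • gradient φ y) + φ y ^ 2 • gradient η y := by
                  rw [gradient_mul hdη (show DifferentiableAt ℝ (fun y => φ y ^ 2) y from hdφ.pow 2)]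
                  congr 2
                  have : (fun y => φ y ^ 2) = fun y => φ y * φ y := by funext z; ring
                  rw [this, gradient_mul hdφ hdφ, ← add_smul]
                  ring_nf
                have hn := neg_le_of_abs_le ((abs_real_inner_le_norm e
                  (gradient (fun y => η y * φ y ^ 2) y)))
                rw [h.norm_eq, one_mul] at hn
                have hn2 : ‖gradient (fun y => η y * φ y ^ 2) y‖ ≤
                    M * (2 * |φ y| * ‖gradient φ y‖) + φ y ^ 2 * L := by
                  rw [hg]
                  refine (norm_add_le _ _).trans ?_
                  rw [norm_smul, norm_smul, norm_smul, norm_mul]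
                  simp only [Real.norm_eq_abs, abs_two, abs_pow, sq_abs]
                  gcongr
                  · exact hM y
                  · exact norm_gradient_le_of_lipschitz hL y
                have hab : 2 * |φ y| * ‖gradient φ y‖ ≤ φ y ^ 2 + ‖gradient φ y‖ ^ 2 := by
                  rw [← sq_abs (φ y)]; nlinarith [sq_nonneg (|φ y| - ‖gradient φ y‖)]
                have hab2 := mul_le_mul_of_nonneg_left hab hM0
                have hL0 : (0 : ℝ) ≤ L * ‖gradient φ y‖ ^ 2 := by positivity
                simp only
                nlinarith
          _ = _ := by ring
      · refine ⟨(frontier V)ᶜ, isClosed_frontier.isOpen_compl, hx, fun ζ hζ hζc hζN _ =>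
          ⟨hζ.continuous.mul hb.continuous, hζc.mul_right, 0, le_rfl, fun φ _ => ?_⟩⟩
        rw [zero_mul, surfaceMeasure, setIntegral_eq_zero_of_forall_eq_zero]
        intro y hy
        have : ζ y = 0 := image_eq_zero_of_notMem_tsupport fun h => hζN h hy
        simp [this]
  obtain ⟨-, -, C, hC, hi⟩ := hmain
  refine ⟨C, hC, fun φ hφ => ?_⟩
  rw [← show ∫ s, b s * φ s ^ 2 ∂(surfaceMeasure (frontier V)) =
    ∫ s, φ s ^ 2 ∂(surfaceMeasure (frontier V)) from ?_]
  · exact hi φ hφ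
  · refine setIntegral_congr_fun isClosed_frontier.measurableSet fun y hy => ?_
    have := eventually_nhdsSet_iff_forall.1 hb1 y (frontier_subset_closure hy)
    simp only [this.self_of_nhds, one_mul]

/-- The flux of a constant field, weighted by a smooth function, through the boundary of a Lipschitz
domain is bounded by the surface integral of the weight. -/
theorem IsBoundedLipschitz.abs_integral_inner_gradient_le {d : ℕ} (hd : 1 ≤ d) {V : Set (Euc d)}
    (hV : IsBoundedLipschitz V) (v : Euc d) {ψ : Euc d → ℝ} (hψ : ContDiff ℝ ∞ ψ) :
    |∫ y in V, ⟪v, gradient ψ y⟫| ≤ ‖v‖ * ∫ s, |ψ s| ∂(surfaceMeasure (frontier V)) := by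
  have hfin := hV.isFiniteMeasure_surfaceMeasure hd
  obtain ⟨b, hb, hbc, -, hb1, hb0⟩ := exists_smooth_cutoff hV.isCompact_closure isOpen_univ
    (subset_univ _)
  have hmain : ContDiff ℝ ∞ b ∧ HasCompactSupport b ∧
      |∫ y in V, ⟪v, gradient (fun y => b y * ψ y) y⟫| ≤
        ‖v‖ * ∫ s, b s * |ψ s| ∂(surfaceMeasure (frontier V)) := by
    refine induction_on_small_support (P := fun ζ => ContDiff ℝ ∞ ζ ∧ HasCompactSupport ζ ∧
      |∫ y in V, ⟪v, gradient (fun y => ζ y * ψ y) y⟫| ≤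
        ‖v‖ * ∫ s, ζ s * |ψ s| ∂(surfaceMeasure (frontier V))) ?_ ?_ hbc ?_
    · refine ⟨contDiff_const, HasCompactSupport.zero, ?_⟩
      have : ∀ y : Euc d, gradient (fun _ : Euc d => (0 : ℝ)) y = 0 := fun y => by
        simp [gradient]
      simp [this]
    · rintro ζ₁ ζ₂ ⟨h1, h1c, hi₁⟩ ⟨h2, h2c, hi₂⟩
      refine ⟨h1.add h2, h1c.add h2c, ?_⟩
      have hg : ∀ y, gradient (fun y => ζ₁ y * ψ y + ζ₂ y * ψ y) y =
          gradient (fun y => ζ₁ y * ψ y) y + gradient (fun y => ζ₂ y * ψ y) y := fun y =>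
        gradient_add (((h1.mul hψ).differentiable (by simp)) y)
          (((h2.mul hψ).differentiable (by simp)) y)
      simp only [Pi.add_apply, add_mul, hg, inner_add_right]
      rw [integral_add, integral_add, mul_add]
      · exact (abs_add_le _ _).trans (add_le_add hi₁ hi₂)
      · exact (h1.continuous.mul hψ.continuous.abs).integrable_of_hasCompactSupport h1c.mul_right
      · exact (h2.continuous.mul hψ.continuous.abs).integrable_of_hasCompactSupport h2c.mul_right
      · exact (continuous_const.inner (continuous_gradient (h1.mul hψ))).integrableOn_of_isBounded
          hV.isBounded
      · exact (continuous_const.inner (continuous_gradient (h2.mul hψ))).integrableOn_of_isBounded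
          hV.isBounded
    · intro x _
      have hpos : ∀ ζ : Euc d → ℝ, (∀ y, 0 ≤ ζ y) →
          0 ≤ ‖v‖ * ∫ s, (ζ * b) s * |ψ s| ∂(surfaceMeasure (frontier V)) := fun ζ hζ0 =>
        mul_nonneg (norm_nonneg _) (integral_nonneg fun s =>
          mul_nonneg (mul_nonneg (hζ0 s) (hb0 s)) (abs_nonneg _))
      have hsupp : ∀ ζ : Euc d → ℝ, tsupport (fun y => (ζ * b) y * ψ y) ⊆ tsupport ζ := fun ζ =>
        tsupport_mul_subset_left.trans tsupport_mul_subset_left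
      by_cases hx : x ∈ frontier V
      · obtain ⟨N, e, γ, K, hxN, h⟩ := hV.exists_chart hx
        refine ⟨N, h.isOpen, hxN, fun ζ hζ hζc hζN hζ0 => ⟨hζ.mul hb, hζc.mul_right, ?_⟩⟩
        have hη1 : ContDiff ℝ ∞ (ζ * b) := hζ.mul hb
        have hηc : HasCompactSupport (ζ * b) := hζc.mul_right
        rw [h.integral_inner_gradient hV.isOpen v (hη1.mul hψ) hηc.mul_right
          ((hsupp ζ).trans hζN), abs_neg, h.integral_surfaceMeasure hd hV.isOpen
          (fun y hy => by
            have : ζ y = 0 := image_eq_zero_of_notMem_tsupport fun h' => hy (hζN h')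
            simp [this]), ← integral_const_mul]
        have hemb := isClosedEmbedding_graphMap h.lipschitz.continuous (e := e)
        have hi : Integrable fun x => ‖v‖ * (areaDensity γ x *
            ((ζ * b) (graphMap e γ x) * |ψ (graphMap e γ x)|)) := by
          refine Integrable.const_mul (Integrable.bdd_mul (c := √(1 + (K : ℝ) ^ 2)) ?_
            (measurable_areaDensity γ).aestronglyMeasurable (Eventually.of_forall fun x => ?_)) _
          · have hc : HasCompactSupport fun y => (ζ * b) y * |ψ y| := hηc.mul_right
            exact ((hη1.continuous.mul hψ.continuous.abs).comp
              hemb.continuous).integrable_of_hasCompactSupport (hc.comp_isClosedEmbedding hemb)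
          · rw [Real.norm_eq_abs, abs_of_nonneg (by linarith [one_le_areaDensity γ x])]
            exact areaDensity_le h.lipschitz x
        rw [← Real.norm_eq_abs]
        refine norm_integral_le_of_norm_le hi (Eventually.of_forall fun x => ?_)
        have h1 := abs_real_inner_le_norm v (graphConormal e γ x)
        rw [norm_graphConormal h.norm_eq] at h1
        have h0 : 0 ≤ (ζ * b) (graphMap e γ x) := mul_nonneg (hζ0 _) (hb0 _)
        rw [norm_mul, norm_mul, Real.norm_eq_abs, Real.norm_eq_abs, Real.norm_eq_abs,
          abs_of_nonneg h0]
        have h2 := mul_nonneg h0 (abs_nonneg (ψ (graphMap e γ x)))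
        calc _ ≤ (ζ * b) (graphMap e γ x) * |ψ (graphMap e γ x)| * (‖v‖ * areaDensity γ x) := by
              gcongr
          _ = _ := by ring
      · by_cases hxV : x ∈ V
        · refine ⟨V, hV.isOpen, hxV, fun ζ hζ hζc hζN hζ0 => ⟨hζ.mul hb, hζc.mul_right, ?_⟩⟩
          have hη1 : ContDiff ℝ ∞ fun y => (ζ * b) y * ψ y := (hζ.mul hb).mul hψ
          have hηc : HasCompactSupport fun y => (ζ * b) y * ψ y := hζc.mul_right.mul_right
          have hL := ContDiff.lipschitzWith_of_hasCompactSupport hηc hη1 (by simp)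
          have h0 := hasDivergence_const hV.isOpen v _ hL hηc ((hsupp ζ).trans hζN)
          have h1 : ∫ y in V, ⟪v, gradient (fun y => (ζ * b) y * ψ y) y⟫ =
              ∫ y, ⟪v, gradient (fun y => (ζ * b) y * ψ y) y⟫ :=
            setIntegral_eq_integral_of_forall_compl_eq_zero fun y hy => by
              rw [gradient_eq_zero_of_notMem_tsupport (fun h => hy (hζN (hsupp ζ h))),
                inner_zero_right]
          rw [h1, h0]
          simpa using hpos ζ hζ0
        · have hxc : x ∉ closure V := fun h => hx (by
            rw [hV.isOpen.frontier_eq]; exact ⟨h, hxV⟩)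
          refine ⟨(closure V)ᶜ, isClosed_closure.isOpen_compl, hxc, fun ζ hζ hζc hζN hζ0 =>
            ⟨hζ.mul hb, hζc.mul_right, ?_⟩⟩
          rw [setIntegral_eq_zero_of_forall_eq_zero, abs_zero]
          · exact hpos ζ hζ0
          · intro y hy
            rw [gradient_eq_zero_of_notMem_tsupport (fun h => hζN (hsupp ζ h) (subset_closure hy)),
              inner_zero_right]
  have h1 : ∫ s, b s * |ψ s| ∂(surfaceMeasure (frontier V)) =
      ∫ s, |ψ s| ∂(surfaceMeasure (frontier V)) := by
    refine setIntegral_congr_fun isClosed_frontier.measurableSet fun y hy => ?_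
    have := eventually_nhdsSet_iff_forall.1 hb1 y (frontier_subset_closure hy)
    simp only [this.self_of_nhds, one_mul]
  have h2 : ∫ y in V, ⟪v, gradient (fun y => b y * ψ y) y⟫ = ∫ y in V, ⟪v, gradient ψ y⟫ := by
    refine setIntegral_congr_fun hV.isOpen.measurableSet fun y hy => ?_
    have h3 : (fun y => b y * ψ y) =ᶠ[𝓝 y] ψ := by
      filter_upwards [eventually_nhdsSet_iff_forall.1 hb1 y (subset_closure hy)] with z hz
      rw [hz, one_mul]
    simp only [gradient, h3.fderiv_eq]
  rw [← h1, ← h2]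
  exact hmain.2.2

/-- **Friedrichs inequality** for smooth functions on a Lipschitz domain, from the divergence
theorem for the field `φ² ⟨v, x⟩ v` with a unit vector `v`. -/
theorem IsBoundedLipschitz.exists_friedrichs_inequality {d : ℕ} (hd : 1 ≤ d) {V : Set (Euc d)}
    (hV : IsBoundedLipschitz V) : ∃ C : ℝ, 0 ≤ C ∧ ∀ φ : Euc d → ℝ, ContDiff ℝ ∞ φ →
      ∫ y in V, φ y ^ 2 ≤ C * ((∫ y in V, ‖gradient φ y‖ ^ 2) +
        ∫ s, φ s ^ 2 ∂(surfaceMeasure (frontier V))) := by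
  have hfin := hV.isFiniteMeasure_surfaceMeasure hd
  have : Nontrivial (Euc d) := by
    have : Nonempty (Fin d) := ⟨⟨0, hd⟩⟩
    infer_instance
  obtain ⟨v, hv⟩ := exists_norm_eq (Euc d) zero_le_one
  obtain ⟨R, hR0, hR⟩ := hV.isCompact_closure.isBounded.exists_pos_norm_le
  -- With `|⟪v, y⟫| ≤ R`, the divergence theorem gives `∫ φ² ≤ 2R ∫ |φ| |∇φ| + R ∫ φ² dS`, and half of
  -- `∫ φ²` is absorbed: `2R |φ| |∇φ| ≤ φ² / 2 + 2R² |∇φ|²`.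
  refine ⟨2 * R + 4 * R ^ 2, by positivity, fun φ hφ => ?_⟩
  have hx : ContDiff ℝ ∞ fun y : Euc d => ⟪v, y⟫ := contDiff_const.inner ℝ contDiff_id
  have hψ : ContDiff ℝ ∞ fun y => φ y * (φ y * ⟪v, y⟫) := hφ.mul (hφ.mul hx)
  have hg : ∀ y, ⟪v, gradient (fun y => φ y * (φ y * ⟪v, y⟫)) y⟫ =
      φ y ^ 2 + 2 * φ y * ⟪v, y⟫ * ⟪v, gradient φ y⟫ := by
    intro y
    have hdφ := (hφ.differentiable (by simp)) y
    have hdx := (hx.differentiable (by simp)) y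
    have hgx : gradient (fun y : Euc d => ⟪v, y⟫) y = v := by
      have : HasGradientAt (fun y : Euc d => ⟪v, y⟫) v y := by
        rw [hasGradientAt_iff_hasFDerivAt]; exact (innerSL ℝ v).hasFDerivAt
      exact this.gradient
    rw [gradient_mul hdφ (show DifferentiableAt ℝ (fun y => φ y * ⟪v, y⟫) y from hdφ.mul hdx),
      gradient_mul hdφ hdx, hgx]
    simp only [inner_add_right, inner_smul_right, real_inner_self_eq_norm_sq, hv]
    ring
  have hb := hV.abs_integral_inner_gradient_le hd v hψ
  rw [hv, one_mul] at hb
  simp_rw [hg] at hb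
  have i1 : IntegrableOn (fun y => φ y ^ 2) V :=
    (hφ.continuous.pow 2).integrableOn_of_isBounded hV.isBounded
  have i2 : IntegrableOn (fun y => ‖gradient φ y‖ ^ 2) V :=
    ((continuous_gradient hφ).norm.pow 2).integrableOn_of_isBounded hV.isBounded
  have i3 : IntegrableOn (fun y => 2 * φ y * ⟪v, y⟫ * ⟪v, gradient φ y⟫) V :=
    (((continuous_const.mul hφ.continuous).mul hx.continuous).mul
      (continuous_const.inner (continuous_gradient hφ))).integrableOn_of_isBounded hV.isBounded
  rw [integral_add i1 i3] at hb
  have hs : ∫ s, |φ s * (φ s * ⟪v, s⟫)| ∂(surfaceMeasure (frontier V)) ≤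
      R * ∫ s, φ s ^ 2 ∂(surfaceMeasure (frontier V)) := by
    rw [← integral_const_mul, surfaceMeasure]
    have i4 : IntegrableOn (fun s => R * φ s ^ 2) (frontier V)
        (Measure.euclideanHausdorffMeasure (d - 1)) := by
      have : IsFiniteMeasure ((Measure.euclideanHausdorffMeasure (d - 1) :
        Measure (Euc d)).restrict (frontier V)) := hfin
      obtain ⟨B, hB⟩ := hV.isCompact_frontier.exists_bound_of_continuousOn
        (hφ.continuous.pow 2).continuousOn
      refine Integrable.const_mul (Integrable.of_bound
        (hφ.continuous.pow 2).aestronglyMeasurable B ?_) R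
      exact (ae_restrict_iff' isClosed_frontier.measurableSet).2 (Eventually.of_forall hB)
    refine integral_mono_of_nonneg (Eventually.of_forall fun s => abs_nonneg _) i4 ?_
    refine (ae_restrict_iff' isClosed_frontier.measurableSet).2 (Eventually.of_forall fun s hs => ?_)
    have h1 := abs_real_inner_le_norm v s
    rw [hv, one_mul] at h1
    replace h1 := h1.trans (hR s (frontier_subset_closure hs))
    have h2 : |φ s * (φ s * ⟪v, s⟫)| = φ s ^ 2 * |⟪v, s⟫| := by
      rw [← mul_assoc, abs_mul, ← sq, abs_of_nonneg (sq_nonneg _)]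
    simp only [h2]
    nlinarith [sq_nonneg (φ s)]
  have hi : -∫ y in V, 2 * φ y * ⟪v, y⟫ * ⟪v, gradient φ y⟫ ≤
      (1 / 2) * (∫ y in V, φ y ^ 2) + 2 * R ^ 2 * ∫ y in V, ‖gradient φ y‖ ^ 2 := by
    rw [← integral_neg, ← integral_const_mul, ← integral_const_mul,
      ← integral_add (i1.const_mul _) (i2.const_mul _)]
    refine setIntegral_mono_on i3.neg ((i1.const_mul _).add (i2.const_mul _))
      hV.isOpen.measurableSet fun y hy => ?_
    have h1 := abs_real_inner_le_norm v y
    rw [hv, one_mul] at h1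
    replace h1 := h1.trans (hR y (subset_closure hy))
    have h2 := abs_real_inner_le_norm v (gradient φ y)
    rw [hv, one_mul] at h2
    have h3 : -(2 * φ y * ⟪v, y⟫ * ⟪v, gradient φ y⟫) ≤ 2 * |φ y| * (R * ‖gradient φ y‖) := by
      refine (neg_le_abs _).trans ?_
      rw [abs_mul, abs_mul, abs_mul, abs_two, mul_assoc (2 * |φ y|)]
      gcongr
    have h4 := sq_nonneg (|φ y| - 2 * (R * ‖gradient φ y‖))
    have h5 := sq_abs (φ y)
    nlinarith
  have hb2 := (le_abs_self _).trans hb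
  have p1 : 0 ≤ ∫ y in V, ‖gradient φ y‖ ^ 2 := integral_nonneg fun y => by positivity
  have p2 : 0 ≤ ∫ s, φ s ^ 2 ∂(surfaceMeasure (frontier V)) := integral_nonneg fun y => by positivity
  nlinarith [mul_nonneg hR0.le p1, mul_nonneg (sq_nonneg R) p2]

/-! ### Mollification in `L²` -/

theorem eLpNorm_two_sq {α F : Type*} [MeasurableSpace α] [NormedAddCommGroup F] (f : α → F)
    (μ : Measure α) : eLpNorm f 2 μ ^ 2 = ∫⁻ x, ‖f x‖ₑ ^ 2 ∂μ := by
  have h := eLpNorm_nnreal_pow_eq_lintegral (f := f) (μ := μ) (p := 2) two_ne_zero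
  have h2 : ((2 : ℝ≥0) : ℝ) = ((2 : ℕ) : ℝ) := by norm_num
  have h3 : ((2 : ℝ≥0) : ℝ≥0∞) = 2 := by norm_num
  simpa only [h2, h3, ENNReal.rpow_natCast] using h

section Mollify

variable {d : ℕ} {F : Type*} [NormedAddCommGroup F]

/-- Translations are continuous in `L²`. -/
theorem tendsto_eLpNorm_translate_sub {h : Euc d → F} (hh : MemLp h 2 volume) :
    Tendsto (fun t => eLpNorm (fun x => h (x - t) - h x) 2 volume) (𝓝 0) (𝓝 0) := by
  let g : C(Euc d, C(Euc d, Euc d)) :=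
    (ContinuousMap.mk (fun a : Euc d × Euc d => a.2 - a.1) (by fun_prop)).curry
  have hg : ∀ t, MeasurePreserving (g t) volume volume := fun t => measurePreserving_sub_right volume t
  have hc : Continuous fun t => Lp.compMeasurePreserving (g t) (hg t) (hh.toLp h) :=
    continuous_const.compMeasurePreservingLp g.continuous hg (by norm_num)
  have h1 := (tendsto_iff_edist_tendsto_0.1 (hc.tendsto 0))
  refine h1.congr fun t => ?_
  rw [Lp.edist_def]
  refine eLpNorm_congr_ae ?_
  have e : ∀ t, (Lp.compMeasurePreserving (g t) (hg t) (hh.toLp h) : Euc d → F) =ᵐ[volume]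
      fun x => h (x - t) := fun t =>
    (Lp.coeFn_compMeasurePreserving (hh.toLp h) (hg t)).trans
      ((hg t).quasiMeasurePreserving.ae_eq_comp hh.coeFn_toLp)
  filter_upwards [e t, e 0] with x hx hx0
  rw [Pi.sub_apply, hx, hx0, sub_zero]

/-- Averaging the translates of an `L²` function against a probability density changes it by at most
the largest change under one of the translations. -/
theorem eLpNorm_convolution_sub_le [NormedSpace ℝ F] [CompleteSpace F] {κ : Euc d → ℝ}
    (hκ : Continuous κ) (hκc : HasCompactSupport κ) (hκ0 : ∀ t, 0 ≤ κ t) (hκ1 : ∫ t, κ t = 1)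
    {h : Euc d → F} (hh : MemLp h 2 volume) {ε : ℝ≥0∞}
    (hε : ∀ t, κ t ≠ 0 → eLpNorm (fun x => h (x - t) - h x) 2 volume ≤ ε) :
    eLpNorm (fun x => (κ ⋆[ContinuousLinearMap.lsmul ℝ ℝ, volume] h) x - h x) 2 volume ≤ ε := by
  wlog hm : StronglyMeasurable h generalizing h
  · have he := hh.1.ae_eq_mk
    have h1 := this (h := hh.1.mk h) (hh.ae_eq he) (fun t ht => by
      refine (eLpNorm_congr_ae ?_).trans_le (hε t ht)
      filter_upwards [he, (measurePreserving_sub_right volume t).quasiMeasurePreserving.ae_eq_comp he]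
        with x hx hx2
      have hx2' : h (x - t) = hh.1.mk h (x - t) := hx2
      rw [hx, hx2']) hh.1.stronglyMeasurable_mk
    rw [← convolution_congr _ (EventuallyEq.refl _ κ) he] at h1
    refine (eLpNorm_congr_ae ?_).trans_le h1
    filter_upwards [he] with x hx
    rw [hx]
  have hloc : LocallyIntegrable h := hh.locallyIntegrable (by norm_num)
  set ρ : Measure (Euc d) := volume.withDensity fun t => ENNReal.ofReal (κ t) with hρ
  have hκi : Integrable κ := hκ.integrable_of_hasCompactSupport hκc
  have hρ1 : IsProbabilityMeasure ρ := by
    constructor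
    rw [hρ, withDensity_apply _ MeasurableSet.univ, setLIntegral_univ,
      ← ofReal_integral_eq_lintegral_ofReal hκi (Eventually.of_forall hκ0), hκ1, ENNReal.ofReal_one]
  have hjm : StronglyMeasurable fun p : Euc d × Euc d => h (p.1 - p.2) - h p.1 :=
    (hm.comp_measurable (measurable_fst.sub measurable_snd)).sub (hm.comp_measurable measurable_fst)
  have hpt : ∀ x, ‖(κ ⋆[ContinuousLinearMap.lsmul ℝ ℝ, volume] h) x - h x‖ₑ ^ 2 ≤
      ∫⁻ t, ‖h (x - t) - h x‖ₑ ^ 2 ∂ρ := by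
    intro x
    have hmx : StronglyMeasurable fun t => h (x - t) - h x :=
      hjm.comp_measurable (measurable_const.prodMk measurable_id)
    have hce : Integrable fun t => κ t • h (x - t) :=
      hκc.convolutionExists_left (ContinuousLinearMap.lsmul ℝ ℝ) hκ hloc x
    have h1 : (κ ⋆[ContinuousLinearMap.lsmul ℝ ℝ, volume] h) x - h x =
        ∫ t, κ t • (h (x - t) - h x) := by
      have : ∫ t, κ t • h x = h x := by rw [integral_smul_const, hκ1, one_smul]
      conv_lhs => rw [← this]
      simp only [convolution_def, ContinuousLinearMap.lsmul_apply, smul_sub]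
      rw [integral_sub hce (hκi.smul_const _)]
    have h2 : ‖∫ t, κ t • (h (x - t) - h x)‖ₑ ≤ eLpNorm (fun t => h (x - t) - h x) 1 ρ := by
      refine (enorm_integral_le_lintegral_enorm _).trans ?_
      rw [eLpNorm_one_eq_lintegral_enorm, hρ,
        lintegral_withDensity_eq_lintegral_mul _ hκ.measurable.ennreal_ofReal hmx.enorm]
      refine lintegral_mono fun t => ?_
      rw [enorm_smul, Pi.mul_apply, Real.enorm_of_nonneg (hκ0 t)]
    rw [h1, ← eLpNorm_two_sq]
    gcongr
    exact h2.trans (eLpNorm_le_eLpNorm_of_exponent_le (by norm_num) hmx.aestronglyMeasurable)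
  have hsq : eLpNorm (fun x => (κ ⋆[ContinuousLinearMap.lsmul ℝ ℝ, volume] h) x - h x) 2 volume ^ 2
      ≤ ε ^ 2 := by
    rw [eLpNorm_two_sq]
    calc _ ≤ ∫⁻ x, ∫⁻ t, ‖h (x - t) - h x‖ₑ ^ 2 ∂ρ := lintegral_mono hpt
      _ = ∫⁻ t, ∫⁻ x, ‖h (x - t) - h x‖ₑ ^ 2 ∂volume ∂ρ :=
          lintegral_lintegral_swap (hjm.enorm.pow_const 2).aemeasurable
      _ ≤ ∫⁻ _, ε ^ 2 ∂ρ := by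
          refine lintegral_mono_ae ?_
          rw [hρ, ae_withDensity_iff hκ.measurable.ennreal_ofReal]
          refine Eventually.of_forall fun t ht => ?_
          rw [← eLpNorm_two_sq (fun x => h (x - t) - h x)]
          gcongr
          exact hε t fun h0 => ht (by rw [h0, ENNReal.ofReal_zero])
      _ = ε ^ 2 := by rw [lintegral_const, measure_univ, mul_one]
  exact (ENNReal.pow_le_pow_left_iff two_ne_zero).1 hsq

end Mollify

/-! ### Density of smooth functions in `H¹` -/

/-- A Lipschitz domain has the interior cone property, uniformly near each point of its closure. -/
theorem IsBoundedLipschitz.exists_cone {d : ℕ} {U : Set (Euc d)} (hU : IsBoundedLipschitz U)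
    {x₀ : Euc d} (hx₀ : x₀ ∈ closure U) :
    ∃ (r : ℝ) (w : Euc d) (a t₀ : ℝ), 0 < r ∧ 0 < a ∧ 0 < t₀ ∧ ∀ x ∈ closure U,
      x ∈ Metric.ball x₀ r → ∀ t, 0 < t → t < t₀ → Metric.closedBall (x + t • w) (a * t) ⊆ U := by
  by_cases hi : x₀ ∈ U
  · obtain ⟨ρ, hρ, hρU⟩ := Metric.isOpen_iff.1 hU.isOpen x₀ hi
    refine ⟨ρ / 2, 0, 1, ρ / 2, by linarith, one_pos, by linarith, fun x _ hx t ht ht₀ y hy => ?_⟩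
    refine hρU ?_
    rw [smul_zero, add_zero, one_mul, Metric.mem_closedBall] at hy
    rw [Metric.mem_ball] at hx ⊢
    linarith [dist_triangle y x x₀]
  · have hfr : x₀ ∈ frontier U := by rw [hU.isOpen.frontier_eq]; exact ⟨hx₀, hi⟩
    obtain ⟨N, e, γ, K, hxN, h⟩ := hU.exists_chart hfr
    obtain ⟨ρ, hρ, hρN⟩ := Metric.isOpen_iff.1 h.isOpen x₀ hxN
    have hK : (0 : ℝ) ≤ K := K.2
    -- The height is `(1 + K)`-Lipschitz and grows by `t` from `x` to `x + t e`, so it stays positive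
    -- in the ball of radius `t / (2 (1 + K))` around `x + t e`.
    refine ⟨ρ / 2, e, (2 * (1 + K))⁻¹, ρ / 4, by linarith, by positivity, by linarith,
      fun x hx hxr t ht ht₀ y hy => ?_⟩
    have ha : (2 * (1 + (K : ℝ)))⁻¹ ≤ 1 := inv_le_one_of_one_le₀ (by linarith)
    have hat : (2 * (1 + (K : ℝ)))⁻¹ * t ≤ t := by nlinarith
    rw [Metric.mem_closedBall] at hy
    rw [Metric.mem_ball] at hxr
    have hte : dist (x + t • e) x = t := by
      rw [dist_eq_norm, add_sub_cancel_left, norm_smul, h.norm_eq, Real.norm_eq_abs, abs_of_pos ht,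
        mul_one]
    have hyN : y ∈ N := hρN (by
      rw [Metric.mem_ball]
      linarith [dist_triangle y (x + t • e) x₀, dist_triangle (x + t • e) x x₀])
    have hxN' : x ∈ N := hρN (by rw [Metric.mem_ball]; linarith)
    refine (h.mem_iff y hyN).2 ?_
    have h0 := (h.mem_closure_iff hxN').1 hx
    have hlift : graphHeight e γ (x + t • e) = graphHeight e γ x + t := by
      simp only [graphHeight]
      have hp : (Hyper e).orthogonalProjectionOnto (t • e) = 0 := by
        rw [map_smul, Submodule.orthogonalProjectionOnto_orthogonal_apply_eq_zero
          (Submodule.mem_span_singleton_self e), smul_zero]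
      rw [map_add, hp, add_zero, inner_add_right, inner_smul_right, real_inner_self_eq_norm_sq,
        h.norm_eq]
      ring
    have hl := (lipschitzWith_graphHeight h.norm_eq h.lipschitz).dist_le_mul y (x + t • e)
    have hl2 : ((1 + K : ℝ≥0) : ℝ) * dist y (x + t • e) ≤ t / 2 := by
      calc _ ≤ ((1 + K : ℝ≥0) : ℝ) * ((2 * (1 + (K : ℝ)))⁻¹ * t) := by gcongr
        _ = t / 2 := by
          push_cast
          field_simp
    rw [Real.dist_eq, hlift] at hl
    linarith [(abs_le.1 (hl.trans hl2)).1]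

section Weak

variable {d : ℕ} {Ω : Set (Euc d)} {v : Euc d → ℝ} {G : Euc d → Euc d}

theorem MeasureTheory.MemLp.integrableOn_of_isBounded {F : Type*} [NormedAddCommGroup F] {f : Euc d → F}
    (hΩ : Bornology.IsBounded Ω) (hf : MemLp f 2 (volume.restrict Ω)) : IntegrableOn f Ω := by
  have : IsFiniteMeasure (volume.restrict Ω) := ⟨by
    rw [Measure.restrict_apply_univ]; exact hΩ.measure_lt_top⟩
  exact hf.integrable (by norm_num)

theorem MeasureTheory.IntegrableOn.continuous_smul {F : Type*} [NormedAddCommGroup F] [NormedSpace ℝ F]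
    (hΩ : Bornology.IsBounded Ω) {b : Euc d → ℝ} {p : Euc d → F} (hb : Continuous b)
    (hp : IntegrableOn p Ω) : IntegrableOn (fun y => b y • p y) Ω := by
  obtain ⟨C, hC⟩ := hΩ.isCompact_closure.exists_bound_of_continuousOn hb.continuousOn
  exact hp.bdd_smul C hb.aestronglyMeasurable
    (ae_restrict_of_ae_restrict_of_subset subset_closure (ae_restrict_of_forall_mem isClosed_closure.measurableSet hC))

theorem MeasureTheory.IntegrableOn.smul_continuous {F : Type*} [NormedAddCommGroup F] [NormedSpace ℝ F]
    (hΩ : Bornology.IsBounded Ω) {b : Euc d → F} {p : Euc d → ℝ} (hb : Continuous b)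
    (hp : IntegrableOn p Ω) : IntegrableOn (fun y => p y • b y) Ω := by
  obtain ⟨C, hC⟩ := hΩ.isCompact_closure.exists_bound_of_continuousOn hb.continuousOn
  exact hp.smul_bdd C hb.aestronglyMeasurable
    (ae_restrict_of_ae_restrict_of_subset subset_closure (ae_restrict_of_forall_mem isClosed_closure.measurableSet hC))

/-- The weak gradient of the product with a smooth function. -/
theorem IsWeakGrad.integral_mul_smul_gradient (hΩ : Bornology.IsBounded Ω)
    (hv : MemLp v 2 (volume.restrict Ω)) (hG : IsWeakGrad Ω v G) {η ψ : Euc d → ℝ}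
    (hη : ContDiff ℝ ∞ η) (hηc : HasCompactSupport η) (hψ : ContDiff ℝ ∞ ψ)
    (hs : tsupport (fun y => η y * ψ y) ⊆ Ω) :
    ∫ y in Ω, (η y * v y) • gradient ψ y = -∫ y in Ω, ψ y • (η y • G y + v y • gradient η y) := by
  have hvi := hv.integrableOn_of_isBounded hΩ
  have hGi := hG.memLp.integrableOn_of_isBounded hΩ
  have hi1 : IntegrableOn (fun y => (η y * v y) • gradient ψ y) Ω :=
    (IntegrableOn.continuous_smul hΩ hη.continuous hvi).smul_continuous hΩ (continuous_gradient hψ)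
  have hi2 : IntegrableOn (fun y => v y • (ψ y • gradient η y)) Ω :=
    hvi.smul_continuous hΩ (hψ.continuous.smul (continuous_gradient hη))
  have hi3 : IntegrableOn (fun y => (η y * ψ y) • G y) Ω :=
    hGi.continuous_smul hΩ (hη.continuous.mul hψ.continuous)
  have h1 := hG.integral_eq (fun y => η y * ψ y) (hη.mul hψ) hηc.mul_right hs
  have hg : ∀ y, gradient (fun y => η y * ψ y) y = η y • gradient ψ y + ψ y • gradient η y :=
    fun y => gradient_mul (hη.differentiable (by simp) y) (hψ.differentiable (by simp) y)
  have e1 : ∫ y in Ω, v y • gradient (fun y => η y * ψ y) y =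
      (∫ y in Ω, (η y * v y) • gradient ψ y) + ∫ y in Ω, v y • (ψ y • gradient η y) := by
    rw [← integral_add hi1 hi2]
    refine integral_congr_ae (Eventually.of_forall fun y => ?_)
    simp only [hg, smul_add, smul_smul, mul_comm (v y)]
  have e2 : ∫ y in Ω, ψ y • (η y • G y + v y • gradient η y) =
      (∫ y in Ω, (η y * ψ y) • G y) + ∫ y in Ω, v y • (ψ y • gradient η y) := by
    rw [← integral_add hi3 hi2]
    refine integral_congr_ae (Eventually.of_forall fun y => ?_)
    simp only [smul_add, smul_smul, mul_comm (ψ y)]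
  rw [e2, neg_add, ← h1, e1]
  abel

theorem gradient_const_sub {κ : Euc d → ℝ} (hκ : ContDiff ℝ ∞ κ) (x y : Euc d) :
    gradient (fun z => κ (x - z)) y = -gradient κ (x - y) := by
  have h1 : HasFDerivAt (fun z => x - z) (-ContinuousLinearMap.id ℝ (Euc d)) y :=
    (hasFDerivAt_id y).const_sub x
  have h2 := ((hκ.differentiable (by simp) (x - y)).hasFDerivAt).comp y h1
  have h3 : fderiv ℝ (fun z => κ (x - z)) y = -fderiv ℝ κ (x - y) := by
    rw [show (fun z => κ (x - z)) = κ ∘ fun z => x - z from rfl, h2.fderiv]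
    ext z; simp
  rw [gradient, h3, map_neg, gradient]

theorem HasCompactSupport.gradient {κ : Euc d → ℝ} (hκc : HasCompactSupport κ) :
    HasCompactSupport (gradient κ) :=
  hκc.mono' fun y hy => by
    by_contra h
    exact hy (gradient_eq_zero_of_notMem_tsupport h)

/-- The gradient of a mollification. -/
theorem gradient_convolution {κ W : Euc d → ℝ} (hκ : ContDiff ℝ ∞ κ) (hκc : HasCompactSupport κ)
    (hW : LocallyIntegrable W) (x : Euc d) :
    gradient (κ ⋆[ContinuousLinearMap.lsmul ℝ ℝ, volume] W) x =
      -∫ y, W y • gradient (fun z => κ (x - z)) y := by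
  have h1 := hκc.hasFDerivAt_convolution_left (ContinuousLinearMap.lsmul ℝ ℝ)
    (hκ.of_le (by simp)) hW x
  have hi1 := (hκc.fderiv ℝ).convolutionExists_left
    ((ContinuousLinearMap.lsmul ℝ ℝ : ℝ →L[ℝ] ℝ →L[ℝ] ℝ).precompL (Euc d))
    (hκ.continuous_fderiv (by simp)) hW x
  have hi2 : Integrable fun y => W y • gradient κ (x - y) :=
    hκc.gradient.convolutionExists_right (ContinuousLinearMap.lsmul ℝ ℝ : ℝ →L[ℝ] Euc d →L[ℝ] Euc d)
      hW (continuous_gradient hκ) x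
  refine ext_inner_right ℝ fun e => ?_
  rw [inner_gradient_left, h1.fderiv, convolution_eq_swap,
    ContinuousLinearMap.integral_apply hi1.integrable_swap, inner_neg_left, real_inner_comm]
  simp only [gradient_const_sub hκ, smul_neg, integral_neg, neg_neg, inner_neg_right]
  rw [← integral_inner hi2]
  refine integral_congr_ae (Eventually.of_forall fun y => ?_)
  simp only [ContinuousLinearMap.precompL_apply, ContinuousLinearMap.lsmul_apply, inner_smul_right,
    smul_eq_mul, inner_gradient_right, mul_comm, RCLike.conj_to_real]

/-- The smooth functions `φ k` with compact support converge to `v`, and their gradients to `G`, in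
`L²(Ω)`. -/
structure IsSmoothApprox (Ω : Set (Euc d)) (v : Euc d → ℝ) (G : Euc d → Euc d)
    (φ : ℕ → Euc d → ℝ) : Prop where
  contDiff : ∀ k, ContDiff ℝ ∞ (φ k)
  hasCompactSupport : ∀ k, HasCompactSupport (φ k)
  tendsto : Tendsto (fun k => eLpNorm (fun x => φ k x - v x) 2 (volume.restrict Ω)) atTop (𝓝 0)
  tendsto_gradient : Tendsto (fun k => eLpNorm (fun x => gradient (φ k) x - G x) 2
    (volume.restrict Ω)) atTop (𝓝 0)

theorem tsupport_const_sub_subset {κ : Euc d → ℝ} {t a : ℝ} {w : Euc d}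
    (hκ : ∀ s, κ s ≠ 0 → s ∈ Metric.closedBall (-(t • w)) (a * t)) (x : Euc d) :
    tsupport (fun y => κ (x - y)) ⊆ Metric.closedBall (x + t • w) (a * t) := by
  refine closure_minimal (fun y hy => ?_) Metric.isClosed_closedBall
  have := hκ _ hy
  rw [mem_closedBall_iff_norm] at this ⊢
  rwa [show y - (x + t • w) = -(x - y - -(t • w)) by abel, norm_neg]

/-- Mollification with a kernel supported on the inner side of the boundary commutes with the weak
gradient. -/
theorem IsWeakGrad.gradient_convolution_eq (hΩo : IsOpen Ω) (hΩ : Bornology.IsBounded Ω)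
    (hv : MemLp v 2 (volume.restrict Ω)) (hG : IsWeakGrad Ω v G) {η κ : Euc d → ℝ}
    (hη : ContDiff ℝ ∞ η) (hηc : HasCompactSupport η) (hκ : ContDiff ℝ ∞ κ)
    (hκc : HasCompactSupport κ) {x : Euc d}
    (hs : tsupport η ∩ tsupport (fun y => κ (x - y)) ⊆ Ω) :
    gradient (κ ⋆[ContinuousLinearMap.lsmul ℝ ℝ, volume] Ω.indicator (fun y => η y * v y)) x =
      (κ ⋆[ContinuousLinearMap.lsmul ℝ ℝ, volume]
        Ω.indicator (fun y => η y • G y + v y • gradient η y)) x := by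
  have hW : Integrable (Ω.indicator (fun y => η y * v y)) :=
    (integrable_indicator_iff hΩo.measurableSet).2
      (IntegrableOn.continuous_smul hΩ hη.continuous (hv.integrableOn_of_isBounded hΩ))
  have hψ : ContDiff ℝ ∞ fun y => κ (x - y) := hκ.comp (contDiff_const.sub contDiff_id)
  have h1 := hG.integral_mul_smul_gradient hΩ hv hη hηc hψ
    (subset_trans (subset_inter (closure_mono fun _ hy => left_ne_zero_of_mul hy)
      (closure_mono fun _ hy => right_ne_zero_of_mul hy)) hs)
  rw [gradient_convolution hκ hκc hW.locallyIntegrable, convolution_eq_swap]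
  have e1 : ∫ y, Ω.indicator (fun y => η y * v y) y • gradient (fun z => κ (x - z)) y =
      ∫ y in Ω, (η y * v y) • gradient (fun z => κ (x - z)) y := by
    rw [← integral_indicator hΩo.measurableSet]
    refine integral_congr_ae (Eventually.of_forall fun y => ?_)
    by_cases hy : y ∈ Ω <;> simp [hy]
  rw [e1, h1, neg_neg, ← integral_indicator hΩo.measurableSet]
  refine integral_congr_ae (Eventually.of_forall fun y => ?_)
  by_cases hy : y ∈ Ω <;> simp [hy]

theorem norm_convolution_sub_le {κ W : Euc d → ℝ} (hκ : Continuous κ) (hκc : HasCompactSupport κ)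
    (hκ0 : ∀ t, 0 ≤ κ t) (hκ1 : ∫ t, κ t = 1) (hW : LocallyIntegrable W) {x : Euc d} {z ε : ℝ}
    (hε : ∀ s, κ s ≠ 0 → |W (x - s) - z| ≤ ε) :
    |(κ ⋆[ContinuousLinearMap.lsmul ℝ ℝ, volume] W) x - z| ≤ ε := by
  have hκi : Integrable κ := hκ.integrable_of_hasCompactSupport hκc
  have hce : Integrable fun t => κ t * W (x - t) :=
    hκc.convolutionExists_left (ContinuousLinearMap.lsmul ℝ ℝ) hκ hW x
  have h1 : (κ ⋆[ContinuousLinearMap.lsmul ℝ ℝ, volume] W) x - z = ∫ t, κ t * (W (x - t) - z) := by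
    simp only [mul_sub]
    rw [integral_sub hce (hκi.mul_const _), integral_mul_const, hκ1, one_mul]
    rfl
  rw [h1, ← Real.norm_eq_abs]
  refine (norm_integral_le_of_norm_le (hκi.mul_const ε) (Eventually.of_forall fun t => ?_)).trans_eq
    (by rw [integral_mul_const, hκ1, one_mul])
  rw [norm_mul, Real.norm_of_nonneg (hκ0 t), Real.norm_eq_abs]
  by_cases h0 : κ t = 0
  · simp [h0]
  · exact mul_le_mul_of_nonneg_left (hε t h0) (hκ0 t)

/-- Near a point where the cone property holds, `H¹` functions are approximated by convolving with
bump functions centred on the axis of the reflected cone: the values of the function outside the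
domain then play no role. -/
theorem IsWeakGrad.exists_isSmoothApprox_mul (hΩo : IsOpen Ω) (hΩ : Bornology.IsBounded Ω)
    (hv : MemLp v 2 (volume.restrict Ω)) (hG : IsWeakGrad Ω v G) {x₀ w : Euc d} {r a t₀ : ℝ}
    (ha : 0 < a) (ht₀ : 0 < t₀) (hcone : ∀ x ∈ closure Ω, x ∈ Metric.ball x₀ r →
      ∀ t, 0 < t → t < t₀ → Metric.closedBall (x + t • w) (a * t) ⊆ Ω)
    {η : Euc d → ℝ} (hη : ContDiff ℝ ∞ η) (hηc : HasCompactSupport η)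
    (hηs : tsupport η ⊆ Metric.ball x₀ r) :
    ∃ φ, IsSmoothApprox Ω (fun x => η x * v x) (fun x => η x • G x + v x • gradient η x) φ ∧
      (ContinuousOn v (closure Ω) →
        TendstoUniformlyOn φ (fun x => η x * v x) atTop (closure Ω)) := by
  obtain ⟨δ, hδ, hδs⟩ := hηc.isCompact.exists_thickening_subset_open Metric.isOpen_ball hηs
  set W : Euc d → ℝ := Ω.indicator (fun y => η y * v y) with hW
  set Gw : Euc d → Euc d := Ω.indicator (fun y => η y • G y + v y • gradient η y) with hGw
  have hηtop : MemLp η ⊤ (volume.restrict Ω) := by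
    obtain ⟨C, hC⟩ := hηc.exists_bound_of_continuous hη.continuous
    exact memLp_top_of_bound hη.continuous.aestronglyMeasurable C (Eventually.of_forall hC)
  have hηtop' : MemLp (gradient η) ⊤ (volume.restrict Ω) := by
    obtain ⟨C, hC⟩ := hηc.gradient.exists_bound_of_continuous (continuous_gradient hη)
    exact memLp_top_of_bound (continuous_gradient hη).aestronglyMeasurable C (Eventually.of_forall hC)
  have hWL' : MemLp (fun y => η y * v y) 2 (volume.restrict Ω) := hv.mul hηtop
  have hGL' : MemLp (fun y => η y • G y + v y • gradient η y) 2 (volume.restrict Ω) :=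
    (hG.memLp.smul hηtop).add (hηtop'.smul hv)
  have hWL : MemLp W 2 volume := (memLp_indicator_iff_restrict hΩo.measurableSet).2 hWL'
  have hGL : MemLp Gw 2 volume := (memLp_indicator_iff_restrict hΩo.measurableSet).2 hGL'
  -- The parameters of the kernels: `τ k → 0` below `t₀`, radii below the opening of the cone.
  obtain ⟨τ, hτ⟩ : ∃ τ : ℕ → ℝ, τ = fun k : ℕ => t₀ / 2 * (1 / ((k : ℝ) + 1)) := ⟨_, rfl⟩
  have hτ0 : ∀ k, 0 < τ k := fun k => by rw [hτ]; positivity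
  have hτ1 : ∀ k, τ k < t₀ := fun k => by
    have : 1 / ((k : ℝ) + 1) ≤ 1 := by
      rw [div_le_one (by positivity)]; linarith [(Nat.cast_nonneg k : (0 : ℝ) ≤ k)]
    rw [hτ]; nlinarith
  have hτlim : Tendsto τ atTop (𝓝 0) := by
    rw [hτ, ← mul_zero (t₀ / 2)]
    exact tendsto_one_div_add_atTop_nhds_zero_nat.const_mul _
  let B : ∀ k, ContDiffBump (-(τ k • w)) := fun k =>
    ⟨a * τ k / 2, a * τ k, by have := mul_pos ha (hτ0 k); linarith,
      by have := mul_pos ha (hτ0 k); linarith⟩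
  let κ : ℕ → Euc d → ℝ := fun k => (B k).normed volume
  have hκ : ∀ k, ContDiff ℝ ∞ (κ k) := fun k => (B k).contDiff_normed
  have hκc : ∀ k, HasCompactSupport (κ k) := fun k => (B k).hasCompactSupport_normed
  have hκ0 : ∀ k s, 0 ≤ κ k s := fun k s => (B k).nonneg_normed s
  have hκ1 : ∀ k, ∫ s, κ k s = 1 := fun k => (B k).integral_normed
  have hκs : ∀ k s, κ k s ≠ 0 → s ∈ Metric.closedBall (-(τ k • w)) (a * τ k) := fun k s hs => by
    have : s ∈ Function.support ((B k).normed volume) := hs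
    rw [(B k).support_normed_eq] at this
    exact Metric.ball_subset_closedBall this
  have hsmall : ∀ k s, s ∈ Metric.closedBall (-(τ k • w)) (a * τ k) → ‖s‖ ≤ τ k * (‖w‖ + a) := by
    intro k s hs
    rw [mem_closedBall_iff_norm, sub_neg_eq_add] at hs
    have h1 := norm_sub_le (s + τ k • w) (τ k • w)
    rw [add_sub_cancel_right, norm_smul, Real.norm_of_nonneg (hτ0 k).le] at h1
    linarith
  have hlim : Tendsto (fun k => τ k * (‖w‖ + a)) atTop (𝓝 0) := by
    simpa using hτlim.mul_const (‖w‖ + a)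
  have hev : ∀ {P : Euc d → Prop}, (∀ᶠ s in 𝓝 0, P s) → ∀ᶠ k in atTop, ∀ s, κ k s ≠ 0 → P s := by
    intro P hP
    obtain ⟨ε, hε, hεP⟩ := Metric.eventually_nhds_iff.1 hP
    filter_upwards [hlim.eventually_lt_const hε] with k hk s hs
    exact hεP (by rw [dist_zero_right]; exact (hsmall k s (hκs k s hs)).trans_lt hk)
  have hconv : ∀ {F : Type} [NormedAddCommGroup F] [NormedSpace ℝ F] [CompleteSpace F]
      {h : Euc d → F}, MemLp h 2 volume → Tendsto (fun k => eLpNorm (fun x =>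
        (κ k ⋆[ContinuousLinearMap.lsmul ℝ ℝ, volume] h) x - h x) 2 (volume.restrict Ω))
        atTop (𝓝 0) := by
    intro F _ _ _ h hh
    rw [ENNReal.tendsto_nhds_zero]
    intro ε hε
    filter_upwards [hev (ENNReal.tendsto_nhds_zero.1 (tendsto_eLpNorm_translate_sub hh) ε hε)]
      with k hk
    exact (eLpNorm_mono_measure _ Measure.restrict_le_self).trans
      (eLpNorm_convolution_sub_le (hκ k).continuous (hκc k) (hκ0 k) (hκ1 k) hh hk)
  have hWc : HasCompactSupport W := hηc.mono fun y hy => by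
    have := (indicator_apply_ne_zero.1 hy).2
    exact left_ne_zero_of_mul this
  have hWloc : LocallyIntegrable W := hWL.locallyIntegrable (by norm_num)
  refine ⟨fun k => κ k ⋆[ContinuousLinearMap.lsmul ℝ ℝ, volume] W, ⟨fun k =>
    (hκc k).contDiff_convolution_left _ (hκ k) hWloc, fun k => (hκc k).convolution _ hWc, ?_, ?_⟩,
    fun hvc => ?_⟩
  · refine (hconv hWL).congr fun k => eLpNorm_congr_ae ?_
    filter_upwards [ae_restrict_mem hΩo.measurableSet] with x hx
    rw [hW, indicator_of_mem hx]
  · refine (hconv hGL).congr' ?_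
    filter_upwards [hlim.eventually_lt_const hδ] with k hk
    refine eLpNorm_congr_ae ?_
    filter_upwards [ae_restrict_mem hΩo.measurableSet] with x hx
    have hgr := hG.gradient_convolution_eq hΩo hΩ hv hη hηc (hκ k) (hκc k) (x := x) (by
      rintro y ⟨hyη, hyκ⟩
      have hy := tsupport_const_sub_subset (hκs k) x hyκ
      refine hcone x (subset_closure hx) (hδs (Metric.mem_thickening_iff.2 ⟨y, hyη, ?_⟩)) _ (hτ0 k)
        (hτ1 k) hy
      rw [dist_eq_norm]
      refine (hsmall k (x - y) ?_).trans_lt hk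
      rw [mem_closedBall_iff_norm] at hy ⊢
      rwa [show x - y - -(τ k • w) = -(y - (x + τ k • w)) by abel, norm_neg])
    rw [hgr, hGw, indicator_of_mem hx]
  · have hcont : ContinuousOn (fun x => η x * v x) (closure Ω) := hη.continuous.continuousOn.mul hvc
    have huc := hΩ.isCompact_closure.uniformContinuousOn_of_continuous hcont
    rw [Metric.tendstoUniformlyOn_iff]
    intro ε hε
    obtain ⟨ρ, hρ, hρε⟩ := Metric.uniformContinuousOn_iff_le.1 huc (ε / 2) (half_pos hε)
    filter_upwards [hlim.eventually_lt_const hδ, hlim.eventually_lt_const hρ] with k hk1 hk2 x hx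
    rw [dist_comm, Real.dist_eq]
    refine (norm_convolution_sub_le (hκ k).continuous (hκc k) (hκ0 k) (hκ1 k) hWloc
      fun s hs => ?_).trans_lt (half_lt_self hε)
    have hsb := hκs k s hs
    have hsn := hsmall k s hsb
    by_cases hxb : x ∈ Metric.ball x₀ r
    · have hxs : x - s ∈ Ω := hcone x hx hxb _ (hτ0 k) (hτ1 k) (by
        rw [mem_closedBall_iff_norm] at hsb ⊢
        rwa [show x - s - (x + τ k • w) = -(s - -(τ k • w)) by abel, norm_neg])
      rw [hW, indicator_of_mem hxs]
      refine hρε _ (subset_closure hxs) _ hx ?_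
      rw [dist_eq_norm, sub_sub_cancel_left, norm_neg]
      linarith
    · have h1 : η x = 0 := image_eq_zero_of_notMem_tsupport fun h => hxb (hηs h)
      have h2 : η (x - s) = 0 := image_eq_zero_of_notMem_tsupport fun h =>
        hxb (hδs (Metric.mem_thickening_iff.2 ⟨_, h, by
          rw [dist_eq_norm, sub_sub_cancel]; linarith⟩))
      have h3 : W (x - s) = 0 := by
        rw [hW, indicator_apply_eq_zero]; intro _; rw [h2, zero_mul]
      rw [h3, h1, zero_mul, sub_zero, abs_zero]
      linarith

theorem IsSmoothApprox.congr {v' : Euc d → ℝ} {G' : Euc d → Euc d} {φ : ℕ → Euc d → ℝ}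
    (h : IsSmoothApprox Ω v G φ) (hΩ : MeasurableSet Ω) (hv : EqOn v v' Ω) (hG : EqOn G G' Ω) :
    IsSmoothApprox Ω v' G' φ := by
  refine ⟨h.contDiff, h.hasCompactSupport, h.tendsto.congr fun k => eLpNorm_congr_ae ?_,
    h.tendsto_gradient.congr fun k => eLpNorm_congr_ae ?_⟩
  · filter_upwards [ae_restrict_mem hΩ] with x hx
    rw [hv hx]
  · filter_upwards [ae_restrict_mem hΩ] with x hx
    rw [hG hx]

theorem isSmoothApprox_zero : IsSmoothApprox Ω (fun _ => 0) (fun _ => 0) (fun _ _ => 0) := by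
  refine ⟨fun _ => contDiff_const, fun _ => HasCompactSupport.zero, ?_, ?_⟩
  · simp
  · simp [gradient]

theorem tendsto_eLpNorm_add_sub {X F : Type*} [MeasurableSpace X] [NormedAddCommGroup F]
    {μ : Measure X} {f g : ℕ → X → F} {p q : X → F} (hf : ∀ k, AEStronglyMeasurable (f k) μ)
    (hg : ∀ k, AEStronglyMeasurable (g k) μ) (hp : AEStronglyMeasurable p μ)
    (hq : AEStronglyMeasurable q μ)
    (h1 : Tendsto (fun k => eLpNorm (fun x => f k x - p x) 2 μ) atTop (𝓝 0))
    (h2 : Tendsto (fun k => eLpNorm (fun x => g k x - q x) 2 μ) atTop (𝓝 0)) :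
    Tendsto (fun k => eLpNorm (fun x => (f k x + g k x) - (p x + q x)) 2 μ) atTop (𝓝 0) := by
  refine tendsto_of_tendsto_of_tendsto_of_le_of_le tendsto_const_nhds
    (by simpa using h1.add h2) (fun _ => zero_le) fun k => ?_
  refine le_trans (le_of_eq ?_) (eLpNorm_add_le ((hf k).sub hp) ((hg k).sub hq) (by norm_num))
  congr 1
  funext x
  simp only [Pi.add_apply]
  abel

theorem IsSmoothApprox.add {v' : Euc d → ℝ} {G' : Euc d → Euc d} {φ φ' : ℕ → Euc d → ℝ}
    (h : IsSmoothApprox Ω v G φ) (h' : IsSmoothApprox Ω v' G' φ')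
    (hv : AEStronglyMeasurable v (volume.restrict Ω))
    (hv' : AEStronglyMeasurable v' (volume.restrict Ω))
    (hG : AEStronglyMeasurable G (volume.restrict Ω))
    (hG' : AEStronglyMeasurable G' (volume.restrict Ω)) :
    IsSmoothApprox Ω (fun x => v x + v' x) (fun x => G x + G' x) fun k x => φ k x + φ' k x := by
  refine ⟨fun k => (h.contDiff k).add (h'.contDiff k),
    fun k => (h.hasCompactSupport k).add (h'.hasCompactSupport k),
    tendsto_eLpNorm_add_sub (fun k => (h.contDiff k).continuous.aestronglyMeasurable)
      (fun k => (h'.contDiff k).continuous.aestronglyMeasurable) hv hv' h.tendsto h'.tendsto, ?_⟩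
  have hg : ∀ k x, gradient (fun x => φ k x + φ' k x) x = gradient (φ k) x + gradient (φ' k) x :=
    fun k x => gradient_add ((h.contDiff k).differentiable (by simp) x)
      ((h'.contDiff k).differentiable (by simp) x)
  simp only [hg]
  exact tendsto_eLpNorm_add_sub
    (fun k => (continuous_gradient (h.contDiff k)).aestronglyMeasurable)
    (fun k => (continuous_gradient (h'.contDiff k)).aestronglyMeasurable) hG hG'
    h.tendsto_gradient h'.tendsto_gradient

/-- **Density of smooth functions** in `H¹` of a Lipschitz domain. The approximation is uniform
if the function is continuous up to the boundary. -/
theorem IsWeakGrad.exists_isSmoothApprox (hΩ : IsBoundedLipschitz Ω)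
    (hv : MemLp v 2 (volume.restrict Ω)) (hG : IsWeakGrad Ω v G) :
    ∃ φ, IsSmoothApprox Ω v G φ ∧
      (ContinuousOn v (closure Ω) → TendstoUniformlyOn φ v atTop (closure Ω)) := by
  obtain ⟨b, hb, hbc, -, hb1, -⟩ := exists_smooth_cutoff hΩ.isCompact_closure isOpen_univ
    (subset_univ _)
  have hb1' : ∀ x ∈ closure Ω, b =ᶠ[𝓝 x] fun _ => 1 := mem_nhdsSet_iff_forall.1 hb1
  suffices h : ContDiff ℝ ∞ b ∧ ∃ φ,
      IsSmoothApprox Ω (fun x => b x * v x) (fun x => b x • G x + v x • gradient b x) φ ∧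
      (ContinuousOn v (closure Ω) →
        TendstoUniformlyOn φ (fun x => b x * v x) atTop (closure Ω)) by
    obtain ⟨-, φ, hφ, hφu⟩ := h
    refine ⟨φ, hφ.congr hΩ.isOpen.measurableSet (fun x hx => ?_) (fun x hx => ?_), fun hc =>
      (hφu hc).congr_right fun x hx => ?_⟩
    · simp only [(hb1' x (subset_closure hx)).eq_of_nhds, one_mul]
    · have : gradient b x = 0 := by
        rw [gradient, (hb1' x (subset_closure hx)).fderiv_eq]; simp
      simp only [(hb1' x (subset_closure hx)).eq_of_nhds, one_smul, this, smul_zero, add_zero]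
    · simp only [(hb1' x hx).eq_of_nhds, one_mul]
  refine induction_on_small_support (P := fun b => ContDiff ℝ ∞ b ∧ ∃ φ,
      IsSmoothApprox Ω (fun x => b x * v x) (fun x => b x • G x + v x • gradient b x) φ ∧
      (ContinuousOn v (closure Ω) →
        TendstoUniformlyOn φ (fun x => b x * v x) atTop (closure Ω))) ?_ ?_ hbc ?_
  · refine ⟨contDiff_const, fun _ _ => 0, ?_, fun _ => ?_⟩
    · refine isSmoothApprox_zero.congr hΩ.isOpen.measurableSet (fun x _ => ?_) (fun x _ => ?_)
      · simp
      · have : gradient (0 : Euc d → ℝ) x = 0 := by simp [gradient]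
        simp [this]
    · rw [Metric.tendstoUniformlyOn_iff]
      exact fun ε hε => Eventually.of_forall fun k x _ => by simpa using hε
  · rintro ψ χ ⟨hψ, φ, hφ, hφu⟩ ⟨hχ, φ', hφ', hφu'⟩
    have hm : ∀ {ψ : Euc d → ℝ}, ContDiff ℝ ∞ ψ →
        AEStronglyMeasurable (fun x => ψ x * v x) (volume.restrict Ω) ∧ AEStronglyMeasurable
          (fun x => ψ x • G x + v x • gradient ψ x) (volume.restrict Ω) := fun hψ =>
      ⟨hψ.continuous.aestronglyMeasurable.mul hv.1,
        (hψ.continuous.aestronglyMeasurable.smul hG.memLp.1).add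
          (hv.1.smul (continuous_gradient hψ).aestronglyMeasurable)⟩
    refine ⟨hψ.add hχ, _, (hφ.add hφ' (hm hψ).1 (hm hχ).1 (hm hψ).2 (hm hχ).2).congr
      hΩ.isOpen.measurableSet (fun x _ => ?_) (fun x _ => ?_), fun hc =>
      ((hφu hc).add (hφu' hc)).congr_right fun x _ => ?_⟩
    · simp only [Pi.add_apply, add_mul]
    · have : gradient (ψ + χ) x = gradient ψ x + gradient χ x :=
        gradient_add (hψ.differentiable (by simp) x) (hχ.differentiable (by simp) x)
      simp only [this, Pi.add_apply, add_smul, smul_add]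
      abel
    · simp only [Pi.add_apply, add_mul]
  · intro x _
    by_cases hx : x ∈ closure Ω
    · obtain ⟨r, w, a, t₀, hr, ha, ht₀, hcone⟩ := hΩ.exists_cone hx
      refine ⟨Metric.ball x r, Metric.isOpen_ball, Metric.mem_ball_self hr,
        fun ζ hζ hζc hζs _ => ⟨hζ.mul hb, ?_⟩⟩
      exact hG.exists_isSmoothApprox_mul hΩ.isOpen hΩ.isBounded hv ha ht₀ hcone (hζ.mul hb)
        hζc.mul_right (tsupport_mul_subset_left.trans hζs)
    · refine ⟨(closure Ω)ᶜ, isClosed_closure.isOpen_compl, hx, fun ζ hζ hζc hζs _ =>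
        ⟨hζ.mul hb, fun _ _ => 0, ?_, fun _ => ?_⟩⟩
      · have hz : ∀ y ∈ Ω, y ∉ tsupport (ζ * b) := fun y hy hys =>
          hζs (tsupport_mul_subset_left hys) (subset_closure hy)
        refine isSmoothApprox_zero.congr hΩ.isOpen.measurableSet (fun y hy => ?_) (fun y hy => ?_)
        · simp only [image_eq_zero_of_notMem_tsupport (hz y hy), zero_mul]
        · simp only [image_eq_zero_of_notMem_tsupport (hz y hy), zero_smul,
            gradient_eq_zero_of_notMem_tsupport (hz y hy), smul_zero, add_zero]
      · rw [Metric.tendstoUniformlyOn_iff]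
        refine fun ε hε => Eventually.of_forall fun k y hy => ?_
        have : y ∉ tsupport ζ := fun h => hζs h hy
        simpa [image_eq_zero_of_notMem_tsupport this] using hε

end Weak

/-! ### Green's formula with an interface -/

section Green

variable {d : ℕ}

theorem HasDivergence.setIntegral_eq {U : Set (Euc d)} {G : Euc d → Euc d} {D : Euc d → ℝ}
    (h : HasDivergence U G D) {φ : Euc d → ℝ} (hφ : ContDiff ℝ ∞ φ) (hφc : HasCompactSupport φ)
    (hs : tsupport φ ⊆ U) : (∫ y in U, ⟪G y, gradient φ y⟫) + ∫ y in U, φ y * D y = 0 := by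
  rw [setIntegral_eq_integral_of_forall_compl_eq_zero, setIntegral_eq_integral_of_forall_compl_eq_zero,
    h φ (ContDiff.lipschitzWith_of_hasCompactSupport hφc hφ (by simp)) hφc hs, neg_add_cancel]
  · exact fun y hy => by rw [image_eq_zero_of_notMem_tsupport fun h => hy (hs h), zero_mul]
  · exact fun y hy => by
      rw [gradient_eq_zero_of_notMem_tsupport fun h => hy (hs h), inner_zero_right]

theorem setIntegral_inner_gradient_eq_zero {V : Set (Euc d)}
    (G : Euc d → Euc d) {φ : Euc d → ℝ} (h : ∀ y ∈ V, y ∉ tsupport φ) :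
    ∫ y in V, ⟪G y, gradient φ y⟫ = 0 :=
  setIntegral_eq_zero_of_forall_eq_zero fun y hy => by
    rw [gradient_eq_zero_of_notMem_tsupport (h y hy), inner_zero_right]

theorem setIntegral_mul_eq_zero {μ : Measure (Euc d)} {V : Set (Euc d)}
    (D : Euc d → ℝ) {φ : Euc d → ℝ} (h : ∀ y ∈ V, y ∉ tsupport φ) :
    ∫ y in V, φ y * D y ∂μ = 0 :=
  setIntegral_eq_zero_of_forall_eq_zero fun y hy => by
    rw [image_eq_zero_of_notMem_tsupport (h y hy), zero_mul]

/-- The flux through a piece of the boundary in the coordinates of a chart. -/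
theorem IsGraphChart.integral_flux_eq (hd : 1 ≤ d) {U N : Set (Euc d)} {e : Euc d}
    {γ : Hyper e → ℝ} {K : ℝ≥0} (h : IsGraphChart U N e γ K) (hU : IsOpen U) {Φ : Euc d → Euc d}
    {q ψ : Euc d → ℝ} (hs : tsupport ψ ⊆ N)
    (hq : ∀ᵐ s ∂(surfaceMeasure (frontier U)), s ∈ tsupport ψ → ∀ n, IsOuterUnitNormal U s n →
      ⟪Φ s, n⟫ = q s) :
    ∫ x, ψ (graphMap e γ x) * ⟪Φ (graphMap e γ x), graphConormal e γ x⟫ =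
      -∫ s, ψ s * q s ∂(surfaceMeasure (frontier U)) := by
  rw [h.integral_surfaceMeasure hd hU fun y hy => by
    rw [image_eq_zero_of_notMem_tsupport fun h' => hy (hs h'), zero_mul], ← integral_neg]
  refine integral_congr_ae ?_
  filter_upwards [h.ae_of_ae_surfaceMeasure hd hU hq, h.lipschitz.ae_differentiableAt]
    with x hx hdiff
  by_cases hxs : graphMap e γ x ∈ tsupport ψ
  · have h1 := hx (hs hxs) hxs _ (h.isOuterUnitNormal (hs hxs) hdiff)
    rw [← h1, inner_neg_right, inner_smul_right]
    have : areaDensity γ x ≠ 0 := (zero_lt_one.trans_le (one_le_areaDensity γ x)).ne'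
    field_simp
  · rw [image_eq_zero_of_notMem_tsupport hxs]; simp

/-- **Green's formula** in a domain with an interface. The conditions on the normal components are
only required where the test function lives. -/
theorem green_interface (hd : 1 ≤ d) {Ω Ωm Ωp : Set (Euc d)} (hΩ : IsBoundedLipschitz Ω)
    (hΩm : IsBoundedLipschitz Ωm) (hsub : closure Ωm ⊆ Ω) (hΩp : Ωp = Ω \ closure Ωm)
    {Gm Gp : Euc d → Euc d} {Dm Dp : Euc d → ℝ} (hGm : ContinuousOn Gm (closure Ωm))
    (hGp : ContinuousOn Gp (closure Ωp)) (hdm : HasDivergence Ωm Gm Dm)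
    (hdp : HasDivergence Ωp Gp Dp) (hDm : IntegrableOn Dm Ωm) (hDp : IntegrableOn Dp Ωp)
    {p q : Euc d → ℝ} (hpi : Integrable p (surfaceMeasure (frontier Ωm)))
    (hqi : Integrable q (surfaceMeasure (frontier Ω)))
    {φ : Euc d → ℝ} (hφ : ContDiff ℝ ∞ φ) (hφc : HasCompactSupport φ)
    (hp : ∀ᵐ s ∂(surfaceMeasure (frontier Ωm)), ∀ n, IsOuterUnitNormal Ωm s n →
      ⟪Gp s, n⟫ - ⟪Gm s, n⟫ = p s)
    (hq : ∀ᵐ s ∂(surfaceMeasure (frontier Ω)), s ∈ tsupport φ → ∀ n, IsOuterUnitNormal Ω s n →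
      ⟪Gp s, n⟫ = q s) :
    ((∫ y in Ωm, ⟪Gm y, gradient φ y⟫) + ∫ y in Ωm, φ y * Dm y) +
      ((∫ y in Ωp, ⟪Gp y, gradient φ y⟫) + ∫ y in Ωp, φ y * Dp y) =
      (∫ s, φ s * q s ∂(surfaceMeasure (frontier Ω))) -
        ∫ s, φ s * p s ∂(surfaceMeasure (frontier Ωm)) := by
  have hΩpo : IsOpen Ωp := by rw [hΩp]; exact hΩ.isOpen.sdiff isClosed_closure
  have hbdp : Bornology.IsBounded Ωp := hΩ.isBounded.subset (by rw [hΩp]; exact sdiff_subset)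
  have hdisj : ∀ y ∈ frontier Ω, y ∉ Ω := fun y hy => by
    rw [hΩ.isOpen.frontier_eq] at hy; exact hy.2
  have hΓ : ∀ y ∈ frontier Ωm, y ∉ Ωm := fun y hy => by
    rw [hΩm.isOpen.frontier_eq] at hy; exact hy.2
  have hΓc : ∀ y ∈ frontier Ωm, y ∈ closure Ωm := fun y hy => frontier_subset_closure hy
  have hmΩ : Ωm ⊆ Ω := subset_closure.trans hsub
  have hiG : ∀ {V : Set (Euc d)} {G : Euc d → Euc d} {ψ : Euc d → ℝ}, Bornology.IsBounded V →
      ContinuousOn G (closure V) → ContDiff ℝ ∞ ψ →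
      IntegrableOn (fun y => ⟪G y, gradient ψ y⟫) V := fun hV hG hψ =>
    ((hG.inner (continuous_gradient hψ).continuousOn).integrableOn_compact
      hV.isCompact_closure).mono_set subset_closure
  have hiD : ∀ {μ : Measure (Euc d)} {D ψ : Euc d → ℝ}, Integrable D μ → ContDiff ℝ ∞ ψ →
      HasCompactSupport ψ → Integrable (fun y => ψ y * D y) μ := by
    intro μ D ψ hD hψ hψc
    obtain ⟨C, hC⟩ := hψc.exists_bound_of_continuous hψ.continuous
    exact hD.bdd_mul hψ.continuous.aestronglyMeasurable (Eventually.of_forall hC)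
  suffices h : ContDiff ℝ ∞ φ ∧ HasCompactSupport φ ∧
      ((∫ y in Ωm, ⟪Gm y, gradient φ y⟫) + ∫ y in Ωm, φ y * Dm y) +
      ((∫ y in Ωp, ⟪Gp y, gradient φ y⟫) + ∫ y in Ωp, φ y * Dp y) =
      (∫ s, φ s * q s ∂(surfaceMeasure (frontier Ω))) -
        ∫ s, φ s * p s ∂(surfaceMeasure (frontier Ωm)) from h.2.2
  refine induction_on_small_support (P := fun φ => ContDiff ℝ ∞ φ ∧ HasCompactSupport φ ∧
      ((∫ y in Ωm, ⟪Gm y, gradient φ y⟫) + ∫ y in Ωm, φ y * Dm y) +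
      ((∫ y in Ωp, ⟪Gp y, gradient φ y⟫) + ∫ y in Ωp, φ y * Dp y) =
      (∫ s, φ s * q s ∂(surfaceMeasure (frontier Ω))) -
        ∫ s, φ s * p s ∂(surfaceMeasure (frontier Ωm))) ?_ ?_ hφc ?_
  · refine ⟨contDiff_const, HasCompactSupport.zero, ?_⟩
    have h0 : ∀ y : Euc d, gradient (0 : Euc d → ℝ) y = 0 := fun y => by simp [gradient]
    simp [h0]
  · rintro ψ χ ⟨hψ, hψc, h1⟩ ⟨hχ, hχc, h2⟩
    refine ⟨hψ.add hχ, hψc.add hχc, ?_⟩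
    have hg : ∀ y, gradient (ψ + χ) y = gradient ψ y + gradient χ y := fun y =>
      gradient_add (hψ.differentiable (by simp) y) (hχ.differentiable (by simp) y)
    simp only [hg, inner_add_right, Pi.add_apply, add_mul]
    rw [integral_add (hiG hΩm.isBounded hGm hψ) (hiG hΩm.isBounded hGm hχ),
      integral_add (hiD hDm hψ hψc) (hiD hDm hχ hχc),
      integral_add (hiG hbdp hGp hψ) (hiG hbdp hGp hχ),
      integral_add (hiD hDp hψ hψc) (hiD hDp hχ hχc),
      integral_add (hiD hqi hψ hψc) (hiD hqi hχ hχc),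
      integral_add (hiD hpi hψ hψc) (hiD hpi hχ hχc)]
    linarith
  · intro x _
    by_cases hxc : x ∈ closure Ω
    swap
    -- far from the domain: all terms vanish
    · refine ⟨(closure Ω)ᶜ, isClosed_closure.isOpen_compl, hxc, fun ζ hζ hζc hζN _ =>
        ⟨hζ.mul hφ, hζc.mul_right, ?_⟩⟩
      have hz : ∀ y ∈ closure Ω, y ∉ tsupport (ζ * φ) := fun y hy h =>
        hζN (tsupport_mul_subset_left h) hy
      have hzm : ∀ y ∈ Ωm, y ∉ tsupport (ζ * φ) := fun y hy => hz y (subset_closure (hmΩ hy))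
      have hzp : ∀ y ∈ Ωp, y ∉ tsupport (ζ * φ) := fun y hy =>
        hz y (subset_closure (by rw [hΩp] at hy; exact hy.1))
      rw [setIntegral_inner_gradient_eq_zero _ hzm, setIntegral_inner_gradient_eq_zero _ hzp,
        setIntegral_mul_eq_zero _ hzm, setIntegral_mul_eq_zero _ hzp, surfaceMeasure,
        setIntegral_mul_eq_zero _ fun y hy => hz y (frontier_subset_closure hy), surfaceMeasure,
        setIntegral_mul_eq_zero _ fun y hy => hz y (subset_closure (hsub (hΓc y hy)))]
      simp
    by_cases hxΩ : x ∈ Ω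
    swap
    -- on the outer boundary: only the outer side contributes
    · have hxf : x ∈ frontier Ω := by rw [hΩ.isOpen.frontier_eq]; exact ⟨hxc, hxΩ⟩
      obtain ⟨N, e, γ, K, hxN, h⟩ := hΩ.exists_chart hxf
      have h' := h.mono (h.isOpen.inter isClosed_closure.isOpen_compl)
        (inter_subset_left (t := (closure Ωm)ᶜ))
      refine ⟨N ∩ (closure Ωm)ᶜ, h'.isOpen, ⟨hxN, fun hx => hxΩ (hsub hx)⟩,
        fun ζ hζ hζc hζN _ => ⟨hζ.mul hφ, hζc.mul_right, ?_⟩⟩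
      have hzN : tsupport (ζ * φ) ⊆ N ∩ (closure Ωm)ᶜ := tsupport_mul_subset_left.trans hζN
      have hψ : ContDiff ℝ ∞ (ζ * φ) := hζ.mul hφ
      have hψc : HasCompactSupport (ζ * φ) := hζc.mul_right
      have hzm : ∀ y ∈ closure Ωm, y ∉ tsupport (ζ * φ) := fun y hy h => (hzN h).2 hy
      have hch : ∀ y ∈ N ∩ (closure Ωm)ᶜ, y ∈ Ωp ↔ 0 < 1 * graphHeight e γ y := fun y hy => by
        rw [← h'.mem_iff_one y hy, hΩp]; exact and_iff_left hy.2
      have hgreen := integral_inner_gradient_add_integral_mul_divergence h'.norm_eq h'.lipschitz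
        (Or.inl rfl) hΩpo h'.isOpen hch hGp hdp hψ hψc hzN
        (hiD hDp hψ hψc)
      have hflux := h'.integral_flux_eq hd hΩ.isOpen hzN (hq.mono fun s hs hz =>
        hs (tsupport_mul_subset_right hz))
      rw [setIntegral_inner_gradient_eq_zero _ fun y hy => hzm y (subset_closure hy),
        setIntegral_mul_eq_zero _ fun y hy => hzm y (subset_closure hy), surfaceMeasure,
        surfaceMeasure, setIntegral_mul_eq_zero _ fun y hy => hzm y (hΓc y hy), ← surfaceMeasure]
      linarith
    by_cases hxm : x ∈ Ωm
    -- inside the interface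
    · refine ⟨Ωm, hΩm.isOpen, hxm, fun ζ hζ hζc hζN _ => ⟨hζ.mul hφ, hζc.mul_right, ?_⟩⟩
      have hzN : tsupport (ζ * φ) ⊆ Ωm := tsupport_mul_subset_left.trans hζN
      have hψ : ContDiff ℝ ∞ (ζ * φ) := hζ.mul hφ
      have hψc : HasCompactSupport (ζ * φ) := hζc.mul_right
      have hzp : ∀ y ∈ Ωp, y ∉ tsupport (ζ * φ) := fun y hy h => by
        rw [hΩp] at hy; exact hy.2 (subset_closure (hzN h))
      rw [setIntegral_inner_gradient_eq_zero _ hzp, setIntegral_mul_eq_zero _ hzp,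
        surfaceMeasure, setIntegral_mul_eq_zero _ fun y hy h => hdisj y hy (hmΩ (hzN h)),
        surfaceMeasure, setIntegral_mul_eq_zero _ fun y hy h => hΓ y hy (hzN h),
        hdm.setIntegral_eq hψ hψc hzN]
      simp
    by_cases hxmc : x ∈ closure Ωm
    swap
    -- between the interface and the outer boundary
    · refine ⟨Ωp, hΩpo, by rw [hΩp]; exact ⟨hxΩ, hxmc⟩, fun ζ hζ hζc hζN _ =>
        ⟨hζ.mul hφ, hζc.mul_right, ?_⟩⟩
      have hzN : tsupport (ζ * φ) ⊆ Ωp := tsupport_mul_subset_left.trans hζN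
      have hψ : ContDiff ℝ ∞ (ζ * φ) := hζ.mul hφ
      have hψc : HasCompactSupport (ζ * φ) := hζc.mul_right
      have hzm : ∀ y ∈ closure Ωm, y ∉ tsupport (ζ * φ) := fun y hy h => by
        have := hzN h
        rw [hΩp] at this; exact this.2 hy
      have hzm' : ∀ y ∈ Ωm, y ∉ tsupport (ζ * φ) := fun y hy => hzm y (subset_closure hy)
      rw [setIntegral_inner_gradient_eq_zero _ hzm', setIntegral_mul_eq_zero _ hzm',
        surfaceMeasure, setIntegral_mul_eq_zero _ fun y hy h => hdisj y hy (by
          have := hzN h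
          rw [hΩp] at this; exact this.1),
        surfaceMeasure, setIntegral_mul_eq_zero _ fun y hy => hzm y (hΓc y hy),
        hdp.setIntegral_eq hψ hψc hzN]
      simp
    -- on the interface: both sides contribute, with opposite orientations
    · have hxf : x ∈ frontier Ωm := by rw [hΩm.isOpen.frontier_eq]; exact ⟨hxmc, hxm⟩
      obtain ⟨N, e, γ, K, hxN, h⟩ := hΩm.exists_chart hxf
      have h' := h.mono (h.isOpen.inter hΩ.isOpen) (inter_subset_left (t := Ω))
      refine ⟨N ∩ Ω, h'.isOpen, ⟨hxN, hxΩ⟩,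
        fun ζ hζ hζc hζN _ => ⟨hζ.mul hφ, hζc.mul_right, ?_⟩⟩
      have hzN : tsupport (ζ * φ) ⊆ N ∩ Ω := tsupport_mul_subset_left.trans hζN
      have hψ : ContDiff ℝ ∞ (ζ * φ) := hζ.mul hφ
      have hψc : HasCompactSupport (ζ * φ) := hζc.mul_right
      have hch : ∀ y ∈ N ∩ Ω, y ∈ Ωp ↔ 0 < -1 * graphHeight e γ y := fun y hy => by
        rw [← h'.mem_compl_closure_iff hy, hΩp]; exact and_iff_right hy.2
      have hgm := integral_inner_gradient_add_integral_mul_divergence h'.norm_eq h'.lipschitz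
        (Or.inl rfl) hΩm.isOpen h'.isOpen h'.mem_iff_one hGm hdm hψ hψc hzN
        (hiD hDm hψ hψc)
      have hgp := integral_inner_gradient_add_integral_mul_divergence h'.norm_eq h'.lipschitz
        (Or.inr rfl) hΩpo h'.isOpen hch hGp hdp hψ hψc hzN
        (hiD hDp hψ hψc)
      have him := integrable_flux h'.norm_eq h'.lipschitz isClosed_closure (fun x hx =>
        graphMap_mem_closure h'.norm_eq h'.lipschitz (Or.inl rfl) h'.isOpen h'.mem_iff_one hx)
        hGm hψ.continuous hψc hzN
      have hip := integrable_flux h'.norm_eq h'.lipschitz isClosed_closure (fun x hx =>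
        graphMap_mem_closure h'.norm_eq h'.lipschitz (Or.inr rfl) h'.isOpen hch hx)
        hGp hψ.continuous hψc hzN
      have hflux := h'.integral_flux_eq hd hΩm.isOpen hzN (Φ := fun y => Gp y - Gm y) (q := p)
        (hp.mono fun s hs _ n hn => by rw [inner_sub_left]; exact hs n hn)
      simp only [inner_sub_left, mul_sub] at hflux
      rw [integral_sub hip him] at hflux
      have hz : ∫ s, (ζ * φ) s * q s ∂(surfaceMeasure (frontier Ω)) = 0 :=
        setIntegral_mul_eq_zero _ fun y hy h => hdisj y hy (hzN h).2
      linarith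

end Green

/-! ### The weak form of the interface problem -/

section Solution

variable {d : ℕ} {Ω Ωm Ωp U : Set (Euc d)} {u : Euc d → ℝ}

theorem HasDivergence.congr {G G' : Euc d → Euc d} {D D' : Euc d → ℝ} (h : HasDivergence U G D)
    (hU : MeasurableSet U) (hG : EqOn G G' U) (hD : D =ᵐ[volume.restrict U] D') :
    HasDivergence U G' D' := by
  intro χ hχ hχc hs
  have e1 : ∀ y, ⟪G y, gradient χ y⟫ = ⟪G' y, gradient χ y⟫ := fun y => by
    by_cases hy : y ∈ tsupport χ
    · rw [hG (hs hy)]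
    · rw [gradient_eq_zero_of_notMem_tsupport hy, inner_zero_right, inner_zero_right]
  have e2 : ∫ y, χ y * D y = ∫ y, χ y * D' y := by
    refine integral_congr_ae ?_
    rw [EventuallyEq, ae_restrict_iff' hU] at hD
    filter_upwards [hD] with y hy
    by_cases hyt : y ∈ tsupport χ
    · rw [hy (hs hyt)]
    · rw [image_eq_zero_of_notMem_tsupport hyt, zero_mul, zero_mul]
  rw [← e2, ← h χ hχ hχc hs]
  exact integral_congr_ae (Eventually.of_forall fun y => (e1 y).symm)

theorem IsC2UpToBoundary.gradFrom_eq (hU : IsOpen U) (h : IsC2UpToBoundary U u) {x : Euc d}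
    (hx : x ∈ U) : gradFrom U u x = gradient u x := by
  have hfd : ContinuousOn (fderiv ℝ u) U :=
    h.contDiffOn.continuousOn_fderiv_of_isOpen hU (by norm_num)
  have hg : ContinuousOn (gradient u) U :=
    (InnerProductSpace.toDual ℝ (Euc d)).symm.continuous.comp_continuousOn hfd
  exact extendFrom_eq (subset_closure hx) (hg x hx)

theorem IsC2UpToBoundary.continuousOn_gradFrom (h : IsC2UpToBoundary U u) :
    ContinuousOn (gradFrom U u) (closure U) :=
  continuousOn_extendFrom subset_rfl h.gradient_tendsto

/-- The interface is a null set, so that a property holds almost everywhere in the domain as soon as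
it holds on both sides of the interface. -/
theorem volume_restrict_interface (hΩm : IsBoundedLipschitz Ωm) (hsub : closure Ωm ⊆ Ω)
    (hΩp : Ωp = Ω \ closure Ωm) : volume.restrict Ω = volume.restrict (Ωm ∪ Ωp) := by
  refine Measure.restrict_congr_set ?_
  have h0 : ∀ᵐ x ∂volume, x ∉ frontier Ωm := measure_eq_zero_iff_ae_notMem.1 hΩm.volume_frontier
  filter_upwards [h0] with x hx
  rw [hΩm.isOpen.frontier_eq, Set.mem_sdiff, not_and_not_right] at hx
  refine propext ⟨fun h => ?_, fun h => ?_⟩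
  · by_cases hc : x ∈ closure Ωm
    · exact Or.inl (hx hc)
    · exact Or.inr (by rw [hΩp]; exact ⟨h, hc⟩)
  · rcases h with h | h
    · exact hsub (subset_closure h)
    · rw [hΩp] at h; exact h.1

theorem ae_restrict_interface (hΩm : IsBoundedLipschitz Ωm) (hΩ : IsOpen Ω)
    (hsub : closure Ωm ⊆ Ω) (hΩp : Ωp = Ω \ closure Ωm) {P : Euc d → Prop} (hm : ∀ x ∈ Ωm, P x)
    (hp : ∀ x ∈ Ωp, P x) : ∀ᵐ x ∂(volume.restrict Ω), P x := by
  rw [volume_restrict_interface hΩm hsub hΩp]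
  have hΩpo : IsOpen Ωp := by rw [hΩp]; exact hΩ.sdiff isClosed_closure
  exact ae_restrict_of_forall_mem (hΩm.isOpen.union hΩpo).measurableSet
    fun x hx => hx.elim (hm x) (hp x)

theorem setIntegral_interface (hΩm : IsBoundedLipschitz Ωm) (hΩ : IsOpen Ω)
    (hsub : closure Ωm ⊆ Ω) (hΩp : Ωp = Ω \ closure Ωm) {F : Type*} [NormedAddCommGroup F]
    [NormedSpace ℝ F] {h : Euc d → F} (hh : IntegrableOn h Ω) :
    ∫ x in Ω, h x = (∫ x in Ωm, h x) + ∫ x in Ωp, h x := by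
  have hΩpo : IsOpen Ωp := by rw [hΩp]; exact hΩ.sdiff isClosed_closure
  rw [volume_restrict_interface hΩm hsub hΩp, setIntegral_union]
  · rw [hΩp]; exact disjoint_sdiff_right.mono_left subset_closure
  · exact hΩpo.measurableSet
  · exact hh.mono_set (subset_closure.trans hsub)
  · exact hh.mono_set (by rw [hΩp]; exact sdiff_subset)

/-- Off the interface, the classical gradient is bounded. -/
theorem exists_norm_gradient_le (hΩ : IsBoundedLipschitz Ω) (hΩm : IsBoundedLipschitz Ωm)
    (hsub : closure Ωm ⊆ Ω) (hΩp : Ωp = Ω \ closure Ωm) (hum : IsC2UpToBoundary Ωm u)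
    (hup : IsC2UpToBoundary Ωp u) : ∃ C, ∀ᵐ x ∂(volume.restrict Ω), ‖gradient u x‖ ≤ C := by
  have hΩpo : IsOpen Ωp := by rw [hΩp]; exact hΩ.isOpen.sdiff isClosed_closure
  have hbdp : Bornology.IsBounded Ωp := hΩ.isBounded.subset (by rw [hΩp]; exact sdiff_subset)
  obtain ⟨Cm, hCm⟩ := hΩm.isCompact_closure.exists_bound_of_continuousOn hum.continuousOn_gradFrom
  obtain ⟨Cp, hCp⟩ := hbdp.isCompact_closure.exists_bound_of_continuousOn hup.continuousOn_gradFrom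
  refine ⟨max Cm Cp, ae_restrict_interface hΩm hΩ.isOpen hsub hΩp (fun x hx => ?_) fun x hx => ?_⟩
  · rw [← hum.gradFrom_eq hΩm.isOpen hx]
    exact (hCm x (subset_closure hx)).trans (le_max_left _ _)
  · rw [← hup.gradFrom_eq hΩpo hx]
    exact (hCp x (subset_closure hx)).trans (le_max_right _ _)

theorem MeasureTheory.MemLp.integrable_inner {X E : Type*} [MeasurableSpace X]
    [NormedAddCommGroup E] [InnerProductSpace ℝ E] {μ : Measure X} {f g : X → E} (hf : MemLp f 2 μ)
    (hg : MemLp g 2 μ) : Integrable (fun x => ⟪f x, g x⟫) μ :=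
  (hf.norm.integrable_mul hg.norm).mono' (hf.1.inner hg.1)
    (Eventually.of_forall fun x => norm_inner_le_norm (f x) (g x))

theorem ContDiff.memLp_gradient {φ : Euc d → ℝ} (hφ : ContDiff ℝ ∞ φ) (hφc : HasCompactSupport φ)
    {p : ℝ≥0∞} : MemLp (gradient φ) p (volume.restrict U) :=
  ((continuous_gradient hφ).memLp_of_hasCompactSupport hφc.gradient).restrict U

theorem IsBoundedLipschitz.isFiniteMeasure_volume_restrict (hΩ : IsBoundedLipschitz Ω) :
    IsFiniteMeasure (volume.restrict Ω) :=
  ⟨by rw [Measure.restrict_apply_univ]; exact hΩ.isBounded.measure_lt_top⟩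

theorem ContinuousOn.memLp_two_of_isBoundedLipschitz (hΩ : IsBoundedLipschitz Ω)
    (hu : ContinuousOn u (closure Ω)) : MemLp u 2 (volume.restrict Ω) := by
  have := hΩ.isFiniteMeasure_volume_restrict
  obtain ⟨C, hC⟩ := hΩ.isCompact_closure.exists_bound_of_continuousOn hu
  exact MemLp.of_bound ((hu.mono subset_closure).aestronglyMeasurable hΩ.isOpen.measurableSet) C
    (ae_restrict_of_forall_mem hΩ.isOpen.measurableSet fun x hx => hC x (subset_closure hx))

/-- The classical gradient off the interface of a continuous function is its weak gradient, because
the boundary terms from the two sides of the interface cancel. -/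
theorem isWeakGrad_gradient (hd : 1 ≤ d) (hΩ : IsBoundedLipschitz Ω) (hΩm : IsBoundedLipschitz Ωm)
    (hsub : closure Ωm ⊆ Ω) (hΩp : Ωp = Ω \ closure Ωm) (hu : ContinuousOn u (closure Ω))
    (hum : IsC2UpToBoundary Ωm u) (hup : IsC2UpToBoundary Ωp u) :
    IsWeakGrad Ω u (gradient u) := by
  have hfin := hΩ.isFiniteMeasure_volume_restrict
  have hΩpo : IsOpen Ωp := by rw [hΩp]; exact hΩ.isOpen.sdiff isClosed_closure
  obtain ⟨C, hC⟩ := exists_norm_gradient_le hΩ hΩm hsub hΩp hum hup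
  have hmem : MemLp (gradient u) 2 (volume.restrict Ω) :=
    MemLp.of_bound (measurable_gradient u).aestronglyMeasurable C hC
  have hGi := hmem.integrableOn_of_isBounded hΩ.isBounded
  have hui := (hu.memLp_two_of_isBoundedLipschitz hΩ).integrableOn_of_isBounded hΩ.isBounded
  refine ⟨hmem, fun φ hφ hφc hs => ?_⟩
  have hi1 : IntegrableOn (fun x => u x • gradient φ x) Ω :=
    IntegrableOn.smul_continuous hΩ.isBounded (continuous_gradient hφ) hui
  have hi2 : IntegrableOn (fun x => φ x • gradient u x) Ω :=
    IntegrableOn.continuous_smul hΩ.isBounded hφ.continuous hGi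
  -- The component along `v`: Green's formula for the field `u v`, whose normal component does not
  -- jump.
  refine ext_inner_left ℝ fun v => ?_
  have hmΩ : Ωm ⊆ Ω := subset_closure.trans hsub
  have hpΩ : Ωp ⊆ Ω := by rw [hΩp]; exact sdiff_subset
  have hDi : IntegrableOn (fun x => fderiv ℝ u x v) Ω := by
    have := hGi.inner_const (𝕜 := ℝ) v
    simpa only [IntegrableOn, inner_gradient_left] using this
  have hGreen := green_interface hd hΩ hΩm hsub hΩp (Gm := fun y => u y • v) (Gp := fun y => u y • v)
    ((hu.mono (closure_mono hmΩ)).smul continuousOn_const)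
    ((hu.mono (closure_mono hpΩ)).smul continuousOn_const)
    (hasDivergence_smul_const hΩm.isOpen (hum.contDiffOn.of_le (by norm_num)) v)
    (hasDivergence_smul_const hΩpo (hup.contDiffOn.of_le (by norm_num)) v)
    (hDi.mono_set hmΩ) (hDi.mono_set hpΩ) (p := 0) (q := 0) (integrable_zero _ _ _)
    (integrable_zero _ _ _) hφ hφc (Eventually.of_forall fun s n _ => sub_self _) (by
      rw [surfaceMeasure]
      refine ae_restrict_of_forall_mem isClosed_frontier.measurableSet fun s hsf hst => ?_
      rw [hΩ.isOpen.frontier_eq] at hsf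
      exact absurd (hs hst) hsf.2)
  simp only [Pi.zero_apply, mul_zero, integral_zero, sub_zero, inner_smul_left, conj_trivial]
    at hGreen
  have hj1 : IntegrableOn (fun y => u y * ⟪v, gradient φ y⟫) Ω := by
    have := hi1.const_inner (𝕜 := ℝ) v
    simpa only [IntegrableOn, inner_smul_right] using this
  have hj2 : IntegrableOn (fun y => φ y * fderiv ℝ u y v) Ω := by
    have := hi2.inner_const (𝕜 := ℝ) v
    simpa only [IntegrableOn, inner_smul_left, inner_gradient_left, conj_trivial] using this
  have e1 := setIntegral_interface hΩm hΩ.isOpen hsub hΩp hj1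
  have e2 := setIntegral_interface hΩm hΩ.isOpen hsub hΩp hj2
  rw [inner_neg_right, ← integral_inner hi1, ← integral_inner hi2]
  simp only [inner_smul_right, inner_gradient_right, RCLike.conj_to_real]
  simp only [inner_gradient_right, RCLike.conj_to_real] at hGreen e1
  linarith

/-- The weak form of the interface problem. -/
theorem weak_form (hd : 1 ≤ d) (hΩ : IsBoundedLipschitz Ω) (hΩm : IsBoundedLipschitz Ωm)
    (hsub : closure Ωm ⊆ Ω) (hΩp : Ωp = Ω \ closure Ωm) {α β : ℝ} (hβ : 0 < β)
    {f c g : Euc d → ℝ} (hf : MemLp f 2 (volume.restrict Ω))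
    (hc : MemLp c 2 (surfaceMeasure (frontier Ωm))) (hg : MemLp g 2 (surfaceMeasure (frontier Ω)))
    (hu : ContinuousOn u (closure Ω)) (hum : IsC2UpToBoundary Ωm u) (hup : IsC2UpToBoundary Ωp u)
    (hpde : ∀ᵐ x ∂(volume.restrict (Ω \ frontier Ωm)), Δ u x - α * u x = f x)
    (hjump : ∀ᵐ s ∂(surfaceMeasure (frontier Ωm)), ∀ n, IsOuterUnitNormal Ωm s n →
      ⟪gradFrom Ωp u s, n⟫ - ⟪gradFrom Ωm u s, n⟫ = c s)
    (hrobin : ∀ᵐ s ∂(surfaceMeasure (frontier Ω)), ∀ n, IsOuterUnitNormal Ω s n →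
      u s + 1 / (2 * β) * ⟪gradFrom Ωp u s, n⟫ = g s)
    {φ : Euc d → ℝ} (hφ : ContDiff ℝ ∞ φ) (hφc : HasCompactSupport φ) :
    (∫ x in Ω, ⟪gradient u x, gradient φ x⟫) + (∫ x in Ω, φ x * (α * u x + f x)) +
      (∫ s, φ s * c s ∂(surfaceMeasure (frontier Ωm))) +
      ∫ s, φ s * (2 * β * (u s - g s)) ∂(surfaceMeasure (frontier Ω)) = 0 := by
  have hfin := hΩ.isFiniteMeasure_volume_restrict
  have hfinS := hΩ.isFiniteMeasure_surfaceMeasure hd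
  have hfinΓ := hΩm.isFiniteMeasure_surfaceMeasure hd
  have hΩpo : IsOpen Ωp := by rw [hΩp]; exact hΩ.isOpen.sdiff isClosed_closure
  have hmΩ : Ωm ⊆ Ω := subset_closure.trans hsub
  have hpΩ : Ωp ⊆ Ω := by rw [hΩp]; exact sdiff_subset
  have hG := isWeakGrad_gradient hd hΩ hΩm hsub hΩp hu hum hup
  have hGi := hG.memLp.integrableOn_of_isBounded hΩ.isBounded
  have hui := (hu.memLp_two_of_isBoundedLipschitz hΩ).integrableOn_of_isBounded hΩ.isBounded
  have hDi : IntegrableOn (fun x => α * u x + f x) Ω :=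
    (hui.const_mul α).add (hf.integrableOn_of_isBounded hΩ.isBounded)
  have hus : Integrable u (surfaceMeasure (frontier Ω)) := by
    obtain ⟨C, hC⟩ := hΩ.isCompact_frontier.exists_bound_of_continuousOn
      (hu.mono frontier_subset_closure)
    exact Integrable.of_bound ((hu.mono frontier_subset_closure).aestronglyMeasurable
      isClosed_frontier.measurableSet) C
      (ae_restrict_of_forall_mem isClosed_frontier.measurableSet hC)
  have hlap : ∀ {V : Set (Euc d)}, V ⊆ Ω \ frontier Ωm →
      Δ u =ᵐ[volume.restrict V] fun x => α * u x + f x := by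
    intro V hV
    filter_upwards [ae_restrict_of_ae_restrict_of_subset hV hpde] with x hx
    linarith
  have hdm : HasDivergence Ωm (gradFrom Ωm u) fun x => α * u x + f x :=
    (hasDivergence_gradient hΩm.isOpen hum.contDiffOn).congr hΩm.isOpen.measurableSet
      (fun x hx => (hum.gradFrom_eq hΩm.isOpen hx).symm) (hlap fun x hx => ⟨hmΩ hx, fun h => by
        rw [hΩm.isOpen.frontier_eq] at h; exact h.2 hx⟩)
  have hdp : HasDivergence Ωp (gradFrom Ωp u) fun x => α * u x + f x :=
    (hasDivergence_gradient hΩpo hup.contDiffOn).congr hΩpo.measurableSet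
      (fun x hx => (hup.gradFrom_eq hΩpo hx).symm) (hlap fun x hx => ⟨hpΩ hx, fun h => by
        rw [hΩp] at hx; exact hx.2 (frontier_subset_closure h)⟩)
  have hGreen := green_interface hd hΩ hΩm hsub hΩp hum.continuousOn_gradFrom
    hup.continuousOn_gradFrom hdm hdp (hDi.mono_set hmΩ) (hDi.mono_set hpΩ)
    (p := c) (q := fun s => 2 * β * (g s - u s)) (hc.integrable (by norm_num))
    (((hg.integrable (by norm_num)).sub hus).const_mul _) hφ hφc hjump (by
      filter_upwards [hrobin] with s hs _ n hn
      rw [← hs n hn]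
      field_simp
      ring)
  have e1 := setIntegral_interface hΩm hΩ.isOpen hsub hΩp
    (hG.memLp.integrable_inner (hφ.memLp_gradient hφc))
  have e2 := setIntegral_interface hΩm hΩ.isOpen hsub hΩp
    (IntegrableOn.continuous_smul hΩ.isBounded hφ.continuous hDi)
  have e3 : ∀ {V}, IsOpen V → IsC2UpToBoundary V u → ∫ y in V, ⟪gradFrom V u y, gradient φ y⟫ =
      ∫ y in V, ⟪gradient u y, gradient φ y⟫ := fun hV h =>
    setIntegral_congr_fun hV.measurableSet fun y hy => by simp only [h.gradFrom_eq hV hy]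
  rw [e3 hΩm.isOpen hum, e3 hΩpo hup] at hGreen
  have e4 : ∫ s, φ s * (2 * β * (u s - g s)) ∂(surfaceMeasure (frontier Ω)) =
      -∫ s, φ s * (2 * β * (g s - u s)) ∂(surfaceMeasure (frontier Ω)) := by
    rw [← integral_neg]
    refine integral_congr_ae (Eventually.of_forall fun s => ?_)
    simp only
    ring
  simp only [smul_eq_mul] at e2
  rw [e1, e2, e4]
  linarith

end Solution

/-! ### Traces -/

section Trace

variable {d : ℕ} {Ω S : Set (Euc d)} {u v w : Euc d → ℝ} {G G' : Euc d → Euc d}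

theorem MemH1.isWeakGrad_weakGrad (hv : MemH1 Ω v) : IsWeakGrad Ω v (weakGrad Ω v) := by
  rw [weakGrad, dif_pos hv.2]
  exact hv.2.choose_spec

/-- Weak gradients are unique almost everywhere. -/
theorem IsWeakGrad.ae_eq (hΩ : IsBoundedLipschitz Ω) (h : IsWeakGrad Ω v G)
    (h' : IsWeakGrad Ω v G') : G =ᵐ[volume.restrict Ω] G' := by
  have hi := h.memLp.integrableOn_of_isBounded hΩ.isBounded
  have hi' := h'.memLp.integrableOn_of_isBounded hΩ.isBounded
  have key := hΩ.isOpen.ae_eq_zero_of_integral_contDiff_smul_eq_zero (μ := volume)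
    (f := fun x => G x - G' x) (hi.sub hi').locallyIntegrableOn fun φ hφ hφc hs => by
      rw [← setIntegral_eq_integral_of_forall_compl_eq_zero (s := Ω) fun x hx => by
        rw [image_eq_zero_of_notMem_tsupport fun h => hx (hs h), zero_smul]]
      simp only [smul_sub]
      rw [integral_sub (IntegrableOn.continuous_smul hΩ.isBounded hφ.continuous hi)
        (IntegrableOn.continuous_smul hΩ.isBounded hφ.continuous hi'), sub_eq_zero,
        ← neg_inj, ← h.integral_eq φ hφ hφc hs, ← h'.integral_eq φ hφ hφc hs]
  rw [EventuallyEq, ae_restrict_iff' hΩ.isOpen.measurableSet]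
  filter_upwards [key] with x hx hxΩ
  exact sub_eq_zero.1 (hx hxΩ)

theorem IsWeakGrad.add (hΩ : Bornology.IsBounded Ω) (hv : MemLp v 2 (volume.restrict Ω))
    (hw : MemLp w 2 (volume.restrict Ω)) (h : IsWeakGrad Ω v G) (h' : IsWeakGrad Ω w G') :
    IsWeakGrad Ω (v + w) (G + G') := by
  refine ⟨h.memLp.add h'.memLp, fun φ hφ hφc hs => ?_⟩
  have hi := h.memLp.integrableOn_of_isBounded hΩ
  have hi' := h'.memLp.integrableOn_of_isBounded hΩ
  simp only [Pi.add_apply, add_smul, smul_add]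
  rw [integral_add (IntegrableOn.smul_continuous hΩ (continuous_gradient hφ)
      (hv.integrableOn_of_isBounded hΩ)) (IntegrableOn.smul_continuous hΩ (continuous_gradient hφ)
      (hw.integrableOn_of_isBounded hΩ)),
    integral_add (IntegrableOn.continuous_smul hΩ hφ.continuous hi)
      (IntegrableOn.continuous_smul hΩ hφ.continuous hi'), h.integral_eq φ hφ hφc hs,
    h'.integral_eq φ hφ hφc hs, neg_add]

theorem IsWeakGrad.neg (h : IsWeakGrad Ω v G) : IsWeakGrad Ω (-v) (-G) := by
  refine ⟨h.memLp.neg, fun φ hφ hφc hs => ?_⟩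
  simp only [Pi.neg_apply, neg_smul, smul_neg, integral_neg]
  rw [h.integral_eq φ hφ hφc hs]

theorem MemH1.sub (hΩ : Bornology.IsBounded Ω) (hv : MemH1 Ω v) (hw : MemH1 Ω w) :
    MemH1 Ω (v - w) := by
  refine ⟨hv.1.sub hw.1, weakGrad Ω v + -weakGrad Ω w, ?_⟩
  rw [sub_eq_add_neg]
  exact hv.isWeakGrad_weakGrad.add hΩ hv.1 hw.1.neg hw.isWeakGrad_weakGrad.neg

theorem weakGrad_add (hΩ : IsBoundedLipschitz Ω) (hv : MemH1 Ω v) (hw : MemH1 Ω w) :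
    weakGrad Ω (v + w) =ᵐ[volume.restrict Ω] weakGrad Ω v + weakGrad Ω w := by
  have h := hv.isWeakGrad_weakGrad.add hΩ.isBounded hv.1 hw.1 hw.isWeakGrad_weakGrad
  have hm : MemH1 Ω (v + w) := ⟨hv.1.add hw.1, _, h⟩
  exact hm.isWeakGrad_weakGrad.ae_eq hΩ h

theorem eLpNorm_two_sq_eq_ofReal {X F : Type*} [MeasurableSpace X] [NormedAddCommGroup F]
    {μ : Measure X} {f : X → F} (hf : MemLp f 2 μ) :
    eLpNorm f 2 μ ^ 2 = ENNReal.ofReal (∫ x, ‖f x‖ ^ 2 ∂μ) := by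
  rw [eLpNorm_two_sq, ofReal_integral_eq_lintegral_ofReal hf.norm.integrable_sq
    (Eventually.of_forall fun x => sq_nonneg _)]
  refine lintegral_congr fun x => ?_
  rw [ENNReal.ofReal_pow (norm_nonneg _), ofReal_norm]

theorem tendsto_eLpNorm_two_iff {X F ι : Type*} [MeasurableSpace X] [NormedAddCommGroup F]
    {μ : Measure X} {f : ι → X → F} {l : Filter ι} (hf : ∀ i, MemLp (f i) 2 μ) :
    Tendsto (fun i => eLpNorm (f i) 2 μ) l (𝓝 0) ↔
      Tendsto (fun i => ∫ x, ‖f i x‖ ^ 2 ∂μ) l (𝓝 0) := by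
  have h1 : ∀ i, ∫ x, ‖f i x‖ ^ 2 ∂μ = (eLpNorm (f i) 2 μ ^ 2).toReal := fun i => by
    rw [eLpNorm_two_sq_eq_ofReal (hf i), ENNReal.toReal_ofReal (integral_nonneg fun x => sq_nonneg _)]
  have h2 : ∀ i, eLpNorm (f i) 2 μ = ENNReal.ofReal (∫ x, ‖f i x‖ ^ 2 ∂μ) ^ (1 / 2 : ℝ) := fun i => by
    rw [← eLpNorm_two_sq_eq_ofReal (hf i), ← ENNReal.rpow_natCast, ← ENNReal.rpow_mul]
    norm_num
  constructor
  · intro h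
    simp only [h1]
    rw [← ENNReal.toReal_zero, ENNReal.tendsto_toReal_iff
      (fun i => ENNReal.pow_ne_top (hf i).2.ne) ENNReal.zero_ne_top]
    have := ENNReal.Tendsto.pow (n := 2) h
    simpa using this
  · intro h
    simp only [h2]
    have := (ENNReal.tendsto_ofReal h).ennrpow_const (1 / 2 : ℝ)
    simpa using this

/-- A compact set of finite surface measure in the closure of `Ω` for which the trace inequality
holds, so that functions in `H¹(Ω)` have traces on it. -/
structure IsTraceSurface (Ω S : Set (Euc d)) : Prop where
  isCompact : IsCompact S
  subset_closure : S ⊆ closure Ω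
  isFiniteMeasure : IsFiniteMeasure (surfaceMeasure S)
  exists_le : ∃ C : ℝ, 0 ≤ C ∧ ∀ φ : Euc d → ℝ, ContDiff ℝ ∞ φ →
    ∫ s, φ s ^ 2 ∂(surfaceMeasure S) ≤ C * ((∫ y in Ω, φ y ^ 2) + ∫ y in Ω, ‖gradient φ y‖ ^ 2)

theorem IsBoundedLipschitz.isTraceSurface (hd : 1 ≤ d) (hΩ : IsBoundedLipschitz Ω)
    {V : Set (Euc d)} (hV : IsBoundedLipschitz V) (hsub : V ⊆ Ω) :
    IsTraceSurface Ω (frontier V) := by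
  obtain ⟨C, hC, h⟩ := hV.exists_trace_inequality hd
  refine ⟨hV.isCompact_frontier, frontier_subset_closure.trans (closure_mono hsub),
    hV.isFiniteMeasure_surfaceMeasure hd, C, hC, fun φ hφ => (h φ hφ).trans ?_⟩
  refine mul_le_mul_of_nonneg_left (add_le_add ?_ ?_) hC
  · exact setIntegral_mono_set ((hφ.continuous.pow 2).integrableOn_of_isBounded hΩ.isBounded)
      (Eventually.of_forall fun _ => sq_nonneg _) hsub.eventuallyLE
  · exact setIntegral_mono_set
      (((continuous_gradient hφ).norm.pow 2).integrableOn_of_isBounded hΩ.isBounded)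
      (Eventually.of_forall fun _ => sq_nonneg _) hsub.eventuallyLE

theorem Continuous.memLp_two_of_isBoundedLipschitz {F : Type*} [NormedAddCommGroup F]
    (hΩ : IsBoundedLipschitz Ω) {f : Euc d → F} (hf : Continuous f) :
    MemLp f 2 (volume.restrict Ω) := by
  have := hΩ.isFiniteMeasure_volume_restrict
  obtain ⟨C, hC⟩ := hΩ.isCompact_closure.exists_bound_of_continuousOn hf.continuousOn
  exact MemLp.of_bound hf.aestronglyMeasurable C
    (ae_restrict_of_forall_mem hΩ.isOpen.measurableSet fun x hx => hC x (subset_closure hx))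

theorem IsTraceSurface.memLp_two (hS : IsTraceSurface Ω S) (hu : ContinuousOn u S) :
    MemLp u 2 (surfaceMeasure S) := by
  have := hS.isFiniteMeasure
  obtain ⟨C, hC⟩ := hS.isCompact.exists_bound_of_continuousOn hu
  exact MemLp.of_bound (hu.aestronglyMeasurable hS.isCompact.measurableSet) C
    (ae_restrict_of_forall_mem hS.isCompact.measurableSet hC)

/-- Smooth functions tending to zero in `H¹(Ω)` tend to zero on the surface. -/
theorem IsTraceSurface.tendsto_zero (hΩ : IsBoundedLipschitz Ω) (hS : IsTraceSurface Ω S) {ι : Type*}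
    {l : Filter ι} {φ : ι → Euc d → ℝ} (hφ : ∀ i, ContDiff ℝ ∞ (φ i))
    (h : Tendsto (fun i => eLpNorm (φ i) 2 (volume.restrict Ω)) l (𝓝 0))
    (hg : Tendsto (fun i => eLpNorm (gradient (φ i)) 2 (volume.restrict Ω)) l (𝓝 0)) :
    Tendsto (fun i => eLpNorm (φ i) 2 (surfaceMeasure S)) l (𝓝 0) := by
  obtain ⟨C, -, hC⟩ := hS.exists_le
  rw [tendsto_eLpNorm_two_iff fun i =>
    (hφ i).continuous.memLp_two_of_isBoundedLipschitz hΩ] at h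
  rw [tendsto_eLpNorm_two_iff fun i =>
    (continuous_gradient (hφ i)).memLp_two_of_isBoundedLipschitz hΩ] at hg
  rw [tendsto_eLpNorm_two_iff fun i => hS.memLp_two (hφ i).continuous.continuousOn]
  refine squeeze_zero (fun i => integral_nonneg fun x => sq_nonneg _) (fun i => ?_)
    (by simpa using (h.add hg).const_mul C)
  simpa only [Real.norm_eq_abs, sq_abs] using hC (φ i) (hφ i)

theorem tendsto_eLpNorm_sub_sub {X F ι : Type*} [MeasurableSpace X] [NormedAddCommGroup F]
    {μ : Measure X} {l : Filter ι} {f g : ι → X → F} {p : X → F}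
    (hf : ∀ k, AEStronglyMeasurable (f k) μ) (hg : ∀ k, AEStronglyMeasurable (g k) μ)
    (hp : AEStronglyMeasurable p μ) (h1 : Tendsto (fun k => eLpNorm (fun x => f k x - p x) 2 μ) l (𝓝 0))
    (h2 : Tendsto (fun k => eLpNorm (fun x => g k x - p x) 2 μ) l (𝓝 0)) :
    Tendsto (fun k => eLpNorm (fun x => f k x - g k x) 2 μ) l (𝓝 0) := by
  refine tendsto_of_tendsto_of_tendsto_of_le_of_le tendsto_const_nhds
    (by simpa using h1.add h2) (fun _ => zero_le) fun k => ?_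
  refine le_trans (le_of_eq ?_) (eLpNorm_sub_le ((hf k).sub hp) ((hg k).sub hp) (by norm_num))
  congr 1
  funext x
  simp

/-- Two sequences of smooth functions with the same limit in `H¹(Ω)` have the same limit on the
surface. -/
theorem IsTraceSurface.tendsto_sub_zero (hΩ : IsBoundedLipschitz Ω) (hS : IsTraceSurface Ω S)
    {ι : Type*} {l : Filter ι} {φ ψ : ι → Euc d → ℝ} (hφ : ∀ i, ContDiff ℝ ∞ (φ i))
    (hψ : ∀ i, ContDiff ℝ ∞ (ψ i)) (hv : MemLp v 2 (volume.restrict Ω))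
    (hG : MemLp G 2 (volume.restrict Ω))
    (h1 : Tendsto (fun i => eLpNorm (fun x => φ i x - v x) 2 (volume.restrict Ω)) l (𝓝 0))
    (h2 : Tendsto (fun i => eLpNorm (fun x => gradient (φ i) x - G x) 2 (volume.restrict Ω)) l (𝓝 0))
    (h3 : Tendsto (fun i => eLpNorm (fun x => ψ i x - v x) 2 (volume.restrict Ω)) l (𝓝 0))
    (h4 : Tendsto (fun i => eLpNorm (fun x => gradient (ψ i) x - G x) 2 (volume.restrict Ω)) l
      (𝓝 0)) :
    Tendsto (fun i => eLpNorm (fun x => φ i x - ψ i x) 2 (surfaceMeasure S)) l (𝓝 0) := by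
  refine hS.tendsto_zero hΩ (fun i => (hφ i).sub (hψ i))
    (tendsto_eLpNorm_sub_sub (fun i => (hφ i).continuous.aestronglyMeasurable)
      (fun i => (hψ i).continuous.aestronglyMeasurable) hv.1 h1 h3) ?_
  have hg : ∀ i, gradient (fun x => φ i x - ψ i x) = fun x => gradient (φ i) x - gradient (ψ i) x :=
    fun i => funext fun x => by
      simp only [gradient, fderiv_fun_sub ((hφ i).differentiable (by simp) x)
        ((hψ i).differentiable (by simp) x), map_sub]
  simp only [hg]
  exact tendsto_eLpNorm_sub_sub (fun i => (continuous_gradient (hφ i)).aestronglyMeasurable)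
    (fun i => (continuous_gradient (hψ i)).aestronglyMeasurable) hG.1 h2 h4

/-- Every `H¹` function has a trace: smooth approximations are Cauchy on the surface. -/
theorem IsTraceSurface.isTrace_trace (hΩ : IsBoundedLipschitz Ω) (hS : IsTraceSurface Ω S)
    (hv : MemH1 Ω v) : IsTrace Ω S v (trace Ω S v) := by
  suffices h : ∃ T, IsTrace Ω S v T by
    rw [trace, dif_pos h]
    exact h.choose_spec
  have hw := hv.isWeakGrad_weakGrad
  obtain ⟨φ, hφ, -⟩ := hw.exists_isSmoothApprox hΩ hv.1
  have hm : ∀ k, MemLp (φ k) 2 (surfaceMeasure S) := fun k =>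
    hS.memLp_two (hφ.contDiff k).continuous.continuousOn
  have hcau : CauchySeq fun k => (hm k).toLp (φ k) := by
    rw [Lp.cauchySeq_Lp_iff_cauchySeq_eLpNorm]
    have hfst : Tendsto (Prod.fst : ℕ × ℕ → ℕ) atTop atTop := by
      rw [← prod_atTop_atTop_eq]; exact tendsto_fst
    have hsnd : Tendsto (Prod.snd : ℕ × ℕ → ℕ) atTop atTop := by
      rw [← prod_atTop_atTop_eq]; exact tendsto_snd
    refine (hS.tendsto_sub_zero hΩ (φ := fun n : ℕ × ℕ => φ n.1) (ψ := fun n : ℕ × ℕ => φ n.2)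
      (fun n => hφ.contDiff _) (fun n => hφ.contDiff _) hv.1 hw.memLp (hφ.tendsto.comp hfst)
      (hφ.tendsto_gradient.comp hfst) (hφ.tendsto.comp hsnd)
      (hφ.tendsto_gradient.comp hsnd)).congr fun n => ?_
    refine eLpNorm_congr_ae ?_
    filter_upwards [(hm n.1).coeFn_toLp, (hm n.2).coeFn_toLp] with x h1 h2
    rw [Pi.sub_apply, h1, h2]
  obtain ⟨T, hT⟩ := cauchySeq_tendsto_of_complete hcau
  refine ⟨T, Lp.memLp T, φ, hφ.contDiff, hφ.tendsto, hφ.tendsto_gradient, ?_⟩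
  rw [← Lp.toLp_coeFn T (Lp.memLp T)] at hT
  exact (Lp.tendsto_Lp_iff_tendsto_eLpNorm'' _ hm _ (Lp.memLp T)).1 hT

/-- Every smooth approximation in `H¹(Ω)`, not only the one defining the trace, converges to the trace
on the surface. -/
theorem IsTraceSurface.tendsto_trace (hΩ : IsBoundedLipschitz Ω) (hS : IsTraceSurface Ω S)
    (hv : MemH1 Ω v) {φ : ℕ → Euc d → ℝ} (hφ : IsSmoothApprox Ω v (weakGrad Ω v) φ) :
    Tendsto (fun k => eLpNorm (fun x => φ k x - trace Ω S v x) 2 (surfaceMeasure S)) atTop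
      (𝓝 0) := by
  obtain ⟨hT, ψ, hψ, h1, h2, h3⟩ := hS.isTrace_trace hΩ hv
  have h := hS.tendsto_sub_zero hΩ hψ hφ.contDiff hv.1 hv.isWeakGrad_weakGrad.memLp h1 h2 hφ.tendsto
    hφ.tendsto_gradient
  have := tendsto_eLpNorm_sub_sub (f := fun k x => ψ k x - trace Ω S v x)
    (g := fun k x => ψ k x - φ k x) (p := 0)
    (fun k => (hψ k).continuous.aestronglyMeasurable.sub hT.1)
    (fun k => (hψ k).continuous.aestronglyMeasurable.sub (hφ.contDiff k).continuous.aestronglyMeasurable)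
    aestronglyMeasurable_zero (by simpa using h3) (by simpa using h)
  simpa using this

theorem ae_eq_of_tendsto_eLpNorm_sub {X F : Type*} [MeasurableSpace X] [NormedAddCommGroup F]
    {μ : Measure X} {f : ℕ → X → F} {p q : X → F}
    (hf : ∀ k, AEStronglyMeasurable (f k) μ) (hp : AEStronglyMeasurable p μ)
    (hq : AEStronglyMeasurable q μ)
    (h1 : Tendsto (fun k => eLpNorm (fun x => f k x - p x) 2 μ) atTop (𝓝 0))
    (h2 : Tendsto (fun k => eLpNorm (fun x => f k x - q x) 2 μ) atTop (𝓝 0)) : p =ᵐ[μ] q := by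
  have h := tendsto_eLpNorm_sub_sub (f := fun k x => f k x - q x) (g := fun k x => f k x - p x)
    (p := 0) (fun k => (hf k).sub hq) (fun k => (hf k).sub hp) aestronglyMeasurable_zero
    (by simpa using h2) (by simpa using h1)
  simp only [sub_sub_sub_cancel_left] at h
  have h0 := tendsto_nhds_unique tendsto_const_nhds h
  filter_upwards [(eLpNorm_eq_zero_iff (p := 2) (hp.sub hq) two_ne_zero).1 h0] with x hx
  exact sub_eq_zero.1 hx

theorem IsTraceSurface.trace_add (hΩ : IsBoundedLipschitz Ω) (hS : IsTraceSurface Ω S)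
    (hv : MemH1 Ω v) (hw : MemH1 Ω w) :
    trace Ω S (v + w) =ᵐ[surfaceMeasure S] trace Ω S v + trace Ω S w := by
  have gv := hv.isWeakGrad_weakGrad
  have gw := hw.isWeakGrad_weakGrad
  have hm : MemH1 Ω (v + w) := ⟨hv.1.add hw.1, _, gv.add hΩ.isBounded hv.1 hw.1 gw⟩
  obtain ⟨φ, hφ, -⟩ := gv.exists_isSmoothApprox hΩ hv.1
  obtain ⟨ψ, hψ, -⟩ := gw.exists_isSmoothApprox hΩ hw.1
  have hadd := hφ.add hψ hv.1.1 hw.1.1 gv.memLp.1 gw.memLp.1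
  have hadd' : IsSmoothApprox Ω (v + w) (weakGrad Ω (v + w)) fun k x => φ k x + ψ k x := by
    refine ⟨hadd.contDiff, hadd.hasCompactSupport, hadd.tendsto,
      hadd.tendsto_gradient.congr fun k => eLpNorm_congr_ae ?_⟩
    filter_upwards [weakGrad_add hΩ hv hw] with x hx
    rw [hx, Pi.add_apply]
  have hTv := (hS.isTrace_trace hΩ hv).1.1
  have hTw := (hS.isTrace_trace hΩ hw).1.1
  exact ae_eq_of_tendsto_eLpNorm_sub (fun k => (hadd.contDiff k).continuous.aestronglyMeasurable)
    (hS.isTrace_trace hΩ hm).1.1 (hTv.add hTw) (hS.tendsto_trace hΩ hm hadd')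
    (tendsto_eLpNorm_add_sub (fun k => (hφ.contDiff k).continuous.aestronglyMeasurable)
      (fun k => (hψ.contDiff k).continuous.aestronglyMeasurable) hTv hTw
      (hS.tendsto_trace hΩ hv hφ) (hS.tendsto_trace hΩ hw hψ))

/-- The trace of a function continuous up to the boundary is its restriction. -/
theorem IsTraceSurface.trace_eq (hΩ : IsBoundedLipschitz Ω) (hS : IsTraceSurface Ω S)
    (hv : MemH1 Ω v) (hvc : ContinuousOn v (closure Ω)) : trace Ω S v =ᵐ[surfaceMeasure S] v := by
  have hfin := hS.isFiniteMeasure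
  obtain ⟨φ, hφ, hφu⟩ := hv.isWeakGrad_weakGrad.exists_isSmoothApprox hΩ hv.1
  refine ae_eq_of_tendsto_eLpNorm_sub (fun k => (hφ.contDiff k).continuous.aestronglyMeasurable)
    (hS.isTrace_trace hΩ hv).1.1 (hS.memLp_two (hvc.mono hS.subset_closure)).1
    (hS.tendsto_trace hΩ hv hφ) ?_
  have hm : ∀ k, MemLp (fun x => φ k x - v x) 2 (surfaceMeasure S) := fun k =>
    hS.memLp_two ((hφ.contDiff k).continuous.continuousOn.sub (hvc.mono hS.subset_closure))
  rw [tendsto_eLpNorm_two_iff hm, Metric.tendsto_atTop]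
  intro ε hε
  obtain ⟨δ, hδ, hδε⟩ : ∃ δ : ℝ, 0 < δ ∧ δ ^ 2 * (surfaceMeasure S).real univ < ε := by
    have : Tendsto (fun δ : ℝ => δ ^ 2 * (surfaceMeasure S).real univ) (𝓝[>] 0) (𝓝 0) := by
      have h : Continuous fun δ : ℝ => δ ^ 2 * (surfaceMeasure S).real univ := by fun_prop
      simpa using (h.tendsto 0).mono_left nhdsWithin_le_nhds
    obtain ⟨δ, h1, h2⟩ := ((this.eventually_lt_const hε).and self_mem_nhdsWithin).exists
    exact ⟨δ, h2, h1⟩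
  obtain ⟨k₀, hk₀⟩ := eventually_atTop.1 (Metric.tendstoUniformlyOn_iff.1 (hφu hvc) δ hδ)
  refine ⟨k₀, fun k hk => ?_⟩
  rw [Real.dist_eq, sub_zero, abs_of_nonneg (integral_nonneg fun x => sq_nonneg _)]
  refine lt_of_le_of_lt ?_ hδε
  calc ∫ x, ‖φ k x - v x‖ ^ 2 ∂surfaceMeasure S ≤ ∫ _, δ ^ 2 ∂surfaceMeasure S := by
        refine integral_mono_ae (hm k).norm.integrable_sq (integrable_const _)
          (ae_restrict_of_forall_mem hS.isCompact.measurableSet fun x hx => ?_)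
        have := hk₀ k hk x (hS.subset_closure hx)
        rw [dist_comm, dist_eq_norm] at this
        simp only
        gcongr
    _ = _ := by rw [integral_const, smul_eq_mul, mul_comm]

/-- **Friedrichs inequality**, as far as uniqueness needs it: an `H¹` function with vanishing
gradient and vanishing boundary trace is zero. -/
theorem ae_eq_zero_of_weakGrad_of_trace (hd : 1 ≤ d) (hΩ : IsBoundedLipschitz Ω) (hv : MemH1 Ω v)
    (hg : weakGrad Ω v =ᵐ[volume.restrict Ω] 0)
    (ht : trace Ω (frontier Ω) v =ᵐ[surfaceMeasure (frontier Ω)] 0) :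
    v =ᵐ[volume.restrict Ω] 0 := by
  have hS := hΩ.isTraceSurface hd hΩ subset_rfl
  obtain ⟨C, -, hC⟩ := hΩ.exists_friedrichs_inequality hd
  obtain ⟨φ, hφ, -⟩ := hv.isWeakGrad_weakGrad.exists_isSmoothApprox hΩ hv.1
  have h1 : Tendsto (fun k => eLpNorm (gradient (φ k)) 2 (volume.restrict Ω)) atTop (𝓝 0) :=
    hφ.tendsto_gradient.congr fun k => eLpNorm_congr_ae (by
      filter_upwards [hg] with x hx
      rw [hx, Pi.zero_apply, sub_zero])
  have h2 : Tendsto (fun k => eLpNorm (φ k) 2 (surfaceMeasure (frontier Ω))) atTop (𝓝 0) :=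
    (hS.tendsto_trace hΩ hv hφ).congr fun k => eLpNorm_congr_ae (by
      filter_upwards [ht] with x hx
      rw [hx, Pi.zero_apply, sub_zero])
  have h3 : Tendsto (fun k => eLpNorm (φ k) 2 (volume.restrict Ω)) atTop (𝓝 0) := by
    rw [tendsto_eLpNorm_two_iff fun k =>
      (continuous_gradient (hφ.contDiff k)).memLp_two_of_isBoundedLipschitz hΩ] at h1
    rw [tendsto_eLpNorm_two_iff fun k =>
      hS.memLp_two (hφ.contDiff k).continuous.continuousOn] at h2
    rw [tendsto_eLpNorm_two_iff fun k =>
      (hφ.contDiff k).continuous.memLp_two_of_isBoundedLipschitz hΩ]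
    refine squeeze_zero (fun k => integral_nonneg fun x => sq_nonneg _) (fun k => ?_)
      (by simpa using (h1.add h2).const_mul C)
    simpa only [Real.norm_eq_abs, sq_abs] using hC (φ k) (hφ.contDiff k)
  exact ae_eq_of_tendsto_eLpNorm_sub (fun k => (hφ.contDiff k).continuous.aestronglyMeasurable)
    hv.1.1 aestronglyMeasurable_zero hφ.tendsto (by simpa using h3)

end Trace

/-! ### Expansion of the energy -/

section Energy

theorem tendsto_integral_inner {X E : Type*} [MeasurableSpace X] [NormedAddCommGroup E]
    [InnerProductSpace ℝ E] {μ : Measure X} {f : ℕ → X → E} {h p : X → E}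
    (hf : ∀ k, MemLp (f k) 2 μ) (hp : MemLp p 2 μ) (hh : MemLp h 2 μ)
    (hlim : Tendsto (fun k => eLpNorm (fun x => f k x - p x) 2 μ) atTop (𝓝 0)) :
    Tendsto (fun k => ∫ x, ⟪h x, f k x⟫ ∂μ) atTop (𝓝 (∫ x, ⟪h x, p x⟫ ∂μ)) := by
  have h1 := (Lp.tendsto_Lp_iff_tendsto_eLpNorm'' _ hf _ hp).2 hlim
  have h2 := (tendsto_const_nhds (x := hh.toLp h)).inner (𝕜 := ℝ) h1
  have e : ∀ {q : X → E} (hq : MemLp q 2 μ), ⟪hh.toLp h, hq.toLp q⟫ = ∫ x, ⟪h x, q x⟫ ∂μ := by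
    intro q hq
    rw [L2.inner_def]
    refine integral_congr_ae ?_
    filter_upwards [hh.coeFn_toLp, hq.coeFn_toLp] with x hx hx'
    rw [hx, hx']
  simpa only [e] using h2

variable {d : ℕ} {Ω : Set (Euc d)} {u z : Euc d → ℝ} {α β : ℝ} {f c g : Euc d → ℝ}

/-- A weak form that holds for smooth test functions holds for test functions in `H¹`. -/
theorem weak_form_memH1 {Γ : Set (Euc d)} (hΩ : IsBoundedLipschitz Ω) (hΓ : IsTraceSurface Ω Γ)
    (hS : IsTraceSurface Ω (frontier Ω)) {G : Euc d → Euc d} {D p q : Euc d → ℝ}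
    (hG : MemLp G 2 (volume.restrict Ω)) (hD : MemLp D 2 (volume.restrict Ω))
    (hp : MemLp p 2 (surfaceMeasure Γ)) (hq : MemLp q 2 (surfaceMeasure (frontier Ω)))
    (h : ∀ φ : Euc d → ℝ, ContDiff ℝ ∞ φ → HasCompactSupport φ →
      (∫ x in Ω, ⟪G x, gradient φ x⟫) + (∫ x in Ω, φ x * D x) +
        (∫ s, φ s * p s ∂(surfaceMeasure Γ)) + ∫ s, φ s * q s ∂(surfaceMeasure (frontier Ω)) = 0)
    (hz : MemH1 Ω z) :
    (∫ x in Ω, ⟪G x, weakGrad Ω z x⟫) + (∫ x in Ω, z x * D x) +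
      (∫ s, trace Ω Γ z s * p s ∂(surfaceMeasure Γ)) +
      ∫ s, trace Ω (frontier Ω) z s * q s ∂(surfaceMeasure (frontier Ω)) = 0 := by
  have hw := hz.isWeakGrad_weakGrad
  obtain ⟨φ, hφ, -⟩ := hw.exists_isSmoothApprox hΩ hz.1
  have hc : ∀ k, Continuous (φ k) := fun k => (hφ.contDiff k).continuous
  have l1 := tendsto_integral_inner (fun k =>
    (continuous_gradient (hφ.contDiff k)).memLp_two_of_isBoundedLipschitz hΩ) hw.memLp hG
    hφ.tendsto_gradient
  have l2 := tendsto_integral_inner (fun k => (hc k).memLp_two_of_isBoundedLipschitz hΩ) hz.1 hD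
    hφ.tendsto
  have l3 := tendsto_integral_inner (fun k => hΓ.memLp_two (hc k).continuousOn)
    (hΓ.isTrace_trace hΩ hz).1 hp (hΓ.tendsto_trace hΩ hz hφ)
  have l4 := tendsto_integral_inner (fun k => hS.memLp_two (hc k).continuousOn)
    (hS.isTrace_trace hΩ hz).1 hq (hS.tendsto_trace hΩ hz hφ)
  refine tendsto_nhds_unique (((l1.add l2).add l3).add l4) ?_
  refine tendsto_const_nhds.congr fun k => ?_
  exact (h (φ k) (hφ.contDiff k) (hφ.hasCompactSupport k)).symm

theorem integral_norm_add_sq {X E : Type*} [MeasurableSpace X] [NormedAddCommGroup E]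
    [InnerProductSpace ℝ E] {μ : Measure X} {p q : X → E} (hp : MemLp p 2 μ) (hq : MemLp q 2 μ) :
    ∫ x, ‖p x + q x‖ ^ 2 ∂μ =
      (∫ x, ‖p x‖ ^ 2 ∂μ) + 2 * (∫ x, ⟪p x, q x⟫ ∂μ) + ∫ x, ‖q x‖ ^ 2 ∂μ := by
  have h1 := hp.norm.integrable_sq
  have h2 := (hp.integrable_inner hq).const_mul 2
  have h3 : Integrable (fun x => ‖p x‖ ^ 2 + 2 * ⟪p x, q x⟫) μ := h1.add h2
  simp only [norm_add_sq_real]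
  rw [integral_add h3 hq.norm.integrable_sq, integral_add h1 h2, integral_const_mul]

theorem MeasureTheory.MemLp.integrable_fun_mul {X : Type*} [MeasurableSpace X] {μ : Measure X}
    {p q : X → ℝ} (hp : MemLp p 2 μ) (hq : MemLp q 2 μ) : Integrable (fun x => p x * q x) μ :=
  hp.integrable_mul hq

/-- Expansion of the energy at a point where the weak form holds: the first-order terms cancel. -/
theorem penalizedEnergy_add {Γ : Set (Euc d)} (hΩ : IsBoundedLipschitz Ω)
    (hΓ : IsTraceSurface Ω Γ) (hS : IsTraceSurface Ω (frontier Ω))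
    (hf : MemLp f 2 (volume.restrict Ω)) (hc : MemLp c 2 (surfaceMeasure Γ))
    (hg : MemLp g 2 (surfaceMeasure (frontier Ω))) (hu : MemH1 Ω u) (hz : MemH1 Ω z)
    (h : (∫ x in Ω, ⟪weakGrad Ω u x, weakGrad Ω z x⟫) + (∫ x in Ω, z x * (α * u x + f x)) +
      (∫ s, trace Ω Γ z s * c s ∂(surfaceMeasure Γ)) +
      ∫ s, trace Ω (frontier Ω) z s * (2 * β * (trace Ω (frontier Ω) u s - g s))
        ∂(surfaceMeasure (frontier Ω)) = 0) :
    penalizedEnergy Ω Γ α β f c g (u + z) = penalizedEnergy Ω Γ α β f c g u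
      + (1 / 2) * (∫ x in Ω, ‖weakGrad Ω z x‖ ^ 2) + (α / 2) * (∫ x in Ω, z x ^ 2)
      + β * (∫ s, trace Ω (frontier Ω) z s ^ 2 ∂(surfaceMeasure (frontier Ω))) := by
  have hTu := (hS.isTrace_trace hΩ hu).1
  have hTz := (hS.isTrace_trace hΩ hz).1
  have hΓu := (hΓ.isTrace_trace hΩ hu).1
  have hΓz := (hΓ.isTrace_trace hΩ hz).1
  have e1 : ∫ x in Ω, ‖weakGrad Ω (u + z) x‖ ^ 2 = (∫ x in Ω, ‖weakGrad Ω u x‖ ^ 2) +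
      2 * (∫ x in Ω, ⟪weakGrad Ω u x, weakGrad Ω z x⟫) + ∫ x in Ω, ‖weakGrad Ω z x‖ ^ 2 := by
    rw [← integral_norm_add_sq hu.isWeakGrad_weakGrad.memLp hz.isWeakGrad_weakGrad.memLp]
    refine integral_congr_ae ?_
    filter_upwards [weakGrad_add hΩ hu hz] with x hx
    rw [hx, Pi.add_apply]
  have e2 : ∫ x in Ω, (u + z) x ^ 2 =
      (∫ x in Ω, u x ^ 2) + 2 * (∫ x in Ω, z x * u x) + ∫ x in Ω, z x ^ 2 := by
    have := integral_norm_add_sq hu.1 hz.1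
    simpa only [Real.norm_eq_abs, sq_abs, RCLike.inner_apply, conj_trivial, Pi.add_apply] using this
  have e3 : ∫ x in Ω, (u + z) x * f x = (∫ x in Ω, u x * f x) + ∫ x in Ω, z x * f x := by
    simp only [Pi.add_apply, add_mul]
    exact integral_add (hu.1.integrable_fun_mul hf) (hz.1.integrable_fun_mul hf)
  have e4 : ∫ s, c s * trace Ω Γ (u + z) s ∂(surfaceMeasure Γ) =
      (∫ s, c s * trace Ω Γ u s ∂(surfaceMeasure Γ)) +
        ∫ s, trace Ω Γ z s * c s ∂(surfaceMeasure Γ) := by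
    rw [← integral_add (hc.integrable_fun_mul hΓu) (hΓz.integrable_fun_mul hc)]
    refine integral_congr_ae ?_
    filter_upwards [hΓ.trace_add hΩ hu hz] with s hs
    rw [hs, Pi.add_apply]
    ring
  have e5 : ∫ s, (trace Ω (frontier Ω) (u + z) s - g s) ^ 2 ∂(surfaceMeasure (frontier Ω)) =
      (∫ s, (trace Ω (frontier Ω) u s - g s) ^ 2 ∂(surfaceMeasure (frontier Ω))) +
      2 * (∫ s, trace Ω (frontier Ω) z s * (trace Ω (frontier Ω) u s - g s)
        ∂(surfaceMeasure (frontier Ω))) +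
      ∫ s, trace Ω (frontier Ω) z s ^ 2 ∂(surfaceMeasure (frontier Ω)) := by
    have := integral_norm_add_sq (hTu.sub hg) hTz
    simp only [Real.norm_eq_abs, sq_abs, RCLike.inner_apply, conj_trivial, Pi.sub_apply] at this
    rw [← this]
    refine integral_congr_ae ?_
    filter_upwards [hS.trace_add hΩ hu hz] with s hs
    rw [hs, Pi.add_apply]
    ring
  have e6 : ∫ x in Ω, z x * (α * u x + f x) =
      α * (∫ x in Ω, z x * u x) + ∫ x in Ω, z x * f x := by
    rw [← integral_const_mul, ← integral_add ((hz.1.integrable_fun_mul hu.1).const_mul α)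
      (hz.1.integrable_fun_mul hf)]
    refine integral_congr_ae (Eventually.of_forall fun x => ?_)
    simp only
    ring
  have e7 : ∫ s, trace Ω (frontier Ω) z s * (2 * β * (trace Ω (frontier Ω) u s - g s))
        ∂(surfaceMeasure (frontier Ω)) = 2 * β * ∫ s, trace Ω (frontier Ω) z s *
          (trace Ω (frontier Ω) u s - g s) ∂(surfaceMeasure (frontier Ω)) := by
    rw [← integral_const_mul]
    refine integral_congr_ae (Eventually.of_forall fun s => ?_)
    simp only
    ring
  rw [e6, e7] at h
  simp only [penalizedEnergy, e1, e2, e3, e4, e5]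
  linarith

end Energy

end

theorem mainTheorem1 {d : ℕ} (hd : 1 ≤ d)
    (Ω Ωm Ωp Γ : Set (Euc d))
    (hΩ : IsBoundedLipschitz Ω) (hΩm : IsBoundedLipschitz Ωm) (hsub : closure Ωm ⊆ Ω)
    (hΓ : Γ = frontier Ωm) (hΩp : Ωp = Ω \ closure Ωm)
    (α β : ℝ) (hα : 0 ≤ α) (hβ : 0 < β)
    (f c g : Euc d → ℝ)
    (hf : MemLp f 2 (volume.restrict Ω))
    (hc : MemLp c 2 (surfaceMeasure Γ))
    (hg : MemLp g 2 (surfaceMeasure (frontier Ω)))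
    (u : Euc d → ℝ)
    (hucont : ContinuousOn u (closure Ω))
    (hum : IsC2UpToBoundary Ωm u) (hup : IsC2UpToBoundary Ωp u)
    (hpde : ∀ᵐ x ∂(volume.restrict (Ω \ Γ)), Δ u x - α * u x = f x)
    (hjump : ∀ᵐ s ∂(surfaceMeasure Γ), ∀ n, IsOuterUnitNormal Ωm s n →
      ⟪gradFrom Ωp u s, n⟫ - ⟪gradFrom Ωm u s, n⟫ = c s)
    (hrobin : ∀ᵐ s ∂(surfaceMeasure (frontier Ω)), ∀ n, IsOuterUnitNormal Ω s n →
      u s + 1 / (2 * β) * ⟪gradFrom Ωp u s, n⟫ = g s) :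
    MemH1 Ω u ∧
    (∀ v, MemH1 Ω v →
      penalizedEnergy Ω Γ α β f c g v = penalizedEnergy Ω Γ α β f c g u
        + (1 / 2) * (∫ x in Ω, ‖weakGrad Ω (v - u) x‖ ^ 2)
        + (α / 2) * (∫ x in Ω, (v x - u x) ^ 2)
        + β * (∫ s, (trace Ω (frontier Ω) (v - u) s) ^ 2 ∂(surfaceMeasure (frontier Ω)))) ∧
    IsMinOn (penalizedEnergy Ω Γ α β f c g) {v | MemH1 Ω v} u ∧
    (∀ w, MemH1 Ω w → IsMinOn (penalizedEnergy Ω Γ α β f c g) {v | MemH1 Ω v} w →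
      w =ᵐ[volume.restrict Ω] u) := by
  subst hΓ
  have hmΩ : Ωm ⊆ Ω := subset_closure.trans hsub
  have hS := hΩ.isTraceSurface hd hΩ subset_rfl
  have hΓ := hΩ.isTraceSurface hd hΩm hmΩ
  have hGu := isWeakGrad_gradient hd hΩ hΩm hsub hΩp hucont hum hup
  have hu : MemH1 Ω u := ⟨hucont.memLp_two_of_isBoundedLipschitz hΩ, _, hGu⟩
  have hus := hS.memLp_two (hucont.mono hS.subset_closure)
  have hTu := hS.trace_eq hΩ hu hucont
  have hexp : ∀ v, MemH1 Ω v →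
      penalizedEnergy Ω (frontier Ωm) α β f c g v = penalizedEnergy Ω (frontier Ωm) α β f c g u
        + (1 / 2) * (∫ x in Ω, ‖weakGrad Ω (v - u) x‖ ^ 2)
        + (α / 2) * (∫ x in Ω, (v x - u x) ^ 2)
        + β * (∫ s, (trace Ω (frontier Ω) (v - u) s) ^ 2 ∂(surfaceMeasure (frontier Ω))) := by
    intro v hv
    have hz := hv.sub hΩ.isBounded hu
    have hweak := weak_form_memH1 hΩ hΓ hS hGu.memLp ((hu.1.const_mul α).add hf) hc
      ((hus.sub hg).const_mul (2 * β)) (fun φ hφ hφc => weak_form hd hΩ hΩm hsub hΩp hβ hf hc hg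
        hucont hum hup hpde hjump hrobin hφ hφc) hz
    have hE := penalizedEnergy_add (α := α) (β := β) hΩ hΓ hS hf hc hg hu hz (by
      rw [← hweak]
      congr 1
      · congr 2
        refine integral_congr_ae ?_
        filter_upwards [hu.isWeakGrad_weakGrad.ae_eq hΩ hGu] with x hx
        rw [hx]
      · refine integral_congr_ae ?_
        filter_upwards [hTu] with s hs
        simp only [hs, Pi.sub_apply])
    rw [add_sub_cancel] at hE
    exact hE
  have hnn : ∀ v, 0 ≤ (1 / 2) * (∫ x in Ω, ‖weakGrad Ω (v - u) x‖ ^ 2) ∧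
      0 ≤ (α / 2) * (∫ x in Ω, (v x - u x) ^ 2) ∧
      0 ≤ β * (∫ s, (trace Ω (frontier Ω) (v - u) s) ^ 2 ∂(surfaceMeasure (frontier Ω))) :=
    fun v => ⟨mul_nonneg (by norm_num) (integral_nonneg fun _ => sq_nonneg _),
      mul_nonneg (by linarith) (integral_nonneg fun _ => sq_nonneg _),
      mul_nonneg hβ.le (integral_nonneg fun _ => sq_nonneg _)⟩
  refine ⟨hu, hexp, fun v hv => ?_, fun w hw hmin => ?_⟩
  · obtain ⟨h1, h2, h3⟩ := hnn v
    have := hexp v hv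
    change penalizedEnergy Ω (frontier Ωm) α β f c g u ≤ penalizedEnergy Ω (frontier Ωm) α β f c g v
    linarith
  · have hle : penalizedEnergy Ω (frontier Ωm) α β f c g w ≤
        penalizedEnergy Ω (frontier Ωm) α β f c g u := hmin hu
    obtain ⟨h1, h2, h3⟩ := hnn w
    have hw' := hexp w hw
    have hz := hw.sub hΩ.isBounded hu
    have h0 : ∫ x in Ω, ‖weakGrad Ω (w - u) x‖ ^ 2 = 0 := by linarith
    have h0' : ∫ s, (trace Ω (frontier Ω) (w - u) s) ^ 2 ∂(surfaceMeasure (frontier Ω)) = 0 :=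
      (mul_eq_zero.1 (by linarith)).resolve_left hβ.ne'
    have hz0 := ae_eq_zero_of_weakGrad_of_trace hd hΩ hz (by
        filter_upwards [(integral_eq_zero_iff_of_nonneg (fun _ => sq_nonneg _)
          hz.isWeakGrad_weakGrad.memLp.norm.integrable_sq).1 h0] with x hx
        simpa using hx) (by
        filter_upwards [(integral_eq_zero_iff_of_nonneg (fun _ => sq_nonneg _)
          (hS.isTrace_trace hΩ hz).1.integrable_sq).1 h0'] with x hx
        simpa using hx)
    filter_upwards [hz0] with x hx
    exact sub_eq_zero.1 hx
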